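/- All locally convex spaces below are complex. A \emph{$\widehat\otimes$-algebra} is a unital associative complex algebra $A$ whose underlying space is a complete Hausdorff locally convex space and whose multiplication $A\times A\to A$ is jointly continuous. Here $\widehat\otimes$ denotes the completed projective tensor product. Homomorphisms of $\widehat\otimes$-algebras are continuous and unital. A (left or right) \emph{$\widehat\otimes$-module} over $A$ is a unital $A$-module whose underlying space is a complete Hausdorff locally convex space and whose action is jointly continuous; morphisms are the continuous $A$-linear maps. For a right module $X$ and a left module $Y$, $X\widehat\otimes_A Y$ is the completion of $(X\widehat\otimes Y)/N$, where $N$ is the closed linear span of all elements $xa\otimes y-x\otimes ay$. A complex of complete locally convex spaces is \emph{admissible} if it splits, i.e. if it has a contracting homotopy consisting of continuous linear maps. A left $\widehat\otimes$-module $P$ is \emph{projective} if every morphism $P\to Y$ lifts along every morphism of $\widehat\otimes$-modules $X\to Y$ that has a continuous linear right inverse. A \emph{projective resolution} of $Y$ is an admissible complex $0\leftarrow Y\leftarrow Q_0\leftarrow Q_1\leftarrow\cdots$ of left $\widehat\otimes$-modules with all $Q_n$ projective. A right module $X$ is \emph{strongly transversal} to a left module $Y$ over $A$ if, for some projective resolution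 $0\leftarrow Y\leftarrow Q_\bullet$ of $Y$, the complex $0\leftarrow X\widehat\otimes_A Y\leftarrow X\widehat\otimes_A Q_\bullet$ is admissible. A \emph{Hopf $\widehat\otimes$-algebra} is a Hopf algebra in the symmetric monoidal category of complete Hausdorff locally convex spaces with the tensor product $\widehat\otimes$; a homomorphism of Hopf $\widehat\otimes$-algebras is a homomorphism of $\widehat\otimes$-algebras that respects the comultiplications and the counits (hence also the antipodes). The antipode is \emph{invertible} if it is a topological isomorphism. Let $\theta\colon A\to B$ be a homomorphism of $\widehat\otimes$-algebras, so that $B$ is a left and a right $\widehat\otimes$-module over $A$ via $\theta$. (1) $\theta$ is a \emph{localization} if the map $B\widehat\otimes_A B\to B$, $b_1\otimes b_2\mapsto b_1b_2$, is a topological isomorphism and $B$ is strongly transversal to $B$ over $A$. (2) If $A$ and $B$ are augmented by homomorphisms $\varepsilon_A\colon A\to\mathbb C$ and $\varepsilon_B\colon B\to\mathbb C$ with $\varepsilon_B\theta=\varepsilon_A$, and $\mathbb C$ is regarded as an $A$-module via $\varepsilon_A$, then $\theta$ is a \emph{weak localization} if $B$ is strongly transversal to $\mathbb C$ over $A$ and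 the map $B\widehat\otimes_A\mathbb C\to\mathbb C$, $b\otimes\lambda\mapsto\varepsilon_B(b)\lambda$, is a topological isomorphism. \textbf{Proposition.} Let $\theta\colon U\to H$ be a homomorphism of Hopf $\widehat\otimes$-algebras with invertible antipodes, augmented by their counits. Then $\theta$ is a localization if and only if it is a weak localization. -/

import Mathlib

open scoped TensorProduct Topology

universe u v w w'

noncomputable section

namespace TopHom

/-! ## Locally convex spaces and completions -/

/-- A (complex, not necessarily Hausdorff) locally convex space. -/
class IsLCS (E : Type*) [AddCommGroup E] [Module ℂ E] [TopologicalSpace E] : Prop extends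
  IsTopologicalAddGroup E, ContinuousSMul ℂ E, LocallyConvexSpace ℝ E

/-- A complete Hausdorff (complex) locally convex space. -/
class IsCompleteLCS (E : Type*) [AddCommGroup E] [Module ℂ E] [UniformSpace E] : Prop extends
  IsUniformAddGroup E, ContinuousSMul ℂ E, LocallyConvexSpace ℝ E, CompleteSpace E, T2Space E

instance (priority := 100) IsCompleteLCS.isLCS (E : Type*) [AddCommGroup E] [Module ℂ E]
    [UniformSpace E] [IsCompleteLCS E] : IsLCS E where

instance : IsCompleteLCS ℂ where

section CompletionDef

variable (Q : Type*) [AddCommGroup Q] [Module ℂ Q] [TopologicalSpace Q] [IsLCS Q]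

/-- The space `Q`, to be equipped with its canonical (translation invariant) uniformity. -/
def Unif (Q : Type*) : Type _ := Q


instance : AddCommGroup (Unif Q) := inferInstanceAs (AddCommGroup Q)

instance : Module ℂ (Unif Q) := inferInstanceAs (Module ℂ Q)

instance : UniformSpace (Unif Q) := IsTopologicalAddGroup.rightUniformSpace Q

instance : IsUniformAddGroup (Unif Q) :=
  @isUniformAddGroup_of_addCommGroup Q _ _ _

instance : ContinuousConstSMul ℂ (Unif Q) := inferInstanceAs (ContinuousConstSMul ℂ Q)

instance : UniformContinuousConstSMul ℂ (Unif Q) :=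
  uniformContinuousConstSMul_of_continuousConstSMul ℂ (Unif Q)

/-- The (Hausdorff) completion of a locally convex space. -/
def Cpl : Type _ := UniformSpace.Completion (Unif Q)

instance : UniformSpace (Cpl Q) := inferInstanceAs (UniformSpace (UniformSpace.Completion (Unif Q)))

instance : AddCommGroup (Cpl Q) := inferInstanceAs (AddCommGroup (UniformSpace.Completion (Unif Q)))

instance : Module ℂ (Cpl Q) := inferInstanceAs (Module ℂ (UniformSpace.Completion (Unif Q)))

instance : IsUniformAddGroup (Cpl Q) :=
  inferInstanceAs (IsUniformAddGroup (UniformSpace.Completion (Unif Q)))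

instance : CompleteSpace (Cpl Q) :=
  inferInstanceAs (CompleteSpace (UniformSpace.Completion (Unif Q)))

instance : T2Space (Cpl Q) := inferInstanceAs (T2Space (UniformSpace.Completion (Unif Q)))

instance : ContinuousConstSMul ℂ (Cpl Q) :=
  inferInstanceAs (ContinuousConstSMul ℂ (UniformSpace.Completion (Unif Q)))

/-- The canonical map of a locally convex space into its completion. -/
def Cpl.ι : Q →L[ℂ] Cpl Q where
  toFun := fun x => ((show Unif Q from x : Unif Q) : UniformSpace.Completion (Unif Q))
  map_add' := UniformSpace.Completion.coe_add (α := Unif Q)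
  map_smul' := fun c x => UniformSpace.Completion.coe_smul c (show Unif Q from x)
  cont := UniformSpace.Completion.continuous_coe (Unif Q)

theorem Cpl.isDenseInducing_ι : IsDenseInducing (Cpl.ι Q) :=
  UniformSpace.Completion.isDenseInducing_coe (α := Unif Q)

variable {Q}

theorem Cpl.closure_mem_nhds {S : Set Q} (hS : S ∈ 𝓝 (0 : Q)) :
    closure (Cpl.ι Q '' S) ∈ 𝓝 (0 : Cpl Q) := by
  have := (Cpl.isDenseInducing_ι Q).closure_image_mem_nhds hS
  rwa [map_zero] at this

theorem Cpl.mem_nhds_of_isClosed {S : Set (Cpl Q)} (hc : IsClosed S)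
    (hS : Cpl.ι Q ⁻¹' S ∈ 𝓝 (0 : Q)) : S ∈ 𝓝 (0 : Cpl Q) :=
  Filter.mem_of_superset (Cpl.closure_mem_nhds hS)
    (closure_minimal (Set.image_preimage_subset _ _) hc)

instance : LocallyConvexSpace ℝ (Cpl Q) := by
  rw [locallyConvexSpace_iff_exists_convex_subset_zero]
  intro U hU
  obtain ⟨C, ⟨hC, hCc⟩, hCU⟩ := (closed_nhds_basis (0 : Cpl Q)).mem_iff.1 hU
  have h1 : Cpl.ι Q ⁻¹' C ∈ 𝓝 (0 : Q) :=
    (Cpl.ι Q).continuous.continuousAt.preimage_mem_nhds (by rwa [map_zero])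
  obtain ⟨S, hS, hSc, hSC⟩ := (locallyConvexSpace_iff_exists_convex_subset_zero ℝ Q).1
    inferInstance _ h1
  refine ⟨_, Cpl.closure_mem_nhds hS, ?_, ?_⟩
  · have : ContinuousConstSMul ℝ (Cpl Q) :=
      ⟨fun r => continuous_const_smul (r : ℂ)⟩
    exact (hSc.linear_image ((Cpl.ι Q).toLinearMap.restrictScalars ℝ)).closure
  · exact (closure_minimal (Set.image_subset_iff.2 hSC) hCc).trans hCU

instance : ContinuousSMul ℂ (Cpl Q) := by
  constructor
  let f : ℂ →+ Cpl Q →+ Cpl Q := smulAddHom ℂ (Cpl Q)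
  refine continuous_of_continuousAt_zero₂ f ?_ ?_ ?_
  · simp only [ContinuousAt, f, smulAddHom_apply, zero_smul]
    intro U hU
    obtain ⟨C, ⟨hC, hCc⟩, hCU⟩ := (closed_nhds_basis (0 : Cpl Q)).mem_iff.1 hU
    have h1 : Cpl.ι Q ⁻¹' C ∈ 𝓝 (0 : Q) :=
      (Cpl.ι Q).continuous.continuousAt.preimage_mem_nhds (by rwa [map_zero])
    have h2 : Filter.Tendsto (fun p : ℂ × Q => p.1 • p.2) (𝓝 0 ×ˢ 𝓝 0) (𝓝 0) := by
      have := (continuous_smul (M := ℂ) (X := Q)).tendsto (0, 0)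
      rwa [zero_smul, nhds_prod_eq] at this
    obtain ⟨V, hV, W, hW, hVW⟩ := Filter.mem_prod_iff.1 (h2 h1)
    have h3 : {x : Cpl Q | ∀ z ∈ V, z • x ∈ C} ∈ 𝓝 (0 : Cpl Q) := by
      refine Cpl.mem_nhds_of_isClosed ?_ (Filter.mem_of_superset hW fun x hx z hz => ?_)
      · simp only [Set.ofPred_forall]
        exact isClosed_iInter fun z => isClosed_iInter fun _ =>
          hCc.preimage (continuous_const_smul z)
      · have h4 : (z, x) ∈ (fun p : ℂ × Q => p.1 • p.2) ⁻¹' (Cpl.ι Q ⁻¹' C) := hVW ⟨hz, hx⟩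
        simpa using h4
    have h5 : V ×ˢ {x : Cpl Q | ∀ z ∈ V, z • x ∈ C} ∈ 𝓝 (((0 : ℂ), (0 : Cpl Q))) :=
      prod_mem_nhds hV h3
    exact Filter.mem_map.2 <| Filter.mem_of_superset h5 fun p hp => hCU (hp.2 p.1 hp.1)
  · intro z
    exact (continuous_const_smul z).continuousAt
  · intro x
    let g : ℂ →+ Cpl Q := (LinearMap.toSpanSingleton ℂ (Cpl Q) x).toAddMonoidHom
    change ContinuousAt g 0
    simp only [ContinuousAt, map_zero]
    intro U hU
    obtain ⟨V, hV, hVU⟩ := exists_nhds_zero_half hU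
    obtain ⟨B, hB, hBb, hBV⟩ : ∃ B ∈ 𝓝 (0 : Cpl Q), (∀ z : ℂ, ‖z‖ ≤ 1 → ∀ y ∈ B, z • y ∈ V) ∧
        B ⊆ V := by
      obtain ⟨C, ⟨hC, hCc⟩, hCV⟩ := (closed_nhds_basis (0 : Cpl Q)).mem_iff.1 hV
      have h1 : Cpl.ι Q ⁻¹' C ∈ 𝓝 (0 : Q) :=
        (Cpl.ι Q).continuous.continuousAt.preimage_mem_nhds (by rwa [map_zero])
      have h2 : {y : Cpl Q | ∀ z : ℂ, ‖z‖ ≤ 1 → z • y ∈ C} ∈ 𝓝 (0 : Cpl Q) := by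
        refine Cpl.mem_nhds_of_isClosed ?_
          (Filter.mem_of_superset (balancedCore_mem_nhds_zero (𝕜 := ℂ) h1) fun y hy z hz => ?_)
        · simp only [Set.ofPred_forall]
          exact isClosed_iInter fun z => isClosed_iInter fun _ =>
            hCc.preimage (continuous_const_smul z)
        · have := balancedCore_subset _
            ((balancedCore_balanced (𝕜 := ℂ) (Cpl.ι Q ⁻¹' C)).smul_mem hz hy)
          simpa using this
      exact ⟨_, h2, fun z hz y hy => hCV (hy z hz),
        fun y hy => hCV (by simpa using hy 1 (by simp))⟩
    obtain ⟨q, hq⟩ : ∃ q : Q, x - Cpl.ι Q q ∈ B := by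
      have h3 : (fun y => x - y) ⁻¹' B ∈ 𝓝 x := by
        refine (continuous_const.sub continuous_id).continuousAt.preimage_mem_nhds ?_
        simpa using hB
      obtain ⟨y, hy, q, rfl⟩ := mem_closure_iff_nhds.1 ((Cpl.isDenseInducing_ι Q).dense x) _ h3
      exact ⟨q, hy⟩
    have h4 : Filter.Tendsto (fun z : ℂ => Cpl.ι Q (z • q)) (𝓝 0) (𝓝 0) := by
      have : Continuous fun z : ℂ => Cpl.ι Q (z • q) :=
        (Cpl.ι Q).continuous.comp (continuous_id.smul continuous_const)
      simpa using this.tendsto 0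
    change g ⁻¹' U ∈ 𝓝 0
    filter_upwards [h4 hV, Metric.closedBall_mem_nhds (0 : ℂ) one_pos] with z hz1 hz2
    have h5 := hVU _ (hBb z (by simpa using hz2) _ hq) _ hz1
    simpa [g, smul_sub] using h5

instance : IsCompleteLCS (Cpl Q) where

/-- The extension of a continuous linear map, with values in a complete Hausdorff locally convex
space, to the completion. -/
def Cpl.extend {K : Type*} [AddCommGroup K] [Module ℂ K] [UniformSpace K] [IsCompleteLCS K]
    (f : Q →L[ℂ] K) : Cpl Q →L[ℂ] K :=
  haveI : UniformContinuousConstSMul ℂ K := uniformContinuousConstSMul_of_continuousConstSMul ℂ K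
  let g : Unif Q →L[ℂ] K :=
    { toFun := f, map_add' := f.map_add, map_smul' := f.map_smul, cont := f.continuous }
  { toFun := g.fromCompletion, map_add' := g.fromCompletion.map_add,
    map_smul' := g.fromCompletion.map_smul, cont := g.fromCompletion.continuous }

@[simp]
theorem Cpl.extend_ι {K : Type*} [AddCommGroup K] [Module ℂ K] [UniformSpace K] [IsCompleteLCS K]
    (f : Q →L[ℂ] K) (x : Q) : Cpl.extend f (Cpl.ι Q x) = f x :=
  haveI : UniformContinuousConstSMul ℂ K := uniformContinuousConstSMul_of_continuousConstSMul ℂ K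
  let g : Unif Q →L[ℂ] K :=
    { toFun := f, map_add' := f.map_add, map_smul' := f.map_smul, cont := f.continuous }
  g.fromCompletion_apply_coe x

theorem Cpl.ext {K : Type*} [AddCommGroup K] [Module ℂ K] [TopologicalSpace K] [T2Space K]
    {f g : Cpl Q →L[ℂ] K} (h : ∀ x : Q, f (Cpl.ι Q x) = g (Cpl.ι Q x)) : f = g :=
  ContinuousLinearMap.ext fun t => congrFun
    ((Cpl.isDenseInducing_ι Q).dense.equalizer f.continuous g.continuous (funext h)) t

end CompletionDef

/-! ## The completed projective tensor product -/

theorem isLCS_induced {M N : Type*} [AddCommGroup M] [Module ℂ M] [AddCommGroup N] [Module ℂ N]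
    [t : TopologicalSpace N] [IsLCS N] (f : M →ₗ[ℂ] N) : @IsLCS M _ _ (t.induced f) :=
  @IsLCS.mk _ _ _ (t.induced f) (topologicalAddGroup_induced f) (continuousSMul_induced f)
    (LocallyConvexSpace.induced (f.restrictScalars ℝ))

theorem isLCS_sInf {M : Type*} [AddCommGroup M] [Module ℂ M] {ts : Set (TopologicalSpace M)}
    (h : ∀ t ∈ ts, @IsLCS M _ _ t) : @IsLCS M _ _ (sInf ts) :=
  @IsLCS.mk _ _ _ (sInf ts) (topologicalAddGroup_sInf fun t ht => (h t ht).toIsTopologicalAddGroup)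
    (continuousSMul_sInf fun t ht => (h t ht).toContinuousSMul)
    (LocallyConvexSpace.sInf fun t ht => (h t ht).toLocallyConvexSpace)

theorem exists_isLCS_of_seminorm {M : Type*} [AddCommGroup M] [Module ℂ M] (p : Seminorm ℂ M) :
    ∃ t : TopologicalSpace M, @IsLCS M _ _ t ∧
      (@nhds M t 0).HasBasis (fun r : ℝ => 0 < r) (fun r => p.ball 0 r) := by
  let q : SeminormFamily ℂ M Unit := fun _ => p
  let t : TopologicalSpace M := q.moduleFilterBasis.topology
  have hq : WithSeminorms q := ⟨rfl⟩
  have h1 := hq.topologicalAddGroup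
  have h2 := hq.continuousSMul
  have h3 : LocallyConvexSpace ℝ M := hq.toLocallyConvexSpace
  refine ⟨t, @IsLCS.mk _ _ _ _ h1 h2 h3, ?_⟩
  refine hq.hasBasis_zero_ball.to_hasBasis ?_ ?_
  · rintro ⟨s, r⟩ hr
    refine ⟨r, hr, ?_⟩
    have : s.sup q ≤ p := Finset.sup_le fun _ _ => le_rfl
    exact Seminorm.ball_antitone this
  · intro r hr
    refine ⟨({()}, r), hr, ?_⟩
    simp [q]

theorem exists_smul_mem_of_mem_nhds {E : Type*} [AddCommGroup E] [Module ℂ E] [TopologicalSpace E]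
    [IsLCS E] {U : Set E} (hU : U ∈ 𝓝 0) (x : E) : ∃ r : ℝ, 0 < r ∧ (r : ℂ) • x ∈ U := by
  have h : Filter.Tendsto (fun r : ℝ => (r : ℂ) • x) (𝓝[>] 0) (𝓝 0) := by
    have : Continuous fun r : ℝ => (r : ℂ) • x :=
      Complex.continuous_ofReal.smul continuous_const
    have := this.tendsto 0
    simp only [Complex.ofReal_zero, zero_smul] at this
    exact this.mono_left nhdsWithin_le_nhds
  obtain ⟨r, hr1, hr2⟩ := ((h.eventually hU).and self_mem_nhdsWithin).exists
  exact ⟨r, hr2, hr1⟩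

section ProjectiveTensor

/-- The algebraic tensor product, to be equipped with the projective topology. -/
def ProjTensor (E F : Type*) [AddCommGroup E] [Module ℂ E] [AddCommGroup F] [Module ℂ F] :
    Type _ := E ⊗[ℂ] F

instance (E F : Type*) [AddCommGroup E] [Module ℂ E] [AddCommGroup F] [Module ℂ F] :
    AddCommGroup (ProjTensor E F) := inferInstanceAs (AddCommGroup (E ⊗[ℂ] F))

instance (E F : Type*) [AddCommGroup E] [Module ℂ E] [AddCommGroup F] [Module ℂ F] :
    Module ℂ (ProjTensor E F) := inferInstanceAs (Module ℂ (E ⊗[ℂ] F))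

/-- The canonical bilinear map `(x, y) ↦ x ⊗ y` into the algebraic tensor product. -/
def ProjTensor.mk (E F : Type*) [AddCommGroup E] [Module ℂ E] [AddCommGroup F] [Module ℂ F] :
    E →ₗ[ℂ] F →ₗ[ℂ] ProjTensor E F := TensorProduct.mk ℂ E F

/-- The linear map on the algebraic tensor product given by a bilinear map. -/
def ProjTensor.lift {E F K : Type*} [AddCommGroup E] [Module ℂ E] [AddCommGroup F] [Module ℂ F]
    [AddCommGroup K] [Module ℂ K] (b : E →ₗ[ℂ] F →ₗ[ℂ] K) : ProjTensor E F →ₗ[ℂ] K :=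
  TensorProduct.lift b

@[simp]
theorem ProjTensor.lift_mk {E F K : Type*} [AddCommGroup E] [Module ℂ E] [AddCommGroup F]
    [Module ℂ F] [AddCommGroup K] [Module ℂ K] (b : E →ₗ[ℂ] F →ₗ[ℂ] K) (x : E) (y : F) :
    ProjTensor.lift b (ProjTensor.mk E F x y) = b x y := TensorProduct.lift.tmul x y

theorem ProjTensor.induction {E F : Type*} [AddCommGroup E] [Module ℂ E] [AddCommGroup F]
    [Module ℂ F] {p : ProjTensor E F → Prop} (t : ProjTensor E F) (h0 : p 0)
    (hmk : ∀ x y, p (ProjTensor.mk E F x y)) (hadd : ∀ s t, p s → p t → p (s + t)) : p t :=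
  TensorProduct.induction_on (motive := p) t h0 hmk hadd

variable (E F G K : Type*) [AddCommGroup E] [Module ℂ E] [AddCommGroup F] [Module ℂ F]
  [AddCommGroup G] [Module ℂ G] [AddCommGroup K] [Module ℂ K]

section Topology

variable [TopologicalSpace E] [TopologicalSpace F] [TopologicalSpace G]

/-- The projective topology: the finest locally convex topology on the algebraic tensor product
for which the canonical bilinear map `E × F → E ⊗ F` is (jointly) continuous. -/
instance : TopologicalSpace (ProjTensor E F) :=
  sInf {t | @IsLCS (ProjTensor E F) _ _ t ∧
    Continuous[_, t] fun p : E × F => ProjTensor.mk E F p.1 p.2}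

instance : IsLCS (ProjTensor E F) := isLCS_sInf fun _ ht => ht.1

theorem ProjTensor.continuous_mk :
    Continuous fun p : E × F => ProjTensor.mk E F p.1 p.2 :=
  continuous_sInf_rng.2 fun _ ht => ht.2

variable {E F G K}

theorem ProjTensor.continuous_lift [TopologicalSpace K] [IsLCS K] (b : E →ₗ[ℂ] F →ₗ[ℂ] K)
    (hb : Continuous fun p : E × F => b p.1 p.2) : Continuous (ProjTensor.lift b) := by
  refine continuous_sInf_dom (t := TopologicalSpace.induced (ProjTensor.lift b) inferInstance)
    (Set.mem_ofPred.2 ⟨isLCS_induced (ProjTensor.lift b), continuous_induced_rng.2 ?_⟩)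
    continuous_induced_dom
  simpa [Function.comp_def] using hb

theorem setOf_smul_mem_mem_nhds {X : Type*} [AddCommGroup X] [Module ℂ X] [TopologicalSpace X]
    [IsLCS X] {W : Set X} (hW : W ∈ 𝓝 0) (r : ℝ) : {x : X | (r : ℂ) • x ∈ W} ∈ 𝓝 0 :=
  (continuous_const_smul (r : ℂ)).continuousAt.preimage_mem_nhds (by simpa using hW)

/-- A balanced convex set that contains all `x ⊗ y` with `x`, `y` in given neighbourhoods of zero
is a neighbourhood of zero in the projective topology. -/
theorem ProjTensor.mem_nhds_zero [IsLCS E] [IsLCS F] {S : Set (ProjTensor E F)}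
    (hb : Balanced ℂ S) (hc : Convex ℝ S) {U : Set E} (hU : U ∈ 𝓝 0) {V : Set F} (hV : V ∈ 𝓝 0)
    (hS : ∀ x ∈ U, ∀ y ∈ V, ProjTensor.mk E F x y ∈ S) : S ∈ 𝓝 (0 : ProjTensor E F) := by
  have hle : ∀ {r r' : ℝ} {t : ProjTensor E F}, (r : ℂ) • t ∈ S → |r'| ≤ r → (r' : ℂ) • t ∈ S := by
    intro r r' t ht hr
    rcases eq_or_ne r 0 with rfl | h0
    · have : r' = 0 := by simpa using hr
      rwa [this]
    · have h1 : ‖(r' : ℂ) / r‖ ≤ 1 := by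
        rw [norm_div, Complex.norm_real, Complex.norm_real, Real.norm_eq_abs, Real.norm_eq_abs]
        exact div_le_one_of_le₀ (hr.trans (le_abs_self r)) (abs_nonneg _)
      have h2 := hb.smul_mem h1 ht
      rwa [smul_smul, div_mul_cancel₀ _ (by exact_mod_cast h0)] at h2
  have h0 : (0 : ProjTensor E F) ∈ S := by
    simpa using hS 0 (mem_of_mem_nhds hU) 0 (mem_of_mem_nhds hV)
  have habs : ∀ t : ProjTensor E F, ∃ r : ℝ, 0 < r ∧ (r : ℂ) • t ∈ S := by
    intro t
    refine ProjTensor.induction (p := fun t => ∃ r : ℝ, 0 < r ∧ (r : ℂ) • t ∈ S) t ⟨1, one_pos, by simpa using h0⟩ ?_ ?_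
    · intro x y
      obtain ⟨r, hr, hx⟩ := exists_smul_mem_of_mem_nhds hU x
      obtain ⟨r', hr', hy⟩ := exists_smul_mem_of_mem_nhds hV y
      refine ⟨r * r', mul_pos hr hr', ?_⟩
      have h1 := hS _ hx _ hy
      rwa [map_smul, map_smul, LinearMap.smul_apply, smul_smul, mul_comm,
        ← Complex.ofReal_mul] at h1
    · rintro s t ⟨r, hr, hs⟩ ⟨r', hr', ht⟩
      have hm : 0 < min r r' := lt_min hr hr'
      refine ⟨min r r' / 2, half_pos hm, ?_⟩
      have h1 := hle hs (r' := min r r') (by rw [abs_of_pos hm]; exact min_le_left _ _)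
      have h2 := hle ht (r' := min r r') (by rw [abs_of_pos hm]; exact min_le_right _ _)
      have h3 := hc h1 h2 (by norm_num : (0 : ℝ) ≤ 1 / 2) (by norm_num : (0 : ℝ) ≤ 1 / 2)
        (by norm_num)
      have h4 : ∀ z : ProjTensor E F, (1 / 2 : ℝ) • ((min r r' : ℝ) : ℂ) • z
          = ((min r r' / 2 : ℝ) : ℂ) • z := by
        intro z
        change ((1 / 2 : ℝ) : ℂ) • ((min r r' : ℝ) : ℂ) • z = _
        rw [smul_smul]
        congr 1
        push_cast
        ring
      rwa [h4, h4, ← smul_add] at h3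
  have hA : Absorbent ℝ S := by
    rw [absorbent_iff_eventually_nhdsNE_zero]
    intro t
    obtain ⟨r, hr, ht⟩ := habs t
    filter_upwards [nhdsWithin_le_nhds (Metric.closedBall_mem_nhds (0 : ℝ) hr)] with c hc'
    exact hle ht (by simpa using hc')
  let p : Seminorm ℂ (ProjTensor E F) := gaugeSeminorm hb hc hA
  have hp1 : ∀ t ∈ S, p t ≤ 1 := fun t ht => gauge_le_one_of_mem ht
  have hpS : p.ball 0 1 ⊆ S := by
    rw [Seminorm.ball_zero_eq]
    exact setOfPred_gauge_lt_one_subset_self hc h0 hA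
  have hpm : ∀ {r a : ℝ}, 0 < r → 0 < a → ∀ x y, (r : ℂ) • x ∈ U → (a : ℂ) • y ∈ V →
      p (ProjTensor.mk E F x y) ≤ (r * a)⁻¹ := by
    intro r a hr ha x y hx hy
    have h1 := hp1 _ (hS _ hx _ hy)
    simp only [map_smul, LinearMap.smul_apply, map_smul_eq_mul, Complex.norm_real,
      Real.norm_eq_abs, abs_of_pos hr, abs_of_pos ha] at h1
    rw [inv_eq_one_div, le_div_iff₀ (mul_pos hr ha)]
    linarith
  obtain ⟨t, ht, htb⟩ := exists_isLCS_of_seminorm p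
  have htg := ht.toIsTopologicalAddGroup
  suffices hmk : Continuous[_, t] fun q : E × F => ProjTensor.mk E F q.1 q.2 by
    have h1 : S ∈ @nhds _ t 0 := Filter.mem_of_superset (htb.mem_of_mem one_pos) hpS
    exact nhds_mono (sInf_le (Set.mem_ofPred.2 ⟨ht, hmk⟩)) h1
  let f : E →+ F →+ ProjTensor E F :=
    AddMonoidHom.mk' (fun x => (ProjTensor.mk E F x).toAddMonoidHom)
      (fun x y => by ext z; simp)
  have hlt : ∀ {r ε : ℝ}, 0 < r → 0 < ε → (r * (2 / (r * ε)))⁻¹ < ε := by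
    intro r ε hr hε
    have : (r * (2 / (r * ε)))⁻¹ = ε / 2 := by field_simp
    rw [this]
    exact half_lt_self hε
  refine @continuous_of_continuousAt_zero₂ E _ _ _ F (ProjTensor E F) _ t _ _ _ _ f ?_ ?_ ?_
  · change Filter.Tendsto _ _ (@nhds _ t _)
    simp only [map_zero]
    rw [htb.tendsto_right_iff]
    intro ε hε
    have h1 := setOf_smul_mem_mem_nhds hU (2 / (1 * ε))
    rw [nhds_prod_eq]
    filter_upwards [Filter.prod_mem_prod h1 hV] with q hq
    rw [Seminorm.mem_ball_zero]
    refine (hpm (r := 2 / (1 * ε)) (a := 1) (by positivity) one_pos q.1 q.2 hq.1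
      (by simpa using hq.2)).trans_lt ?_
    rw [mul_comm]
    exact hlt one_pos hε
  · intro x
    change Filter.Tendsto _ _ (@nhds _ t _)
    simp only [map_zero]
    rw [htb.tendsto_right_iff]
    intro ε hε
    obtain ⟨r, hr, hx⟩ := exists_smul_mem_of_mem_nhds hU x
    filter_upwards [setOf_smul_mem_mem_nhds hV (2 / (r * ε))] with y hy
    rw [Seminorm.mem_ball_zero]
    exact (hpm hr (by positivity) x y hx hy).trans_lt (hlt hr hε)
  · intro y
    change Filter.Tendsto _ _ (@nhds _ t _)
    simp only [map_zero, AddMonoidHom.zero_apply]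
    rw [htb.tendsto_right_iff]
    intro ε hε
    obtain ⟨r, hr, hy⟩ := exists_smul_mem_of_mem_nhds hV y
    filter_upwards [setOf_smul_mem_mem_nhds hU (2 / (r * ε))] with x hx
    rw [Seminorm.mem_ball_zero]
    refine (hpm (by positivity) hr x y hx hy).trans_lt ?_
    rw [mul_comm]
    exact hlt hr hε

end Topology

end ProjectiveTensor

section CompletedTensor

/-- The completed projective tensor product of two locally convex spaces. -/
abbrev CTensor (E F : Type*) [AddCommGroup E] [Module ℂ E] [TopologicalSpace E]
    [AddCommGroup F] [Module ℂ F] [TopologicalSpace F] : Type _ := Cpl (ProjTensor E F)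

infixl:70 " ⊗̂ " => CTensor

section

variable {E F G K : Type*} [AddCommGroup E] [Module ℂ E] [TopologicalSpace E]
  [AddCommGroup F] [Module ℂ F] [TopologicalSpace F]
  [AddCommGroup G] [Module ℂ G] [TopologicalSpace G]

/-- The canonical bilinear map `(x, y) ↦ x ⊗ y` into the completed projective tensor product. -/
def tmk : E →ₗ[ℂ] F →ₗ[ℂ] E ⊗̂ F :=
  (ProjTensor.mk E F).compr₂ (Cpl.ι (ProjTensor E F)).toLinearMap

theorem tmk_apply (x : E) (y : F) : tmk x y = Cpl.ι _ (ProjTensor.mk E F x y) := rfl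

theorem continuous_tmk : Continuous fun p : E × F => tmk p.1 p.2 :=
  (Cpl.ι (ProjTensor E F)).continuous.comp (ProjTensor.continuous_mk E F)

attribute [irreducible] tmk

theorem continuous_tmk_comp {Z : Type*} [TopologicalSpace Z] {f : Z → E} {g : Z → F}
    (hf : Continuous f) (hg : Continuous g) : Continuous fun z => tmk (f z) (g z) :=
  continuous_tmk.comp (hf.prodMk hg)

theorem CTensor.ext [AddCommGroup K] [Module ℂ K] [TopologicalSpace K] [T2Space K]
    {f g : E ⊗̂ F →L[ℂ] K} (h : ∀ x y, f (tmk x y) = g (tmk x y)) : f = g := by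
  refine Cpl.ext fun t => ?_
  refine ProjTensor.induction (p := fun t => f (Cpl.ι _ t) = g (Cpl.ι _ t)) t (by simp)
    (fun x y => by simpa only [tmk_apply] using h x y) fun s t hs ht => by simp [hs, ht]

variable [AddCommGroup K] [Module ℂ K] [UniformSpace K] [IsCompleteLCS K]

/-- The continuous linear map on the completed projective tensor product which corresponds to a
jointly continuous bilinear map. -/
def CTensor.lift (b : E →ₗ[ℂ] F →ₗ[ℂ] K) (hb : Continuous fun p : E × F => b p.1 p.2) :
    E ⊗̂ F →L[ℂ] K :=
  Cpl.extend ⟨ProjTensor.lift b, ProjTensor.continuous_lift b hb⟩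

@[simp]
theorem CTensor.lift_tmk (b : E →ₗ[ℂ] F →ₗ[ℂ] K) (hb : Continuous fun p : E × F => b p.1 p.2)
    (x : E) (y : F) : CTensor.lift b hb (tmk x y) = b x y := by
  rw [tmk_apply]
  exact (Cpl.extend_ι _ _).trans (ProjTensor.lift_mk b x y)

attribute [irreducible] CTensor.lift

/-- A jointly continuous trilinear map on `G × E × F` gives a bilinear map on `G × (E ⊗̂ F)`. -/
def CTensor.lift₃ (T : G →ₗ[ℂ] E →ₗ[ℂ] F →ₗ[ℂ] K)
    (hT : Continuous fun p : G × E × F => T p.1 p.2.1 p.2.2) : G →ₗ[ℂ] E ⊗̂ F →ₗ[ℂ] K where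
  toFun g := (CTensor.lift (T g) (hT.comp (Continuous.prodMk_right g))).toLinearMap
  map_add' g g' := by
    have : CTensor.lift (T (g + g')) (hT.comp (Continuous.prodMk_right (g + g'))) =
        CTensor.lift (T g) (hT.comp (Continuous.prodMk_right g)) +
          CTensor.lift (T g') (hT.comp (Continuous.prodMk_right g')) :=
      CTensor.ext fun x y => by simp
    rw [this]
    rfl
  map_smul' c g := by
    have : CTensor.lift (T (c • g)) (hT.comp (Continuous.prodMk_right (c • g))) =
        c • CTensor.lift (T g) (hT.comp (Continuous.prodMk_right g)) :=
      CTensor.ext fun x y => by simp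
    rw [this]
    rfl

@[simp]
theorem CTensor.lift₃_tmk (T : G →ₗ[ℂ] E →ₗ[ℂ] F →ₗ[ℂ] K)
    (hT : Continuous fun p : G × E × F => T p.1 p.2.1 p.2.2) (g : G) (x : E) (y : F) :
    CTensor.lift₃ T hT g (tmk x y) = T g x y :=
  CTensor.lift_tmk (T g) (hT.comp (Continuous.prodMk_right g)) x y

theorem CTensor.continuous_lift₃_right (T : G →ₗ[ℂ] E →ₗ[ℂ] F →ₗ[ℂ] K)
    (hT : Continuous fun p : G × E × F => T p.1 p.2.1 p.2.2) (g : G) :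
    Continuous (CTensor.lift₃ T hT g) :=
  (CTensor.lift (T g) (hT.comp (Continuous.prodMk_right g))).continuous

attribute [irreducible] CTensor.lift₃

theorem CTensor.continuous_lift₃ [IsLCS E] [IsLCS F] [IsLCS G] (T : G →ₗ[ℂ] E →ₗ[ℂ] F →ₗ[ℂ] K)
    (hT : Continuous fun p : G × E × F => T p.1 p.2.1 p.2.2) :
    Continuous fun p : G × (E ⊗̂ F) => CTensor.lift₃ T hT p.1 p.2 := by
  have hsep := CTensor.continuous_lift₃_right T hT
  -- closed balanced convex neighbourhoods of zero
  have hK : ∀ W ∈ 𝓝 (0 : K), ∃ C ∈ 𝓝 (0 : K), C ⊆ W ∧ IsClosed C ∧ Balanced ℂ C ∧ Convex ℝ C := by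
    intro W hW
    obtain ⟨C, ⟨hC, hCc⟩, hCW⟩ := (closed_nhds_basis (0 : K)).mem_iff.1 hW
    obtain ⟨A, hA, hAc, hAC⟩ := (locallyConvexSpace_iff_exists_convex_subset_zero ℝ K).1
      inferInstance _ hC
    have : ContinuousConstSMul ℝ K := ⟨fun r => continuous_const_smul (r : ℂ)⟩
    refine ⟨closure (convexHull ℝ (balancedCore ℂ A)),
      Filter.mem_of_superset (balancedCore_mem_nhds_zero hA)
        ((subset_convexHull ℝ _).trans subset_closure),
      (closure_minimal ((convexHull_min (balancedCore_subset A) hAc).trans hAC) hCc).trans hCW,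
      isClosed_closure, ?_, (convex_convexHull ℝ _).closure⟩
    have hbal : Balanced ℂ (convexHull ℝ (balancedCore ℂ A)) := by
      rw [balanced_iff_smul_mem]
      intro c hc x hx
      have h1 : convexHull ℝ (balancedCore ℂ A) ⊆
          ((LinearMap.lsmul ℂ K c).restrictScalars ℝ) ⁻¹' convexHull ℝ (balancedCore ℂ A) :=
        convexHull_min (fun y hy => subset_convexHull ℝ _
          ((balancedCore_balanced (𝕜 := ℂ) A).smul_mem hc hy))
          ((convex_convexHull ℝ _).linear_preimage _)
      exact h1 hx
    exact hbal.closure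
  -- the key uniform estimate
  have key : ∀ C ∈ 𝓝 (0 : K), IsClosed C → Balanced ℂ C → Convex ℝ C → ∀ V : Set G,
      ∀ U ∈ 𝓝 (0 : E), ∀ U' ∈ 𝓝 (0 : F), (∀ g ∈ V, ∀ x ∈ U, ∀ y ∈ U', T g x y ∈ C) →
      {t : E ⊗̂ F | ∀ g ∈ V, CTensor.lift₃ T hT g t ∈ C} ∈ 𝓝 0 := by
    intro C hC hCc hCb hCv V U hU U' hU' h
    refine Cpl.mem_nhds_of_isClosed ?_ (ProjTensor.mem_nhds_zero ?_ ?_ hU hU' ?_)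
    · simp only [Set.ofPred_forall]
      exact isClosed_iInter fun g => isClosed_iInter fun _ => hCc.preimage (hsep g)
    · rw [balanced_iff_smul_mem]
      intro c hc t ht g hg
      have h1 := hCb.smul_mem hc (ht g hg)
      rwa [← map_smul, ← map_smul] at h1
    · intro s hs t ht a b ha hb hab g hg
      have h1 := hCv (hs g hg) (ht g hg) ha hb hab
      have h2 : CTensor.lift₃ T hT g (Cpl.ι _ (a • s + b • t)) =
          a • CTensor.lift₃ T hT g (Cpl.ι _ s) + b • CTensor.lift₃ T hT g (Cpl.ι _ t) := by
        change CTensor.lift₃ T hT g (Cpl.ι _ ((a : ℂ) • s + (b : ℂ) • t)) =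
          (a : ℂ) • CTensor.lift₃ T hT g (Cpl.ι _ s) + (b : ℂ) • CTensor.lift₃ T hT g (Cpl.ι _ t)
        simp
      change CTensor.lift₃ T hT g (Cpl.ι _ (a • s + b • t)) ∈ C
      rwa [h2]
    · intro x hx y hy g hg
      have := h g hg x hx y hy
      rwa [← CTensor.lift₃_tmk T hT, tmk_apply] at this
  let f : G →+ (E ⊗̂ F) →+ K :=
    AddMonoidHom.mk' (fun g => (CTensor.lift₃ T hT g).toAddMonoidHom)
      (fun g g' => by ext z; simp)
  refine continuous_of_continuousAt_zero₂ f ?_ ?_ ?_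
  · change Filter.Tendsto (fun p : G × (E ⊗̂ F) => CTensor.lift₃ T hT p.1 p.2) (𝓝 (0, 0))
      (𝓝 (CTensor.lift₃ T hT 0 0))
    rw [map_zero]
    intro W hW
    obtain ⟨C, hC, hCW, hCc, hCb, hCv⟩ := hK W hW
    have h1 : Filter.Tendsto (fun p : G × E × F => T p.1 p.2.1 p.2.2) (𝓝 0 ×ˢ 𝓝 0 ×ˢ 𝓝 0)
        (𝓝 0) := by
      have := hT.tendsto (0, 0, 0)
      rwa [map_zero, nhds_prod_eq, nhds_prod_eq] at this
    obtain ⟨V, hV, Z, hZ, hVZ⟩ := Filter.mem_prod_iff.1 (h1 hC)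
    obtain ⟨U, hU, U', hU', hUZ⟩ := Filter.mem_prod_iff.1 hZ
    have h2 := key C hC hCc hCb hCv V U hU U' hU' fun g hg x hx y hy =>
      hVZ (Set.mk_mem_prod hg (hUZ (Set.mk_mem_prod hx hy)))
    rw [Filter.mem_map, nhds_prod_eq]
    filter_upwards [Filter.prod_mem_prod hV h2] with p hp
    exact hCW (hp.2 p.1 hp.1)
  · exact fun g => (hsep g).continuousAt
  · intro t
    change Filter.Tendsto (fun g => CTensor.lift₃ T hT g t) (𝓝 0) (𝓝 (CTensor.lift₃ T hT 0 t))
    rw [map_zero, LinearMap.zero_apply]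
    intro W hW
    obtain ⟨C, hC, hCW, hCc, hCb, hCv⟩ := hK W hW
    have h1 : Filter.Tendsto (fun p : G × E × F => T p.1 p.2.1 p.2.2) (𝓝 0 ×ˢ 𝓝 0 ×ˢ 𝓝 0)
        (𝓝 0) := by
      have := hT.tendsto (0, 0, 0)
      rwa [map_zero, nhds_prod_eq, nhds_prod_eq] at this
    obtain ⟨V, hV, Z, hZ, hVZ⟩ := Filter.mem_prod_iff.1 (h1 hC)
    obtain ⟨U, hU, U', hU', hUZ⟩ := Filter.mem_prod_iff.1 hZ
    have h2 := key C hC hCc hCb hCv V U hU U' hU' fun g hg x hx y hy =>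
      hVZ (Set.mk_mem_prod hg (hUZ (Set.mk_mem_prod hx hy)))
    obtain ⟨r, hr, ht⟩ := exists_smul_mem_of_mem_nhds h2 t
    rw [Filter.mem_map]
    filter_upwards [setOf_smul_mem_mem_nhds hV r⁻¹] with g hg
    have h3 := ht _ hg
    rw [map_smul, map_smul, LinearMap.smul_apply, smul_smul, Complex.ofReal_inv,
      mul_inv_cancel₀ (by exact_mod_cast hr.ne'), one_smul] at h3
    exact hCW h3

end

section Functoriality

variable {E F G K E' F' : Type*}
  [AddCommGroup E] [Module ℂ E] [UniformSpace E] [IsCompleteLCS E]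
  [AddCommGroup F] [Module ℂ F] [UniformSpace F] [IsCompleteLCS F]
  [AddCommGroup G] [Module ℂ G] [UniformSpace G] [IsCompleteLCS G]
  [AddCommGroup K] [Module ℂ K] [UniformSpace K] [IsCompleteLCS K]
  [AddCommGroup E'] [Module ℂ E'] [UniformSpace E'] [IsCompleteLCS E']
  [AddCommGroup F'] [Module ℂ F'] [UniformSpace F'] [IsCompleteLCS F']

/-- The tensor product `f ⊗ g` of continuous linear maps. -/
def CTensor.map (f : E →L[ℂ] E') (g : F →L[ℂ] F') : E ⊗̂ F →L[ℂ] E' ⊗̂ F' :=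
  CTensor.lift (tmk.compl₁₂ f.toLinearMap g.toLinearMap)
    (continuous_tmk.comp (f.continuous.prodMap g.continuous))

@[simp]
theorem CTensor.map_tmk (f : E →L[ℂ] E') (g : F →L[ℂ] F') (x : E) (y : F) :
    CTensor.map f g (tmk x y) = tmk (f x) (g y) := CTensor.lift_tmk _ _ x y

variable (E F G K)

/-- The symmetry `x ⊗ y ↦ y ⊗ x`. -/
def CTensor.comm : E ⊗̂ F →L[ℂ] F ⊗̂ E :=
  CTensor.lift tmk.flip (continuous_tmk.comp continuous_swap)

@[simp]
theorem CTensor.comm_tmk (x : E) (y : F) : CTensor.comm E F (tmk x y) = tmk y x :=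
  CTensor.lift_tmk _ _ x y

/-- The trilinear map `(z, x, y) ↦ x ⊗ (y ⊗ z)`. -/
def CTensor.assocAux : G →ₗ[ℂ] E →ₗ[ℂ] F →ₗ[ℂ] E ⊗̂ (F ⊗̂ G) :=
  LinearMap.mk₂ ℂ (fun z x => (tmk x).comp (tmk.flip z))
    (fun z z' x => by ext y; simp) (fun c z x => by ext y; simp)
    (fun z x x' => by ext y; simp) (fun c z x => by ext y; simp)

@[simp]
theorem CTensor.assocAux_apply (x : E) (y : F) (z : G) :
    CTensor.assocAux E F G z x y = tmk x (tmk y z) := rfl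

theorem CTensor.continuous_assocAux :
    Continuous fun p : G × E × F => CTensor.assocAux E F G p.1 p.2.1 p.2.2 :=
  continuous_tmk_comp continuous_snd.fst (continuous_tmk_comp continuous_snd.snd continuous_fst)

/-- The bilinear map `(x ⊗ y, z) ↦ x ⊗ (y ⊗ z)`. -/
def CTensor.assocBilin : E ⊗̂ F →ₗ[ℂ] G →ₗ[ℂ] E ⊗̂ (F ⊗̂ G) :=
  LinearMap.flip (CTensor.lift₃ (CTensor.assocAux E F G) (CTensor.continuous_assocAux E F G))

theorem CTensor.continuous_assocBilin :
    Continuous fun p : (E ⊗̂ F) × G => CTensor.assocBilin E F G p.1 p.2 := by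
  have h := (CTensor.continuous_lift₃ _ (CTensor.continuous_assocAux E F G)).comp
    (continuous_swap (X := E ⊗̂ F) (Y := G))
  refine h.congr fun p => ?_
  simp [CTensor.assocBilin]

/-- The associativity map `(x ⊗ y) ⊗ z ↦ x ⊗ (y ⊗ z)`. -/
def CTensor.assoc : (E ⊗̂ F) ⊗̂ G →L[ℂ] E ⊗̂ (F ⊗̂ G) :=
  CTensor.lift (CTensor.assocBilin E F G) (CTensor.continuous_assocBilin E F G)

@[simp]
theorem CTensor.assoc_tmk (x : E) (y : F) (z : G) :
    CTensor.assoc E F G (tmk (tmk x y) z) = tmk x (tmk y z) := by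
  simp [CTensor.assoc, CTensor.assocBilin]

/-- The trilinear map `(x, y, z) ↦ (x ⊗ y) ⊗ z`. -/
def CTensor.assocSymmAux : E →ₗ[ℂ] F →ₗ[ℂ] G →ₗ[ℂ] (E ⊗̂ F) ⊗̂ G :=
  LinearMap.mk₂ ℂ (fun x y => tmk (tmk x y))
    (fun z z' x => by ext y; simp) (fun c z x => by ext y; simp)
    (fun z x x' => by ext y; simp) (fun c z x => by ext y; simp)

@[simp]
theorem CTensor.assocSymmAux_apply (x : E) (y : F) (z : G) :
    CTensor.assocSymmAux E F G x y z = tmk (tmk x y) z := rfl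

theorem CTensor.continuous_assocSymmAux :
    Continuous fun p : E × F × G => CTensor.assocSymmAux E F G p.1 p.2.1 p.2.2 :=
  continuous_tmk_comp (continuous_tmk_comp continuous_fst continuous_snd.fst) continuous_snd.snd

/-- The associativity map `x ⊗ (y ⊗ z) ↦ (x ⊗ y) ⊗ z`. -/
def CTensor.assocSymm : E ⊗̂ (F ⊗̂ G) →L[ℂ] (E ⊗̂ F) ⊗̂ G :=
  CTensor.lift (CTensor.lift₃ (CTensor.assocSymmAux E F G) (CTensor.continuous_assocSymmAux E F G))
    (CTensor.continuous_lift₃ _ (CTensor.continuous_assocSymmAux E F G))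

@[simp]
theorem CTensor.assocSymm_tmk (x : E) (y : F) (z : G) :
    CTensor.assocSymm E F G (tmk x (tmk y z)) = tmk (tmk x y) z := by
  simp [CTensor.assocSymm]

/-- The interchange of the two middle factors, `(x ⊗ y) ⊗ (z ⊗ w) ↦ (x ⊗ z) ⊗ (y ⊗ w)`. -/
def CTensor.interchange : (E ⊗̂ F) ⊗̂ (G ⊗̂ K) →L[ℂ] (E ⊗̂ G) ⊗̂ (F ⊗̂ K) :=
  (CTensor.assocSymm E G (F ⊗̂ K)).comp <|
    (CTensor.map (.id ℂ E) ((CTensor.assoc G F K).comp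
      ((CTensor.map (CTensor.comm F G) (.id ℂ K)).comp (CTensor.assocSymm F G K)))).comp
    (CTensor.assoc E F (G ⊗̂ K))

@[simp]
theorem CTensor.interchange_tmk (x : E) (y : F) (z : G) (w : K) :
    CTensor.interchange E F G K (tmk (tmk x y) (tmk z w)) = tmk (tmk x z) (tmk y w) := by
  simp [CTensor.interchange]

/-- The left unit isomorphism `c ⊗ x ↦ c x`. -/
def CTensor.lid : ℂ ⊗̂ E →L[ℂ] E := CTensor.lift (LinearMap.lsmul ℂ E) continuous_smul

/-- The right unit isomorphism `x ⊗ c ↦ c x`. -/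
def CTensor.rid : E ⊗̂ ℂ →L[ℂ] E :=
  CTensor.lift (LinearMap.lsmul ℂ E).flip (continuous_smul.comp continuous_swap)

end Functoriality

end CompletedTensor

/-! ## Complete locally convex algebras and Hopf algebras -/

/-- A `⊗̂`-algebra: a unital associative complex algebra whose underlying space is complete,
Hausdorff and locally convex, with jointly continuous multiplication. -/
class IsTensorAlgebra (A : Type*) [Ring A] [Algebra ℂ A] [UniformSpace A] : Prop extends
  IsCompleteLCS A, ContinuousMul A

instance : IsTensorAlgebra ℂ where

/-- The multiplication of a `⊗̂`-algebra as a continuous linear map `A ⊗̂ A → A`. -/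
def mulMap (A : Type*) [Ring A] [Algebra ℂ A] [UniformSpace A] [IsTensorAlgebra A] :
    A ⊗̂ A →L[ℂ] A :=
  CTensor.lift (LinearMap.mul ℂ A) continuous_mul

@[simp]
theorem mulMap_tmk {A : Type*} [Ring A] [Algebra ℂ A] [UniformSpace A] [IsTensorAlgebra A]
    (a b : A) : mulMap A (tmk a b) = a * b :=
  CTensor.lift_tmk (LinearMap.mul ℂ A) continuous_mul a b

/-- The multiplication of the tensor product algebra `A ⊗̂ B`, which is determined by
`(a ⊗ b) (a' ⊗ b') = a a' ⊗ b b'`. -/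
def tensorMul (A B : Type*) [Ring A] [Algebra ℂ A] [UniformSpace A] [IsTensorAlgebra A]
    [Ring B] [Algebra ℂ B] [UniformSpace B] [IsTensorAlgebra B] :
    (A ⊗̂ B) ⊗̂ (A ⊗̂ B) →L[ℂ] A ⊗̂ B :=
  (CTensor.map (mulMap A) (mulMap B)).comp (CTensor.interchange A B A B)

/-- A Hopf `⊗̂`-algebra: a Hopf algebra in the symmetric monoidal category of complete Hausdorff
locally convex spaces with the completed projective tensor product. -/
class HopfTensorAlgebra (H : Type*) [Ring H] [Algebra ℂ H] [UniformSpace H]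
    [IsTensorAlgebra H] where
  /-- The comultiplication. -/
  comul : H →L[ℂ] H ⊗̂ H
  /-- The counit. -/
  counit : H →A[ℂ] ℂ
  /-- The antipode. -/
  antipode : H →L[ℂ] H
  coassoc : (CTensor.assoc H H H).comp ((CTensor.map comul (.id ℂ H)).comp comul) =
    (CTensor.map (.id ℂ H) comul).comp comul
  counit_comul : (CTensor.lid H).comp
    ((CTensor.map counit.toContinuousLinearMap (.id ℂ H)).comp comul) = .id ℂ H
  comul_counit : (CTensor.rid H).comp
    ((CTensor.map (.id ℂ H) counit.toContinuousLinearMap).comp comul) = .id ℂ H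
  comul_one : comul 1 = tmk 1 1
  comul_mul : ∀ a b, comul (a * b) = tensorMul H H (tmk (comul a) (comul b))
  antipode_left : ∀ a, mulMap H (CTensor.map antipode (.id ℂ H) (comul a)) =
    algebraMap ℂ H (counit a)
  antipode_right : ∀ a, mulMap H (CTensor.map (.id ℂ H) antipode (comul a)) =
    algebraMap ℂ H (counit a)

/-- A continuous linear map is a topological isomorphism. -/
def IsTopIso {E F : Type*} [AddCommGroup E] [Module ℂ E] [TopologicalSpace E]
    [AddCommGroup F] [Module ℂ F] [TopologicalSpace F] (f : E →L[ℂ] F) : Prop :=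
  ∃ g : F →L[ℂ] E, g.comp f = .id ℂ E ∧ f.comp g = .id ℂ F

/-- The Hopf `⊗̂`-algebra `H` has invertible antipode. -/
def HasInvertibleAntipode (H : Type*) [Ring H] [Algebra ℂ H] [UniformSpace H] [IsTensorAlgebra H]
    [HopfTensorAlgebra H] : Prop :=
  IsTopIso (HopfTensorAlgebra.antipode (H := H))

/-- A continuous unital algebra homomorphism is a homomorphism of Hopf `⊗̂`-algebras if it respects
the comultiplications and the counits (it then automatically respects the antipodes). -/
structure IsHopfHom {U H : Type*} [Ring U] [Algebra ℂ U] [UniformSpace U] [IsTensorAlgebra U]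
    [HopfTensorAlgebra U] [Ring H] [Algebra ℂ H] [UniformSpace H] [IsTensorAlgebra H]
    [HopfTensorAlgebra H] (θ : U →A[ℂ] H) : Prop where
  map_comul : ∀ a, CTensor.map θ.toContinuousLinearMap θ.toContinuousLinearMap (HopfTensorAlgebra.comul a) =
    HopfTensorAlgebra.comul (θ a)
  counit_comp : (HopfTensorAlgebra.counit (H := H)).comp θ = HopfTensorAlgebra.counit

/-! ## Modules over complete locally convex algebras -/

section Modules

variable (A : Type u) [Ring A] [Algebra ℂ A] [UniformSpace A]

/-- A left `⊗̂`-module over `A`: a complete Hausdorff locally convex space with a jointly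
continuous bilinear unital associative left action of `A`. -/
structure LMod where
  carrier : Type w
  [addCommGroup : AddCommGroup carrier]
  [module : Module ℂ carrier]
  [uniformSpace : UniformSpace carrier]
  [isCompleteLCS : IsCompleteLCS carrier]
  act : A →ₗ[ℂ] carrier →ₗ[ℂ] carrier
  continuous_act : Continuous fun p : A × carrier => act p.1 p.2
  one_act : ∀ x, act 1 x = x
  mul_act : ∀ a b x, act (a * b) x = act a (act b x)

/-- A right `⊗̂`-module over `A`; here `act a x` stands for `x · a`. -/
structure RMod where
  carrier : Type w
  [addCommGroup : AddCommGroup carrier]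
  [module : Module ℂ carrier]
  [uniformSpace : UniformSpace carrier]
  [isCompleteLCS : IsCompleteLCS carrier]
  act : A →ₗ[ℂ] carrier →ₗ[ℂ] carrier
  continuous_act : Continuous fun p : A × carrier => act p.1 p.2
  one_act : ∀ x, act 1 x = x
  mul_act : ∀ a b x, act (a * b) x = act b (act a x)

instance : CoeSort (LMod.{u, w} A) (Type w) := ⟨LMod.carrier⟩
instance : CoeSort (RMod.{u, w} A) (Type w) := ⟨RMod.carrier⟩

attribute [instance] LMod.addCommGroup LMod.module LMod.uniformSpace LMod.isCompleteLCS
attribute [instance] RMod.addCommGroup RMod.module RMod.uniformSpace RMod.isCompleteLCS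

/-- `A` as a left module over itself. -/
def LMod.self [IsTensorAlgebra A] : LMod.{u, u} A where
  carrier := A
  act := LinearMap.mul ℂ A
  continuous_act := continuous_mul
  one_act := one_mul
  mul_act := mul_assoc

/-- `A` as a right module over itself. -/
def RMod.self [IsTensorAlgebra A] : RMod.{u, u} A where
  carrier := A
  act := (LinearMap.mul ℂ A).flip
  continuous_act := continuous_mul.comp continuous_swap
  one_act := mul_one
  mul_act := fun a b x => (mul_assoc x a b).symm

variable {A}
variable {B : Type v} [Ring B] [Algebra ℂ B] [UniformSpace B]

/-- Restriction of scalars along a homomorphism `θ : A → B`. -/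
def LMod.restrict (θ : A →A[ℂ] B) (M : LMod.{v, w} B) : LMod.{u, w} A where
  carrier := M
  act := M.act.comp θ.toContinuousLinearMap.toLinearMap
  continuous_act := M.continuous_act.comp (θ.continuous.prodMap continuous_id)
  one_act := fun x => by simpa using M.one_act x
  mul_act := fun a b x => by simpa using M.mul_act (θ a) (θ b) x

/-- Restriction of scalars along a homomorphism `θ : A → B`. -/
def RMod.restrict (θ : A →A[ℂ] B) (M : RMod.{v, w} B) : RMod.{u, w} A where
  carrier := M
  act := M.act.comp θ.toContinuousLinearMap.toLinearMap
  continuous_act := M.continuous_act.comp (θ.continuous.prodMap continuous_id)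
  one_act := fun x => by simpa using M.one_act x
  mul_act := fun a b x => by simpa using M.mul_act (θ a) (θ b) x

/-- A morphism of left `⊗̂`-modules: a continuous linear map commuting with the actions. -/
structure LMod.Hom (M : LMod.{u, w} A) (N : LMod.{u, w'} A) where
  toCLM : M →L[ℂ] N
  map_act : ∀ a x, toCLM (M.act a x) = N.act a (toCLM x)

/-- A left `⊗̂`-module `P` is projective if morphisms from `P` lift along every admissible
epimorphism, i.e. along every morphism `σ : X → Y` which has a continuous linear right inverse. -/
def LMod.IsProjective (P : LMod.{u, w} A) : Prop :=
  ∀ (X Y : LMod.{u, w} A) (σ : LMod.Hom X Y),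
    (∃ τ : Y →L[ℂ] X, σ.toCLM.comp τ = .id ℂ Y) →
    ∀ φ : LMod.Hom P Y, ∃ ψ : LMod.Hom P X, σ.toCLM.comp ψ.toCLM = φ.toCLM

/-- The augmented sequence `0 ← X ← C 0 ← C 1 ← ⋯` is an admissible complex of locally convex
spaces: it is a chain complex, and it splits, i.e. it has a contracting homotopy that consists of
continuous linear maps. -/
def IsAdmissible {X : Type*} {C : ℕ → Type*} [AddCommGroup X] [Module ℂ X] [TopologicalSpace X]
    [∀ n, AddCommGroup (C n)] [∀ n, Module ℂ (C n)] [∀ n, UniformSpace (C n)]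
    [∀ n, IsCompleteLCS (C n)] (e : C 0 →L[ℂ] X) (d : ∀ n, C (n + 1) →L[ℂ] C n) : Prop :=
  e.comp (d 0) = 0 ∧ (∀ n, (d n).comp (d (n + 1)) = 0) ∧
    ∃ (s₀ : X →L[ℂ] C 0) (s : ∀ n, C n →L[ℂ] C (n + 1)),
      e.comp s₀ = .id ℂ X ∧ s₀.comp e + (d 0).comp (s 0) = .id ℂ (C 0) ∧
      ∀ n, (s n).comp (d n) + (d (n + 1)).comp (s (n + 1)) = .id ℂ (C (n + 1))

/-- A projective resolution of a left `⊗̂`-module `Y`. -/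
structure ProjResolution (Y : LMod.{u, w} A) where
  obj : ℕ → LMod.{u, max u w} A
  aug : LMod.Hom (obj 0) Y
  d : ∀ n, LMod.Hom (obj (n + 1)) (obj n)
  projective : ∀ n, (obj n).IsProjective
  admissible : IsAdmissible (C := fun n => obj n) aug.toCLM fun n => (d n).toCLM

/-! ### The tensor product of modules -/

section TensorOver

/-- The closed linear span of all elements `x · a ⊗ y - x ⊗ a · y` of `X ⊗̂ Y`. -/
def balancer (X : RMod.{u, v} A) (Y : LMod.{u, w} A) : Submodule ℂ (X ⊗̂ Y) :=
  (Submodule.span ℂ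
    {t | ∃ (x : X) (a : A) (y : Y), t = tmk (X.act a x) y - tmk x (Y.act a y)}).topologicalClosure

instance (E : Type*) [AddCommGroup E] [Module ℂ E] [TopologicalSpace E] [IsLCS E]
    (N : Submodule ℂ E) : IsLCS (E ⧸ N) := by
  have h : LocallyConvexSpace ℝ (E ⧸ N) := by
    rw [locallyConvexSpace_iff_exists_convex_subset_zero]
    intro U hU
    have h1 : N.mkQ ⁻¹' U ∈ 𝓝 (0 : E) :=
      N.continuous_mkQ.continuousAt.preimage_mem_nhds (by rwa [map_zero])
    obtain ⟨S, hS, hSc, hSU⟩ := (locallyConvexSpace_iff_exists_convex_subset_zero ℝ E).1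
      inferInstance _ h1
    refine ⟨N.mkQ '' S, ?_, ?_, Set.image_subset_iff.2 hSU⟩
    · simpa using N.isOpenMap_mkQ.image_mem_nhds hS
    · exact hSc.linear_image (N.mkQ.restrictScalars ℝ)
  exact { h with }

/-- The tensor product `X ⊗̂_A Y` of a right and a left `⊗̂`-module over `A`: the completion of the
quotient of `X ⊗̂ Y` by the closed linear span of all `x · a ⊗ y - x ⊗ a · y`. -/
abbrev TensorOver (X : RMod.{u, v} A) (Y : LMod.{u, w} A) : Type _ :=
  Cpl ((X ⊗̂ Y) ⧸ balancer X Y)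

theorem tmk_sub_tmk_mem_balancer (X : RMod.{u, v} A) (Y : LMod.{u, w} A) (x : X) (a : A) (y : Y) :
    (tmk (X.act a x) y - tmk x (Y.act a y) : X ⊗̂ Y) ∈ balancer X Y :=
  Submodule.le_topologicalClosure _ (Submodule.subset_span ⟨x, a, y, rfl⟩)

/-- The canonical map `X ⊗̂ Y → X ⊗̂_A Y`. -/
def TensorOver.proj (X : RMod.{u, v} A) (Y : LMod.{u, w} A) : X ⊗̂ Y →L[ℂ] TensorOver X Y :=
  (Cpl.ι _).comp (balancer X Y).mkQL

theorem TensorOver.proj_balanced (X : RMod.{u, v} A) (Y : LMod.{u, w} A) (x : X) (a : A) (y : Y) :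
    TensorOver.proj X Y (tmk (X.act a x) y) = TensorOver.proj X Y (tmk x (Y.act a y)) := by
  rw [← sub_eq_zero, ← map_sub, TensorOver.proj, ContinuousLinearMap.comp_apply,
    (Submodule.Quotient.mk_eq_zero (balancer X Y)).2 (tmk_sub_tmk_mem_balancer X Y x a y) |>
      (show (balancer X Y).mkQL _ = 0 from ·), map_zero]

section Lift

variable {K : Type*} [AddCommGroup K] [Module ℂ K] [UniformSpace K] [IsCompleteLCS K]

theorem balancer_le_ker (X : RMod.{u, v} A) (Y : LMod.{u, w} A) (f : X ⊗̂ Y →L[ℂ] K)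
    (hf : ∀ x a y, f (tmk (X.act a x) y) = f (tmk x (Y.act a y))) :
    balancer X Y ≤ LinearMap.ker f.toLinearMap := by
  refine Submodule.topologicalClosure_minimal _ (Submodule.span_le.2 ?_) f.isClosed_ker
  rintro _ ⟨x, a, y, rfl⟩
  simp [hf]

/-- The continuous linear map on `X ⊗̂_A Y` induced by a continuous linear map on `X ⊗̂ Y` which is
`A`-balanced. -/
def TensorOver.lift (X : RMod.{u, v} A) (Y : LMod.{u, w} A) (f : X ⊗̂ Y →L[ℂ] K)
    (hf : ∀ x a y, f (tmk (X.act a x) y) = f (tmk x (Y.act a y))) : TensorOver X Y →L[ℂ] K :=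
  Cpl.extend ((balancer X Y).liftQL f (balancer_le_ker X Y f hf))

@[simp]
theorem TensorOver.lift_proj (X : RMod.{u, v} A) (Y : LMod.{u, w} A) (f : X ⊗̂ Y →L[ℂ] K)
    (hf : ∀ x a y, f (tmk (X.act a x) y) = f (tmk x (Y.act a y))) (t : X ⊗̂ Y) :
    TensorOver.lift X Y f hf (TensorOver.proj X Y t) = f t :=
  Cpl.extend_ι _ _

end Lift

/-- The map `1 ⊗ φ : X ⊗̂_A Y → X ⊗̂_A Y'` induced by a morphism `φ : Y → Y'`. -/
def TensorOver.map (X : RMod.{u, v} A) {Y : LMod.{u, w} A} {Y' : LMod.{u, w'} A}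
    (φ : LMod.Hom Y Y') : TensorOver X Y →L[ℂ] TensorOver X Y' :=
  TensorOver.lift X Y ((TensorOver.proj X Y').comp (CTensor.map (.id ℂ X) φ.toCLM)) fun x a y => by
    simp [φ.map_act, TensorOver.proj_balanced]

end TensorOver

/-- `X` and `Y` are strongly transversal over `A`: for some projective resolution
`0 ← Y ← Q` of `Y`, the complex `0 ← X ⊗̂_A Y ← X ⊗̂_A Q` is admissible. -/
def StronglyTransversal (X : RMod.{u, v} A) (Y : LMod.{u, w} A) : Prop :=
  ∃ Q : ProjResolution Y, IsAdmissible (C := fun n => TensorOver X (Q.obj n))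
    (TensorOver.map X Q.aug) fun n => TensorOver.map X (Q.d n)

end Modules

/-! ## Localizations and weak localizations -/

section Localization

variable {A : Type u} [Ring A] [Algebra ℂ A] [UniformSpace A] [IsTensorAlgebra A]
  {B : Type v} [Ring B] [Algebra ℂ B] [UniformSpace B] [IsTensorAlgebra B]

/-- `B` as a left `A`-module via `θ : A → B`. -/
abbrev leftVia (θ : A →A[ℂ] B) : LMod.{u, v} A := (LMod.self B).restrict θ

/-- `B` as a right `A`-module via `θ : A → B`. -/
abbrev rightVia (θ : A →A[ℂ] B) : RMod.{u, v} A := (RMod.self B).restrict θ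

/-- The canonical map `B ⊗̂_A B → B`, `b₁ ⊗ b₂ ↦ b₁ b₂`. -/
def mulOver (θ : A →A[ℂ] B) : TensorOver (rightVia θ) (leftVia θ) →L[ℂ] B :=
  TensorOver.lift (rightVia θ) (leftVia θ) (mulMap B) fun (x : B) a (y : B) => by
    change mulMap B (tmk (x * θ a) y) = mulMap B (tmk x (θ a * y))
    rw [mulMap_tmk, mulMap_tmk, mul_assoc]

/-- A homomorphism `θ : A → B` of `⊗̂`-algebras is a localization if the canonical map
`B ⊗̂_A B → B` is a topological isomorphism and `B` is strongly transversal to `B` over `A`. -/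
def IsLocalizationHom (θ : A →A[ℂ] B) : Prop :=
  IsTopIso (mulOver θ) ∧ StronglyTransversal (rightVia θ) (leftVia θ)

/-- The canonical map `B ⊗̂_A ℂ → ℂ`, `b ⊗ c ↦ ε(b) c`, for a homomorphism `θ : A → B` of augmented
`⊗̂`-algebras; here `ℂ` is an `A`-module via the augmentation `εA`. -/
def augOver (εA : A →A[ℂ] ℂ) (εB : B →A[ℂ] ℂ) (θ : A →A[ℂ] B) (h : εB.comp θ = εA) :
    TensorOver (rightVia θ) (leftVia εA) →L[ℂ] ℂ :=
  TensorOver.lift (rightVia θ) (leftVia εA)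
    ((mulMap ℂ).comp (CTensor.map εB.toContinuousLinearMap (.id ℂ ℂ))) fun (x : B) a (y : ℂ) => by
      change mulMap ℂ (CTensor.map εB.toContinuousLinearMap (.id ℂ ℂ) (tmk (x * θ a) y)) =
        mulMap ℂ (CTensor.map εB.toContinuousLinearMap (.id ℂ ℂ) (tmk x (εA a * y)))
      simp [← h, mul_assoc]

/-- A homomorphism `θ : A → B` of augmented `⊗̂`-algebras (with augmentations `εA`, `εB`) is a weak
localization if the canonical map `B ⊗̂_A ℂ → ℂ` is a topological isomorphism and `B` is strongly
transversal to `ℂ` over `A`. -/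
def IsWeakLocalizationHom (εA : A →A[ℂ] ℂ) (εB : B →A[ℂ] ℂ) (θ : A →A[ℂ] B)
    (h : εB.comp θ = εA) : Prop :=
  StronglyTransversal (rightVia θ) (leftVia εA) ∧ IsTopIso (augOver εA εB θ h)

end Localization

end TopHom

end

/-!
Write `K_N = H ⊗̂_U N` for a left `U`-module `N`, and let `U` act on `N ⊗ M` through its
comultiplication. For a module `M` over `H` there is the *tensor identity*
`H ⊗̂_U (N ⊗ M) ≅ K_N ⊗̂ M`, `h ⊗ (y ⊗ x) ↦ (h₁ ⊗ y) ⊗ h₂ x`, with inverse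
`(h ⊗ y) ⊗ x ↦ h₁ ⊗ (y ⊗ S(h₂) x)` (`tensorIdentity`, `tensorIdentitySymm`); it is natural in `N`.
The theorem is the case `M = H`.

If `Q` is a projective resolution of the trivial module `ℂ`, then `Q ⊗ H` is a projective resolution
of `ℂ ⊗ H ≅ H` (`ProjResolution.tensor`): its terms are projective because the shear isomorphism
`a ⊗ (v ⊗ x) ↦ (a₁ ⊗ v) ⊗ a₂ x` identifies the free module on `V ⊗̂ M` with the tensor product of the
free module on `V` with `M` (`LMod.IsProjective.tensor`). By the tensor identity, the augmented
complex `H ⊗̂_U (Q ⊗ H)` is isomorphic to `(H ⊗̂_U Q) ⊗̂ H`. The latter is admissible if and only if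
`H ⊗̂_U Q` is: contracting homotopies can be tensored with `H`, and every space `E` is naturally a
retract of `E ⊗̂ H` by the unit and the counit. As strong transversality does not depend on the
projective resolution (`StronglyTransversal.isAdmissible`) and the bar resolution exists, `H` is
strongly transversal to `H` if and only if it is strongly transversal to `ℂ`
(`stronglyTransversal_iff`).

In the same way `H ⊗̂_U H → H` is identified with the tensor product of `H ⊗̂_U ℂ → ℂ` with `H`, so
that one of them is a topological isomorphism if and only if the other is (`isTopIso_mulOver_iff`).
-/

noncomputable section

namespace TopHom

set_option linter.unusedSectionVars false

/-! ### Tensor products of continuous linear maps -/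

section Toolkit

section Ext

variable {E F G K L : Type*} [AddCommGroup E] [Module ℂ E] [TopologicalSpace E]
  [AddCommGroup F] [Module ℂ F] [TopologicalSpace F]
  [AddCommGroup G] [Module ℂ G] [TopologicalSpace G]
  [AddCommGroup L] [Module ℂ L] [TopologicalSpace L]
  [AddCommGroup K] [Module ℂ K] [TopologicalSpace K] [T2Space K]

/-- The continuous linear map `x ↦ x ⊗ y`. -/
def CTensor.mkLeft (y : F) : E →L[ℂ] E ⊗̂ F :=
  ⟨tmk.flip y, continuous_tmk_comp continuous_id continuous_const⟩

/-- The continuous linear map `y ↦ x ⊗ y`. -/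
def CTensor.mkRight (x : E) : F →L[ℂ] E ⊗̂ F :=
  ⟨tmk x, continuous_tmk_comp continuous_const continuous_id⟩

@[simp]
theorem CTensor.mkLeft_apply (x : E) (y : F) : CTensor.mkLeft y x = tmk x y := rfl

@[simp]
theorem CTensor.mkRight_apply (x : E) (y : F) : CTensor.mkRight x y = tmk x y := rfl

theorem CTensor.ext_left {f g : (E ⊗̂ F) ⊗̂ G →L[ℂ] K}
    (h : ∀ x y z, f (tmk (tmk x y) z) = g (tmk (tmk x y) z)) : f = g :=
  CTensor.ext fun t z => DFunLike.congr_fun (CTensor.ext (f := f.comp (CTensor.mkLeft z))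
    (g := g.comp (CTensor.mkLeft z)) fun x y => h x y z) t

theorem CTensor.ext_right {f g : E ⊗̂ (F ⊗̂ G) →L[ℂ] K}
    (h : ∀ x y z, f (tmk x (tmk y z)) = g (tmk x (tmk y z))) : f = g :=
  CTensor.ext fun x t => DFunLike.congr_fun (CTensor.ext (f := f.comp (CTensor.mkRight x))
    (g := g.comp (CTensor.mkRight x)) fun y z => h x y z) t

theorem CTensor.ext_both {f g : (E ⊗̂ F) ⊗̂ (G ⊗̂ L) →L[ℂ] K}
    (h : ∀ x y z w, f (tmk (tmk x y) (tmk z w)) = g (tmk (tmk x y) (tmk z w))) : f = g :=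
  CTensor.ext_left fun x y t => DFunLike.congr_fun
    (CTensor.ext (f := f.comp (CTensor.mkRight (tmk x y)))
      (g := g.comp (CTensor.mkRight (tmk x y))) fun z w => h x y z w) t

end Ext

section Map

variable {E F G K E' F' E'' F'' : Type*}
  [AddCommGroup E] [Module ℂ E] [UniformSpace E] [IsCompleteLCS E]
  [AddCommGroup F] [Module ℂ F] [UniformSpace F] [IsCompleteLCS F]
  [AddCommGroup G] [Module ℂ G] [UniformSpace G] [IsCompleteLCS G]
  [AddCommGroup K] [Module ℂ K] [UniformSpace K] [IsCompleteLCS K]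
  [AddCommGroup E'] [Module ℂ E'] [UniformSpace E'] [IsCompleteLCS E']
  [AddCommGroup F'] [Module ℂ F'] [UniformSpace F'] [IsCompleteLCS F']
  [AddCommGroup E''] [Module ℂ E''] [UniformSpace E''] [IsCompleteLCS E'']
  [AddCommGroup F''] [Module ℂ F''] [UniformSpace F''] [IsCompleteLCS F'']

theorem CTensor.map_comp_map (f : E →L[ℂ] E') (g : F →L[ℂ] F') (f' : E' →L[ℂ] E'')
    (g' : F' →L[ℂ] F'') :
    (CTensor.map f' g').comp (CTensor.map f g) = CTensor.map (f'.comp f) (g'.comp g) :=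
  CTensor.ext fun x y => by simp

theorem CTensor.map_map (f : E →L[ℂ] E') (g : F →L[ℂ] F') (f' : E' →L[ℂ] E'')
    (g' : F' →L[ℂ] F'') (t : E ⊗̂ F) :
    CTensor.map f' g' (CTensor.map f g t) = CTensor.map (f'.comp f) (g'.comp g) t :=
  DFunLike.congr_fun (CTensor.map_comp_map f g f' g') t

@[simp]
theorem CTensor.map_id : CTensor.map (.id ℂ E) (.id ℂ F) = .id ℂ (E ⊗̂ F) :=
  CTensor.ext fun x y => by simp

@[simp]
theorem CTensor.map_zero_left (g : F →L[ℂ] F') : CTensor.map (0 : E →L[ℂ] E') g = 0 :=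
  CTensor.ext fun x y => by simp

theorem CTensor.map_add_left (f f' : E →L[ℂ] E') (g : F →L[ℂ] F') :
    CTensor.map (f + f') g = CTensor.map f g + CTensor.map f' g :=
  CTensor.ext fun x y => by simp

@[simp]
theorem CTensor.lid_tmk (c : ℂ) (x : E) : CTensor.lid E (tmk c x) = c • x :=
  CTensor.lift_tmk _ _ c x

@[simp]
theorem CTensor.rid_tmk (x : E) (c : ℂ) : CTensor.rid E (tmk x c) = c • x :=
  CTensor.lift_tmk _ _ x c

variable (E F G)

/-- The isomorphism `x ⊗ (y ⊗ z) ↦ (y ⊗ x) ⊗ z`, by which a factor is moved out of the way. -/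
def CTensor.swapLeft : E ⊗̂ (F ⊗̂ G) →L[ℂ] (F ⊗̂ E) ⊗̂ G :=
  (CTensor.map (CTensor.comm E F) (.id ℂ G)).comp (CTensor.assocSymm E F G)

@[simp]
theorem CTensor.swapLeft_tmk (x : E) (y : F) (z : G) :
    CTensor.swapLeft E F G (tmk x (tmk y z)) = tmk (tmk y x) z := by
  simp [CTensor.swapLeft]

/-- The inverse `(y ⊗ x) ⊗ z ↦ x ⊗ (y ⊗ z)` of `CTensor.swapLeft`. -/
def CTensor.swapLeftSymm : (F ⊗̂ E) ⊗̂ G →L[ℂ] E ⊗̂ (F ⊗̂ G) :=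
  (CTensor.assoc E F G).comp (CTensor.map (CTensor.comm F E) (.id ℂ G))

@[simp]
theorem CTensor.swapLeftSymm_tmk (x : E) (y : F) (z : G) :
    CTensor.swapLeftSymm E F G (tmk (tmk y x) z) = tmk x (tmk y z) := by
  simp [CTensor.swapLeftSymm]

theorem CTensor.swapLeft_comp_swapLeftSymm :
    (CTensor.swapLeft E F G).comp (CTensor.swapLeftSymm E F G) = .id ℂ _ :=
  CTensor.ext_left fun x y z => by simp

theorem CTensor.swapLeftSymm_comp_swapLeft :
    (CTensor.swapLeftSymm E F G).comp (CTensor.swapLeft E F G) = .id ℂ _ :=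
  CTensor.ext_right fun x y z => by simp

end Map

/-- A bilinear map that is continuous in its second argument, and jointly continuous after
composition with a map `π` under which the closures of the images of neighbourhoods of zero are
neighbourhoods of zero, is jointly continuous. -/
theorem continuous_bilin_of_closure_image {M E Q K : Type*}
    [AddCommGroup M] [Module ℂ M] [TopologicalSpace M] [IsLCS M]
    [AddCommGroup E] [Module ℂ E] [TopologicalSpace E] [IsLCS E]
    [AddCommGroup Q] [Module ℂ Q] [TopologicalSpace Q] [IsLCS Q]
    [AddCommGroup K] [Module ℂ K] [UniformSpace K] [IsCompleteLCS K]
    (π : E →L[ℂ] Q) (hπ : ∀ S ∈ 𝓝 (0 : E), closure (π '' S) ∈ 𝓝 (0 : Q))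
    (T : M →ₗ[ℂ] Q →ₗ[ℂ] K) (hT : ∀ m, Continuous (T m))
    (h : Continuous fun p : M × E => T p.1 (π p.2)) :
    Continuous fun p : M × Q => T p.1 p.2 := by
  -- closed neighbourhoods suffice, and they can be tested on the images under `π`
  have key : ∀ W ∈ 𝓝 (0 : K), ∃ V ∈ 𝓝 (0 : M), ∃ S ∈ 𝓝 (0 : Q), ∀ m ∈ V, ∀ q ∈ S, T m q ∈ W := by
    intro W hW
    obtain ⟨C, ⟨hC, hCc⟩, hCW⟩ := (closed_nhds_basis (0 : K)).mem_iff.1 hW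
    have h1 : Filter.Tendsto (fun p : M × E => T p.1 (π p.2)) (𝓝 0 ×ˢ 𝓝 0) (𝓝 0) := by
      have := h.tendsto (0, 0)
      rwa [map_zero, LinearMap.zero_apply, nhds_prod_eq] at this
    obtain ⟨V, hV, S, hS, hVS⟩ := Filter.mem_prod_iff.1 (h1 hC)
    refine ⟨V, hV, _, hπ S hS, fun m hm q hq => hCW ?_⟩
    have h2 : closure (π '' S) ⊆ T m ⁻¹' C := by
      refine closure_minimal ?_ (hCc.preimage (hT m))
      rintro _ ⟨x, hx, rfl⟩
      exact hVS (Set.mk_mem_prod hm hx)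
    exact h2 hq
  let f : M →+ Q →+ K := AddMonoidHom.mk' (fun m => (T m).toAddMonoidHom)
    (fun m m' => by ext z; simp)
  refine continuous_of_continuousAt_zero₂ f ?_ ?_ ?_
  · change Filter.Tendsto (fun p : M × Q => T p.1 p.2) (𝓝 (0, 0)) (𝓝 (T 0 0))
    rw [map_zero]
    intro W hW
    obtain ⟨V, hV, S, hS, hVS⟩ := key W hW
    rw [Filter.mem_map, nhds_prod_eq]
    filter_upwards [Filter.prod_mem_prod hV hS] with p hp
    exact hVS _ hp.1 _ hp.2
  · exact fun m => (hT m).continuousAt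
  · intro q
    change Filter.Tendsto (fun m => T m q) (𝓝 0) (𝓝 (T 0 q))
    rw [map_zero, LinearMap.zero_apply]
    intro W hW
    obtain ⟨V, hV, S, hS, hVS⟩ := key W hW
    obtain ⟨r, hr, ht⟩ := exists_smul_mem_of_mem_nhds hS q
    rw [Filter.mem_map]
    filter_upwards [setOf_smul_mem_mem_nhds hV r⁻¹] with m hm
    have h3 := hVS _ hm _ ht
    rwa [map_smul, map_smul, LinearMap.smul_apply, smul_smul, Complex.ofReal_inv,
      mul_inv_cancel₀ (by exact_mod_cast hr.ne'), one_smul] at h3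

end Toolkit

/-! ### Morphisms of modules and tensor products over an algebra -/

section ModuleToolkit

variable {A : Type u} [Ring A] [Algebra ℂ A] [UniformSpace A]

attribute [ext] LMod.Hom

theorem TensorOver.ext {X : RMod.{u, v} A} {Y : LMod.{u, w} A} {K : Type*} [AddCommGroup K]
    [Module ℂ K] [TopologicalSpace K] [T2Space K] {f g : TensorOver X Y →L[ℂ] K}
    (h : ∀ x y, f (TensorOver.proj X Y (tmk x y)) = g (TensorOver.proj X Y (tmk x y))) :
    f = g := by
  have h1 : f.comp (TensorOver.proj X Y) = g.comp (TensorOver.proj X Y) :=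
    CTensor.ext fun x y => h x y
  refine Cpl.ext fun t => ?_
  obtain ⟨t, rfl⟩ := (balancer X Y).mkQ_surjective t
  exact DFunLike.congr_fun h1 t

theorem TensorOver.closure_image_proj (X : RMod.{u, v} A) (Y : LMod.{u, w} A) {S : Set (X ⊗̂ Y)}
    (hS : S ∈ 𝓝 0) : closure (TensorOver.proj X Y '' S) ∈ 𝓝 0 := by
  have h1 := (balancer X Y).isOpenMap_mkQ.image_mem_nhds hS
  rw [map_zero] at h1
  have h2 := Cpl.closure_mem_nhds h1
  rwa [Set.image_image] at h2

@[simp]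
theorem TensorOver.map_proj (X : RMod.{u, v} A) {Y : LMod.{u, w} A} {Y' : LMod.{u, w'} A}
    (φ : LMod.Hom Y Y') (t : X ⊗̂ Y) : TensorOver.map X φ (TensorOver.proj X Y t) =
      TensorOver.proj X Y' (CTensor.map (.id ℂ X) φ.toCLM t) :=
  TensorOver.lift_proj _ _ _ _ _

section LiftRight

variable {M K : Type*} [AddCommGroup M] [Module ℂ M] [UniformSpace M] [IsCompleteLCS M]
  [AddCommGroup K] [Module ℂ K] [UniformSpace K] [IsCompleteLCS K]

/-- The partial map `t ↦ b (t ⊗ m)` on `X ⊗̂_A Y` that a balanced map `b` induces. -/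
def TensorOver.liftAt (X : RMod.{u, v} A) (Y : LMod.{u, w} A) (b : (X ⊗̂ Y) ⊗̂ M →L[ℂ] K)
    (hb : ∀ x a y m, b (tmk (tmk (X.act a x) y) m) = b (tmk (tmk x (Y.act a y)) m)) (m : M) :
    TensorOver X Y →L[ℂ] K :=
  TensorOver.lift X Y (b.comp (CTensor.mkLeft m)) fun x a y => hb x a y m

theorem TensorOver.liftAt_proj (X : RMod.{u, v} A) (Y : LMod.{u, w} A) (b : (X ⊗̂ Y) ⊗̂ M →L[ℂ] K)
    (hb : ∀ x a y m, b (tmk (tmk (X.act a x) y) m) = b (tmk (tmk x (Y.act a y)) m)) (m : M)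
    (t : X ⊗̂ Y) : TensorOver.liftAt X Y b hb m (TensorOver.proj X Y t) = b (tmk t m) :=
  TensorOver.lift_proj X Y (b.comp (CTensor.mkLeft m)) (fun x a y => hb x a y m) t

attribute [irreducible] TensorOver.liftAt

/-- The bilinear map `(m, t) ↦ b (t ⊗ m)` that a balanced map `b` induces on `M × (X ⊗̂_A Y)`. -/
def TensorOver.liftRightAux (X : RMod.{u, v} A) (Y : LMod.{u, w} A)
    (b : (X ⊗̂ Y) ⊗̂ M →L[ℂ] K)
    (hb : ∀ x a y m, b (tmk (tmk (X.act a x) y) m) = b (tmk (tmk x (Y.act a y)) m)) :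
    M →ₗ[ℂ] TensorOver X Y →ₗ[ℂ] K where
  toFun m := (TensorOver.liftAt X Y b hb m).toLinearMap
  map_add' m m' := by
    have : TensorOver.liftAt X Y b hb (m + m') =
        TensorOver.liftAt X Y b hb m + TensorOver.liftAt X Y b hb m' :=
      TensorOver.ext fun x y => by
        rw [add_apply]
        simp only [TensorOver.liftAt_proj, map_add]
    rw [this]
    rfl
  map_smul' c m := by
    have : TensorOver.liftAt X Y b hb (c • m) = c • TensorOver.liftAt X Y b hb m :=
      TensorOver.ext fun x y => by
        rw [smul_apply]
        simp only [TensorOver.liftAt_proj, map_smul]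
    rw [this]
    rfl

theorem TensorOver.liftRightAux_apply (X : RMod.{u, v} A) (Y : LMod.{u, w} A)
    (b : (X ⊗̂ Y) ⊗̂ M →L[ℂ] K)
    (hb : ∀ x a y m, b (tmk (tmk (X.act a x) y) m) = b (tmk (tmk x (Y.act a y)) m))
    (m : M) (t : TensorOver X Y) :
    TensorOver.liftRightAux X Y b hb m t = TensorOver.liftAt X Y b hb m t := rfl

attribute [irreducible] TensorOver.liftRightAux

theorem TensorOver.continuous_liftRightAux (X : RMod.{u, v} A) (Y : LMod.{u, w} A)
    (b : (X ⊗̂ Y) ⊗̂ M →L[ℂ] K)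
    (hb : ∀ x a y m, b (tmk (tmk (X.act a x) y) m) = b (tmk (tmk x (Y.act a y)) m)) :
    Continuous fun p : M × TensorOver X Y => TensorOver.liftRightAux X Y b hb p.1 p.2 := by
  refine continuous_bilin_of_closure_image (TensorOver.proj X Y)
    (fun S hS => TensorOver.closure_image_proj X Y hS) (TensorOver.liftRightAux X Y b hb)
    (fun m => ?_) ?_
  · exact (TensorOver.liftAt X Y b hb m).continuous.congr fun t =>
      (TensorOver.liftRightAux_apply X Y b hb m t).symm
  · have h : Continuous fun p : M × (X ⊗̂ Y) => b (tmk p.2 p.1) :=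
      b.continuous.comp (continuous_tmk_comp continuous_snd continuous_fst)
    refine h.congr fun p => ?_
    rw [TensorOver.liftRightAux_apply, TensorOver.liftAt_proj]

/-- The continuous linear map on `(X ⊗̂_A Y) ⊗̂ M` induced by a continuous linear map on
`(X ⊗̂ Y) ⊗̂ M` which is `A`-balanced in the first two factors. -/
def TensorOver.liftRight (X : RMod.{u, v} A) (Y : LMod.{u, w} A) (b : (X ⊗̂ Y) ⊗̂ M →L[ℂ] K)
    (hb : ∀ x a y m, b (tmk (tmk (X.act a x) y) m) = b (tmk (tmk x (Y.act a y)) m)) :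
    TensorOver X Y ⊗̂ M →L[ℂ] K :=
  CTensor.lift (TensorOver.liftRightAux X Y b hb).flip
    ((TensorOver.continuous_liftRightAux X Y b hb).comp continuous_swap)

@[simp]
theorem TensorOver.liftRight_tmk (X : RMod.{u, v} A) (Y : LMod.{u, w} A)
    (b : (X ⊗̂ Y) ⊗̂ M →L[ℂ] K)
    (hb : ∀ x a y m, b (tmk (tmk (X.act a x) y) m) = b (tmk (tmk x (Y.act a y)) m))
    (t : X ⊗̂ Y) (m : M) :
    TensorOver.liftRight X Y b hb (tmk (TensorOver.proj X Y t) m) = b (tmk t m) :=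
  (CTensor.lift_tmk _ _ _ _).trans <| (TensorOver.liftRightAux_apply X Y b hb _ _).trans
    (TensorOver.liftAt_proj X Y b hb m t)

theorem TensorOver.ext_tensor {X : RMod.{u, v} A} {Y : LMod.{u, w} A}
    {f g : TensorOver X Y ⊗̂ M →L[ℂ] K}
    (h : ∀ x y m, f (tmk (TensorOver.proj X Y (tmk x y)) m) =
      g (tmk (TensorOver.proj X Y (tmk x y)) m)) : f = g :=
  CTensor.ext fun t m => DFunLike.congr_fun (TensorOver.ext (f := f.comp (CTensor.mkLeft m))
    (g := g.comp (CTensor.mkLeft m)) fun x y => h x y m) t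

end LiftRight

end ModuleToolkit

section Category

variable {A : Type u} [Ring A] [Algebra ℂ A] [UniformSpace A]
variable {M : LMod.{u, w} A} {N : LMod.{u, w'} A} {P : LMod.{u, v} A}

/-- The action of a single element as a continuous linear map. -/
def LMod.actCLM (M : LMod.{u, w} A) (a : A) : M →L[ℂ] M :=
  ⟨M.act a, M.continuous_act.comp (continuous_const.prodMk continuous_id)⟩

/-- The identity morphism. -/
def LMod.Hom.id (M : LMod.{u, w} A) : LMod.Hom M M := ⟨.id ℂ M, fun _ _ => rfl⟩

/-- The composition of morphisms. -/
def LMod.Hom.comp (g : LMod.Hom N P) (f : LMod.Hom M N) : LMod.Hom M P :=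
  ⟨g.toCLM.comp f.toCLM, fun a x => by simp [f.map_act, g.map_act]⟩

instance : Zero (LMod.Hom M N) := ⟨⟨0, fun a x => by simp⟩⟩

instance : Sub (LMod.Hom M N) :=
  ⟨fun f g => ⟨f.toCLM - g.toCLM, fun a x => by simp [f.map_act, g.map_act]⟩⟩

@[simp] theorem LMod.Hom.id_toCLM (M : LMod.{u, w} A) : (LMod.Hom.id M).toCLM = .id ℂ M := rfl

@[simp] theorem LMod.Hom.comp_toCLM (g : LMod.Hom N P) (f : LMod.Hom M N) :
    (g.comp f).toCLM = g.toCLM.comp f.toCLM := rfl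

@[simp] theorem LMod.Hom.zero_toCLM : (0 : LMod.Hom M N).toCLM = 0 := rfl

@[simp] theorem LMod.Hom.sub_toCLM (f g : LMod.Hom M N) : (f - g).toCLM = f.toCLM - g.toCLM := rfl

variable (X : RMod.{u, v} A)

theorem TensorOver.map_id (M : LMod.{u, w} A) :
    TensorOver.map X (LMod.Hom.id M) = .id ℂ (TensorOver X M) :=
  TensorOver.ext fun x y => by rw [TensorOver.map_proj]; simp

theorem TensorOver.map_comp {P : LMod A} (g : LMod.Hom N P) (f : LMod.Hom M N) :
    TensorOver.map X (g.comp f) = (TensorOver.map X g).comp (TensorOver.map X f) :=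
  TensorOver.ext fun x y => by
    rw [ContinuousLinearMap.comp_apply]
    simp only [TensorOver.map_proj, CTensor.map_tmk]
    simp

theorem TensorOver.map_zero : TensorOver.map X (0 : LMod.Hom M N) = 0 :=
  TensorOver.ext fun x y => by rw [TensorOver.map_proj]; simp

theorem TensorOver.map_sub (f g : LMod.Hom M N) :
    TensorOver.map X (f - g) = TensorOver.map X f - TensorOver.map X g :=
  TensorOver.ext fun x y => by
    rw [sub_apply]
    simp only [TensorOver.map_proj, CTensor.map_tmk]
    simp

theorem LMod.IsProjective.of_retract {P P' : LMod.{u, w} A} (hP : P.IsProjective)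
    (i : LMod.Hom P' P) (r : LMod.Hom P P') (hri : r.comp i = LMod.Hom.id P') :
    P'.IsProjective := by
  intro X Y σ hσ φ
  obtain ⟨ψ, hψ⟩ := hP X Y σ hσ (φ.comp r)
  refine ⟨ψ.comp i, ?_⟩
  rw [LMod.Hom.comp_toCLM, ← ContinuousLinearMap.comp_assoc, hψ]
  have h : (φ.comp (r.comp i)).toCLM = φ.toCLM := by rw [hri]; rfl
  exact h

end Category

/-! ### Free modules and projective modules -/

section Free

variable {A : Type u} [Ring A] [Algebra ℂ A] [UniformSpace A] [IsTensorAlgebra A]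

/-- The action of a module as a continuous linear map `A ⊗̂ M → M`. -/
def LMod.actMap (M : LMod.{u, w} A) : A ⊗̂ M →L[ℂ] M := CTensor.lift M.act M.continuous_act

@[simp]
theorem LMod.actMap_tmk (M : LMod.{u, w} A) (a : A) (x : M) : M.actMap (tmk a x) = M.act a x :=
  CTensor.lift_tmk _ _ a x

section FreeDef

variable (A) (E : Type w) [AddCommGroup E] [Module ℂ E] [UniformSpace E] [IsCompleteLCS E]

/-- The trilinear map `(a, b, x) ↦ a b ⊗ x`. -/
def LMod.freeAux : A →ₗ[ℂ] A →ₗ[ℂ] E →ₗ[ℂ] A ⊗̂ E :=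
  LinearMap.mk₂ ℂ (fun a b => tmk (a * b)) (fun a a' b => by simp [add_mul])
    (fun c a b => by simp) (fun a b b' => by simp [mul_add]) (fun c a b => by simp)

@[simp]
theorem LMod.freeAux_apply (a b : A) (x : E) : LMod.freeAux A E a b x = tmk (a * b) x := rfl

theorem LMod.continuous_freeAux :
    Continuous fun p : A × A × E => LMod.freeAux A E p.1 p.2.1 p.2.2 :=
  continuous_tmk_comp (continuous_fst.mul continuous_snd.fst) continuous_snd.snd

/-- The free module `A ⊗̂ E`. -/
def LMod.free : LMod.{u, max u w} A where
  carrier := A ⊗̂ E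
  act := CTensor.lift₃ (LMod.freeAux A E) (LMod.continuous_freeAux A E)
  continuous_act := CTensor.continuous_lift₃ _ (LMod.continuous_freeAux A E)
  one_act := fun t => by
    let f : A ⊗̂ E →L[ℂ] A ⊗̂ E := ⟨CTensor.lift₃ (LMod.freeAux A E) (LMod.continuous_freeAux A E) 1,
      CTensor.continuous_lift₃_right _ _ _⟩
    have h : f = .id ℂ _ := CTensor.ext fun a x => by simp [f]
    exact DFunLike.congr_fun h t
  mul_act := fun a b t => by
    let f (a : A) : A ⊗̂ E →L[ℂ] A ⊗̂ E :=
      ⟨CTensor.lift₃ (LMod.freeAux A E) (LMod.continuous_freeAux A E) a,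
        CTensor.continuous_lift₃_right _ _ _⟩
    have h : f (a * b) = (f a).comp (f b) := CTensor.ext fun a x => by simp [f, mul_assoc]
    exact DFunLike.congr_fun h t

/-- The canonical map `x ↦ 1 ⊗ x` into the free module. -/
def LMod.freeUnit : E →L[ℂ] LMod.free A E := CTensor.mkRight (1 : A)

theorem LMod.free_act_tmk (a b : A) (x : E) :
    (LMod.free A E).act a (tmk b x : A ⊗̂ E) = (tmk (a * b) x : A ⊗̂ E) :=
  CTensor.lift₃_tmk (LMod.freeAux A E) (LMod.continuous_freeAux A E) a b x

end FreeDef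

variable {E : Type w} [AddCommGroup E] [Module ℂ E] [UniformSpace E] [IsCompleteLCS E]

/-- The morphism `A ⊗̂ E → M` that extends a continuous linear map `E → M`. -/
def LMod.freeLift {M : LMod.{u, w'} A} (f : E →L[ℂ] M) : LMod.Hom (LMod.free A E) M where
  toCLM := (M.actMap).comp (CTensor.map (.id ℂ A) f)
  map_act := fun a t => by
    let g : A ⊗̂ E →L[ℂ] M := (M.actMap).comp (CTensor.map (.id ℂ A) f)
    have h : g.comp ((LMod.free A E).actCLM a) = (M.actCLM a).comp g :=
      CTensor.ext fun b x => by
        change g ((LMod.free A E).act a (tmk b x : A ⊗̂ E)) = M.act a (g (tmk b x))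
        rw [LMod.free_act_tmk]
        simp [g, M.mul_act]
    exact DFunLike.congr_fun h t

theorem LMod.freeLift_tmk {M : LMod.{u, w'} A} (f : E →L[ℂ] M) (a : A) (x : E) :
    (LMod.freeLift f).toCLM (tmk a x : A ⊗̂ E) = M.act a (f x) := by
  change (M.actMap).comp (CTensor.map (.id ℂ A) f) (tmk a x) = _
  simp

@[simp]
theorem LMod.freeLift_freeUnit {M : LMod.{u, w'} A} (f : E →L[ℂ] M) (x : E) :
    (LMod.freeLift f).toCLM (LMod.freeUnit A E x) = f x :=
  (LMod.freeLift_tmk f 1 x).trans (M.one_act _)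

/-- A morphism from a free module is determined by its values at all `1 ⊗ x`. -/
theorem LMod.free_hom_ext {M : LMod.{u, w'} A} {f g : LMod.Hom (LMod.free A E) M}
    (h : ∀ x : E, f.toCLM (LMod.freeUnit A E x) = g.toCLM (LMod.freeUnit A E x)) : f = g := by
  refine LMod.Hom.ext (CTensor.ext fun a x => ?_)
  have h1 : (tmk a x : A ⊗̂ E) = (LMod.free A E).act a (LMod.freeUnit A E x) :=
    ((LMod.free_act_tmk A E a 1 x).trans (by rw [mul_one])).symm
  rw [h1]
  exact (f.map_act a _).trans ((congrArg _ (h x)).trans (g.map_act a _).symm)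

theorem LMod.isProjective_free (E : Type w) [AddCommGroup E] [Module ℂ E] [UniformSpace E]
    [IsCompleteLCS E] : (LMod.free A E).IsProjective := by
  rintro X Y σ ⟨τ, hτ⟩ φ
  refine ⟨LMod.freeLift (τ.comp (φ.toCLM.comp (LMod.freeUnit A E))), ?_⟩
  refine congrArg LMod.Hom.toCLM (LMod.free_hom_ext (f := σ.comp _) fun x => ?_)
  simpa using DFunLike.congr_fun hτ (φ.toCLM (LMod.freeUnit A E x))

/-- A projective module is a retract of the free module on its underlying space. -/
theorem LMod.IsProjective.exists_section {P : LMod.{u, max u w} A} (hP : P.IsProjective) :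
    ∃ j : LMod.Hom P (LMod.free A P), (LMod.freeLift (.id ℂ P)).comp j = LMod.Hom.id P := by
  obtain ⟨j, hj⟩ := hP (LMod.free A P) P (LMod.freeLift (.id ℂ P))
    ⟨LMod.freeUnit A P, ContinuousLinearMap.ext fun x => by simp⟩
    (LMod.Hom.id P)
  exact ⟨j, LMod.Hom.ext hj⟩

/-- A morphism `φ` from a projective module to `N` lifts along `d : M → N` as soon as its image is
split off by a continuous linear map `s`, i.e. `d s φ = φ`. The lift is constructed on the free
module that covers `P`, so that no module structure on the kernel of the next differential is
needed. -/
theorem LMod.IsProjective.exists_lift {P : LMod.{u, max u w} A} (hP : P.IsProjective)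
    {M : LMod.{u, w'} A} {N : LMod.{u, v} A} (d : LMod.Hom M N) (s : N →L[ℂ] M)
    (φ : LMod.Hom P N) (h : d.toCLM.comp (s.comp φ.toCLM) = φ.toCLM) :
    ∃ ψ : LMod.Hom P M, d.comp ψ = φ := by
  obtain ⟨j, hj⟩ := hP.exists_section
  refine ⟨(LMod.freeLift (s.comp φ.toCLM)).comp j, ?_⟩
  have h1 : d.comp (LMod.freeLift (s.comp φ.toCLM)) = φ.comp (LMod.freeLift (.id ℂ P)) :=
    LMod.free_hom_ext fun x => by
      simpa using DFunLike.congr_fun h x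
  calc d.comp ((LMod.freeLift (s.comp φ.toCLM)).comp j)
      = (d.comp (LMod.freeLift (s.comp φ.toCLM))).comp j := rfl
    _ = φ.comp ((LMod.freeLift (.id ℂ P)).comp j) := by rw [h1]; rfl
    _ = φ := by rw [hj]; rfl

end Free

/-! ### The bar resolution -/

section Bar

variable {A : Type u} [Ring A] [Algebra ℂ A] [UniformSpace A] [IsTensorAlgebra A]

/-- The inductive step of the bar resolution: the morphism `a ⊗ t ↦ a t - a ⊗ e(t)` for `t ∈ A ⊗̂ N`
and a given morphism `e : A ⊗̂ N → N`. -/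
def LMod.barStep {N : LMod.{u, w} A} (e : LMod.Hom (LMod.free A N) N) :
    LMod.Hom (LMod.free A (LMod.free A N)) (LMod.free A N) :=
  LMod.freeLift (.id ℂ (LMod.free A N)) - LMod.freeLift ((LMod.freeUnit A N).comp e.toCLM)

theorem LMod.barStep_freeUnit {N : LMod.{u, w} A} (e : LMod.Hom (LMod.free A N) N)
    (t : LMod.free A N) : (LMod.barStep e).toCLM (LMod.freeUnit A _ t) =
      t - LMod.freeUnit A N (e.toCLM t) := by
  simp [LMod.barStep]

theorem LMod.comp_barStep {N : LMod.{u, w} A} (e : LMod.Hom (LMod.free A N) N)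
    (h : ∀ t, e.toCLM (LMod.freeUnit A N (e.toCLM t)) = e.toCLM t) :
    e.comp (LMod.barStep e) = 0 :=
  LMod.free_hom_ext fun t => by simp [LMod.barStep_freeUnit, h]

theorem LMod.barStep_freeUnit_barStep {N : LMod.{u, w} A} (e : LMod.Hom (LMod.free A N) N)
    (h : e.comp (LMod.barStep e) = 0) (t : LMod.free A (LMod.free A N)) :
    (LMod.barStep e).toCLM (LMod.freeUnit A _ ((LMod.barStep e).toCLM t)) =
      (LMod.barStep e).toCLM t := by
  have h1 : e.toCLM ((LMod.barStep e).toCLM t) = 0 :=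
    DFunLike.congr_fun (congrArg LMod.Hom.toCLM h) t
  rw [LMod.barStep_freeUnit, h1, _root_.map_zero, sub_zero]

theorem LMod.freeUnit_comp_add_barStep_comp {N : LMod.{u, w} A} (e : LMod.Hom (LMod.free A N) N) :
    (LMod.freeUnit A N).comp e.toCLM + (LMod.barStep e).toCLM.comp (LMod.freeUnit A _) =
      .id ℂ (LMod.free A N) :=
  ContinuousLinearMap.ext fun t => by simp [LMod.barStep_freeUnit]

/-- The modules `A ⊗̂ ⋯ ⊗̂ A ⊗̂ Y` of the bar resolution. -/
def LMod.barObj (Y : LMod.{u, w} A) : ℕ → LMod.{u, max u w} A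
  | 0 => LMod.free A Y
  | n + 1 => LMod.free A (LMod.barObj Y n)

/-- The differentials of the bar resolution. -/
def LMod.barD (Y : LMod.{u, w} A) : ∀ n, LMod.Hom (LMod.barObj Y (n + 1)) (LMod.barObj Y n)
  | 0 => LMod.barStep (LMod.freeLift (.id ℂ Y))
  | n + 1 => LMod.barStep (LMod.barD Y n)

theorem LMod.freeLift_comp_barD (Y : LMod.{u, w} A) :
    (LMod.freeLift (.id ℂ Y)).comp (LMod.barD Y 0) = 0 :=
  LMod.comp_barStep (LMod.freeLift (.id ℂ Y)) fun t => by simp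

theorem LMod.barD_comp_barD (Y : LMod.{u, w} A) (n : ℕ) :
    (LMod.barD Y n).comp (LMod.barD Y (n + 1)) = 0 := by
  induction n with
  | zero => exact LMod.comp_barStep _ (LMod.barStep_freeUnit_barStep _ (LMod.freeLift_comp_barD Y))
  | succ n ih => exact LMod.comp_barStep _ (LMod.barStep_freeUnit_barStep _ ih)

/-- The bar resolution. Its contracting homotopy is `t ↦ 1 ⊗ t` in every degree. -/
def LMod.barResolution (Y : LMod.{u, w} A) : ProjResolution Y where
  obj := LMod.barObj Y
  aug := LMod.freeLift (.id ℂ Y)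
  d := LMod.barD Y
  projective := fun n => by
    cases n <;> exact LMod.isProjective_free _
  admissible :=
    ⟨congrArg LMod.Hom.toCLM (LMod.freeLift_comp_barD Y),
      fun n => congrArg LMod.Hom.toCLM (LMod.barD_comp_barD Y n),
      LMod.freeUnit A Y, fun n => LMod.freeUnit A (LMod.barObj Y n),
      ContinuousLinearMap.ext fun y => LMod.freeLift_freeUnit _ y,
      LMod.freeUnit_comp_add_barStep_comp (LMod.freeLift (.id ℂ Y)),
      fun n => LMod.freeUnit_comp_add_barStep_comp (LMod.barD Y n)⟩

end Bar

/-! ### Homotopy retracts of admissible complexes -/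

section Retract

variable {X X' : Type*} {C C' : ℕ → Type*} [AddCommGroup X] [Module ℂ X] [TopologicalSpace X]
  [AddCommGroup X'] [Module ℂ X'] [TopologicalSpace X']
  [∀ n, AddCommGroup (C n)] [∀ n, Module ℂ (C n)] [∀ n, UniformSpace (C n)]
  [∀ n, IsCompleteLCS (C n)] [∀ n, AddCommGroup (C' n)] [∀ n, Module ℂ (C' n)]
  [∀ n, UniformSpace (C' n)] [∀ n, IsCompleteLCS (C' n)]
  {e : C 0 →L[ℂ] X} {d : ∀ n, C (n + 1) →L[ℂ] C n}
  {e' : C' 0 →L[ℂ] X'} {d' : ∀ n, C' (n + 1) →L[ℂ] C' n}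

/-- Admissibility passes to homotopy retracts: if `f` and `g` are chain maps between augmented
complexes `C` and `C'` such that `1 - f g = d' h + h d'` on `C'`, and `s` is a contracting homotopy
of `C`, then `f s g + h` is a contracting homotopy of `C'`. -/
theorem IsAdmissible.of_homotopy_retract (hC : IsAdmissible e d) (he' : e'.comp (d' 0) = 0)
    (hd' : ∀ n, (d' n).comp (d' (n + 1)) = 0)
    (fX : X →L[ℂ] X') (f : ∀ n, C n →L[ℂ] C' n) (gX : X' →L[ℂ] X) (g : ∀ n, C' n →L[ℂ] C n)
    (h : ∀ n, C' n →L[ℂ] C' (n + 1))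
    (hf0 : ∀ x, e' (f 0 x) = fX (e x)) (hf : ∀ n x, d' n (f (n + 1) x) = f n (d n x))
    (hg0 : ∀ x, e (g 0 x) = gX (e' x)) (hg : ∀ n x, d n (g (n + 1) x) = g n (d' n x))
    (hX : ∀ x, fX (gX x) = x) (h0 : ∀ x, d' 0 (h 0 x) + f 0 (g 0 x) = x)
    (hh : ∀ n x, d' (n + 1) (h (n + 1) x) + h n (d' n x) + f (n + 1) (g (n + 1) x) = x) :
    IsAdmissible e' d' := by
  obtain ⟨-, -, s₀, s, hs, hs0, hsn⟩ := hC
  have ps : ∀ x, e (s₀ x) = x := fun x => DFunLike.congr_fun hs x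
  have ps0 : ∀ x, s₀ (e x) + d 0 (s 0 x) = x := fun x => DFunLike.congr_fun hs0 x
  have psn : ∀ n x, s n (d n x) + d (n + 1) (s (n + 1) x) = x :=
    fun n x => DFunLike.congr_fun (hsn n) x
  refine ⟨he', hd', (f 0).comp (s₀.comp gX), fun n => (f (n + 1)).comp ((s n).comp (g n)) + h n,
    ?_, ?_, fun n => ?_⟩
  · ext x
    simp [hf0, ps, hX]
  · ext x
    have h1 := congrArg (f 0) (ps0 (g 0 x))
    rw [map_add, hg0] at h1
    have h2 := h0 x
    rw [← h1] at h2
    simp only [add_apply, ContinuousLinearMap.comp_apply, map_add, hf, ContinuousLinearMap.id_apply]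
    exact Eq.trans (by abel) h2
  · ext x
    have h1 := congrArg (f (n + 1)) (psn n (g (n + 1) x))
    rw [map_add, hg] at h1
    have h2 := hh n x
    rw [← h1] at h2
    simp only [add_apply, ContinuousLinearMap.comp_apply, map_add, hf, ContinuousLinearMap.id_apply]
    exact Eq.trans (by abel) h2

/-- Admissibility passes to retracts. -/
theorem IsAdmissible.of_retract (hC : IsAdmissible e d)
    (fX : X →L[ℂ] X') (f : ∀ n, C n →L[ℂ] C' n) (gX : X' →L[ℂ] X) (g : ∀ n, C' n →L[ℂ] C n)
    (hf0 : ∀ x, e' (f 0 x) = fX (e x)) (hf : ∀ n x, d' n (f (n + 1) x) = f n (d n x))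
    (hg0 : ∀ x, e (g 0 x) = gX (e' x)) (hg : ∀ n x, d n (g (n + 1) x) = g n (d' n x))
    (hX : ∀ x, fX (gX x) = x) (hfg : ∀ n x, f n (g n x) = x) :
    IsAdmissible e' d' := by
  refine hC.of_homotopy_retract ?_ (fun n => ?_) fX f gX g (fun _ => 0) hf0 hf hg0 hg hX
    (fun x => by simp [hfg]) (fun n x => by simp [hfg])
  · ext x
    rw [← hfg 1 x]
    have := DFunLike.congr_fun hC.1 (g 1 x)
    simp only [ContinuousLinearMap.comp_apply, zero_apply] at this
    simp [hf, hf0, this]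
  · ext x
    rw [← hfg _ x]
    have := DFunLike.congr_fun (hC.2.1 n) (g (n + 2) x)
    simp only [ContinuousLinearMap.comp_apply, zero_apply] at this
    simp [hf, this]

/-- A retract of a topological isomorphism is a topological isomorphism. -/
theorem IsTopIso.of_retract {E F E' F' : Type*}
    [AddCommGroup E] [Module ℂ E] [TopologicalSpace E]
    [AddCommGroup F] [Module ℂ F] [TopologicalSpace F]
    [AddCommGroup E'] [Module ℂ E'] [TopologicalSpace E']
    [AddCommGroup F'] [Module ℂ F'] [TopologicalSpace F']
    {φ : E →L[ℂ] F} (hφ : IsTopIso φ) {φ' : E' →L[ℂ] F'}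
    (i : E' →L[ℂ] E) (r : E →L[ℂ] E') (i' : F' →L[ℂ] F) (r' : F →L[ℂ] F')
    (hi : ∀ x, φ (i x) = i' (φ' x)) (hr : ∀ x, φ' (r x) = r' (φ x))
    (hri : ∀ x, r (i x) = x) (hri' : ∀ x, r' (i' x) = x) : IsTopIso φ' := by
  obtain ⟨ψ, h1, h2⟩ := hφ
  have h1 : ∀ x, ψ (φ x) = x := fun x => DFunLike.congr_fun h1 x
  have h2 : ∀ x, φ (ψ x) = x := fun x => DFunLike.congr_fun h2 x
  refine ⟨r.comp (ψ.comp i'), ?_, ?_⟩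
  · ext x
    simp [← hi, h1, hri]
  · ext x
    simp [hr, h2, hri']

end Retract

/-! ### Independence of the projective resolution -/

/-- A form of dependent choice: a sequence in which any two consecutive terms are related can be
built if every related pair can be continued. -/
theorem exists_seq_of_step {α : ℕ → Type*} (p₀ : α 0 → Prop) (p : ∀ n, α n → α (n + 1) → Prop)
    (h₀ : ∃ a, p₀ a) (h₁ : ∀ a, p₀ a → ∃ b, p 0 a b)
    (h : ∀ n a b, p n a b → ∃ c, p (n + 1) b c) :
    ∃ f : ∀ n, α n, p₀ (f 0) ∧ ∀ n, p n (f n) (f (n + 1)) := by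
  obtain ⟨a, ha⟩ := h₀
  obtain ⟨b, hb⟩ := h₁ a ha
  choose c hc using h
  -- the state at stage `n` is a related pair in degrees `n` and `n + 1`
  let S : ∀ n, {q : α n × α (n + 1) // p n q.1 q.2} := fun n => Nat.rec ⟨(a, b), hb⟩
    (fun n q => ⟨(q.1.2, c n q.1.1 q.1.2 q.2), hc n q.1.1 q.1.2 q.2⟩) n
  exact ⟨fun n => (S n).1.1, ha, fun n => (S n).2⟩

section Comparison

variable {A : Type u} [Ring A] [Algebra ℂ A] [UniformSpace A]

theorem LMod.Hom.comp_assoc {M : LMod.{u, w} A} {N P R : LMod A} (h : LMod.Hom P R)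
    (g : LMod.Hom N P) (f : LMod.Hom M N) : (h.comp g).comp f = h.comp (g.comp f) := rfl

theorem LMod.Hom.apply_eq_of_comp_eq {M N N' P : LMod A} {g : LMod.Hom N P} {f : LMod.Hom M N}
    {g' : LMod.Hom N' P} {f' : LMod.Hom M N'} (h : g.comp f = g'.comp f') (x : M) :
    g.toCLM (f.toCLM x) = g'.toCLM (f'.toCLM x) :=
  DFunLike.congr_fun (congrArg LMod.Hom.toCLM h) x

namespace ProjResolution

variable {Y : LMod.{u, w} A} (Q Q' : ProjResolution Y)

theorem aug_d_apply (x : Q.obj 1) : Q.aug.toCLM ((Q.d 0).toCLM x) = 0 :=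
  DFunLike.congr_fun Q.admissible.1 x

theorem d_d_apply (n : ℕ) (x : Q.obj (n + 2)) :
    (Q.d n).toCLM ((Q.d (n + 1)).toCLM x) = 0 :=
  DFunLike.congr_fun (Q.admissible.2.1 n) x

variable [IsTensorAlgebra A]

theorem exists_lift_aug {P : LMod.{u, max u w} A} (hP : P.IsProjective) (φ : LMod.Hom P Y) :
    ∃ ψ : LMod.Hom P (Q.obj 0), Q.aug.comp ψ = φ := by
  obtain ⟨-, -, s₀, s, hs, -, -⟩ := Q.admissible
  exact hP.exists_lift Q.aug s₀ φ (by rw [← ContinuousLinearMap.comp_assoc, hs]; rfl)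

theorem exists_lift_zero {P : LMod.{u, max u w} A} (hP : P.IsProjective)
    (φ : LMod.Hom P (Q.obj 0)) (h : ∀ x, Q.aug.toCLM (φ.toCLM x) = 0) :
    ∃ ψ : LMod.Hom P (Q.obj 1), (Q.d 0).comp ψ = φ := by
  obtain ⟨-, -, s₀, s, -, hs, -⟩ := Q.admissible
  refine hP.exists_lift (Q.d 0) (s 0) φ (ContinuousLinearMap.ext fun x => ?_)
  have h1 := DFunLike.congr_fun hs (φ.toCLM x)
  simpa [h] using h1

theorem exists_lift_succ {P : LMod.{u, max u w} A} (hP : P.IsProjective) (n : ℕ)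
    (φ : LMod.Hom P (Q.obj (n + 1))) (h : ∀ x, (Q.d n).toCLM (φ.toCLM x) = 0) :
    ∃ ψ : LMod.Hom P (Q.obj (n + 2)), (Q.d (n + 1)).comp ψ = φ := by
  obtain ⟨-, -, s₀, s, -, -, hs⟩ := Q.admissible
  refine hP.exists_lift (Q.d (n + 1)) (s (n + 1)) φ (ContinuousLinearMap.ext fun x => ?_)
  have h1 := DFunLike.congr_fun (hs n) (φ.toCLM x)
  simpa [h] using h1

/-- Any two projective resolutions are related by a chain map over the identity. -/
theorem exists_chainMap : ∃ f : ∀ n, LMod.Hom (Q.obj n) (Q'.obj n),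
    Q'.aug.comp (f 0) = Q.aug ∧ ∀ n, (Q'.d n).comp (f (n + 1)) = (f n).comp (Q.d n) := by
  refine exists_seq_of_step (α := fun n => LMod.Hom (Q.obj n) (Q'.obj n))
    (fun f => Q'.aug.comp f = Q.aug) (fun n f f' => (Q'.d n).comp f' = f.comp (Q.d n))
    (Q'.exists_lift_aug (Q.projective 0) Q.aug) (fun f hf => ?_) (fun n f f' hf => ?_)
  · refine Q'.exists_lift_zero (Q.projective 1) _ fun x => ?_
    have h1 := DFunLike.congr_fun (congrArg LMod.Hom.toCLM hf) ((Q.d 0).toCLM x)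
    exact h1.trans (Q.aug_d_apply x)
  · refine Q'.exists_lift_succ (Q.projective (n + 2)) n _ fun x => ?_
    have h1 := LMod.Hom.apply_eq_of_comp_eq hf ((Q.d (n + 1)).toCLM x)
    rw [Q.d_d_apply, _root_.map_zero] at h1
    exact h1

/-- A chain map over zero between projective resolutions is null-homotopic. -/
theorem exists_homotopy (φ : ∀ n, LMod.Hom (Q.obj n) (Q'.obj n))
    (h₀ : ∀ x, Q'.aug.toCLM ((φ 0).toCLM x) = 0)
    (h : ∀ n x, (Q'.d n).toCLM ((φ (n + 1)).toCLM x) = (φ n).toCLM ((Q.d n).toCLM x)) :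
    ∃ k : ∀ n, LMod.Hom (Q.obj n) (Q'.obj (n + 1)), (Q'.d 0).comp (k 0) = φ 0 ∧
      ∀ n, (Q'.d (n + 1)).comp (k (n + 1)) = φ (n + 1) - (k n).comp (Q.d n) := by
  refine exists_seq_of_step (α := fun n => LMod.Hom (Q.obj n) (Q'.obj (n + 1)))
    (fun k => (Q'.d 0).comp k = φ 0)
    (fun n k k' => (Q'.d (n + 1)).comp k' = φ (n + 1) - k.comp (Q.d n))
    (Q'.exists_lift_zero (Q.projective 0) _ h₀) (fun k hk => ?_) (fun n k k' hk => ?_)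
  · refine Q'.exists_lift_succ (Q.projective 1) 0 _ fun x => ?_
    have h1 := DFunLike.congr_fun (congrArg LMod.Hom.toCLM hk) ((Q.d 0).toCLM x)
    simp only [LMod.Hom.comp_toCLM, ContinuousLinearMap.comp_apply] at h1
    simp [h, h1]
  · refine Q'.exists_lift_succ (Q.projective (n + 2)) (n + 1) _ fun x => ?_
    have h1 := DFunLike.congr_fun (congrArg LMod.Hom.toCLM hk) ((Q.d (n + 1)).toCLM x)
    simp only [LMod.Hom.comp_toCLM, ContinuousLinearMap.comp_apply, LMod.Hom.sub_toCLM,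
      sub_apply, Q.d_d_apply, _root_.map_zero, sub_zero] at h1
    simp [h, h1]

end ProjResolution

theorem TensorOver.map_map (X : RMod.{u, v} A) {M N P : LMod A} (g : LMod.Hom N P)
    (f : LMod.Hom M N) (t : TensorOver X M) :
    TensorOver.map X g (TensorOver.map X f t) = TensorOver.map X (g.comp f) t :=
  (DFunLike.congr_fun (TensorOver.map_comp X g f) t).symm

/-- If `X` is strongly transversal to `Y`, then every projective resolution of `Y` stays admissible
after tensoring with `X`. -/
theorem StronglyTransversal.isAdmissible [IsTensorAlgebra A] {X : RMod.{u, v} A}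
    {Y : LMod.{u, w} A} (h : StronglyTransversal X Y) (Q' : ProjResolution Y) :
    IsAdmissible (C := fun n => TensorOver X (Q'.obj n))
      (TensorOver.map X Q'.aug) fun n => TensorOver.map X (Q'.d n) := by
  obtain ⟨Q, hQ⟩ := h
  obtain ⟨f, hf0, hf⟩ := Q.exists_chainMap Q'
  obtain ⟨g, hg0, hg⟩ := Q'.exists_chainMap Q
  obtain ⟨k, hk0, hk⟩ := Q'.exists_homotopy Q'
    (fun n => LMod.Hom.id (Q'.obj n) - (f n).comp (g n))
    (fun x => by
      have h1 := DFunLike.congr_fun (congrArg LMod.Hom.toCLM hf0) ((g 0).toCLM x)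
      have h2 := DFunLike.congr_fun (congrArg LMod.Hom.toCLM hg0) x
      simp only [LMod.Hom.comp_toCLM, ContinuousLinearMap.comp_apply] at h1 h2
      simp [h1, h2])
    (fun n x => by
      have h1 := LMod.Hom.apply_eq_of_comp_eq (hf n) ((g (n + 1)).toCLM x)
      have h2 := LMod.Hom.apply_eq_of_comp_eq (hg n) x
      simp [h1, h2])
  refine hQ.of_homotopy_retract ?_ (fun n => ?_) (.id ℂ _) (fun n => TensorOver.map X (f n))
    (.id ℂ _) (fun n => TensorOver.map X (g n)) (fun n => TensorOver.map X (k n))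
    (fun x => ?_) (fun n x => ?_) (fun x => ?_) (fun n x => ?_) (fun x => rfl) (fun x => ?_)
    (fun n x => ?_)
  · rw [← TensorOver.map_comp, show Q'.aug.comp (Q'.d 0) = 0 from LMod.Hom.ext Q'.admissible.1,
      TensorOver.map_zero]
  · rw [← TensorOver.map_comp,
      show (Q'.d n).comp (Q'.d (n + 1)) = 0 from LMod.Hom.ext (Q'.admissible.2.1 n),
      TensorOver.map_zero]
  · rw [TensorOver.map_map, hf0]; rfl
  · rw [TensorOver.map_map, TensorOver.map_map, hf]
  · rw [TensorOver.map_map, hg0]; rfl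
  · rw [TensorOver.map_map, TensorOver.map_map, hg]
  · rw [TensorOver.map_map, TensorOver.map_map, hk0, TensorOver.map_sub, TensorOver.map_id]
    simp
  · rw [TensorOver.map_map, TensorOver.map_map, TensorOver.map_map, hk, TensorOver.map_sub,
      TensorOver.map_sub, TensorOver.map_id]
    simp

end Comparison

/-! ### The shear isomorphism -/

section Shear

variable {A : Type u} [Ring A] [Algebra ℂ A] [UniformSpace A] [IsTensorAlgebra A]

/-- The orbit map `a ↦ a x` as a continuous linear map. -/
def LMod.orbit (M : LMod.{u, w} A) (x : M) : A →L[ℂ] M := M.actMap.comp (CTensor.mkLeft x)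

@[simp]
theorem LMod.orbit_apply (M : LMod.{u, w} A) (x : M) (a : A) : M.orbit x a = M.act a x := by
  simp [LMod.orbit]

variable [HopfTensorAlgebra A]

open HopfTensorAlgebra

/-- The shear `a ⊗ x ↦ a₁ ⊗ S(a₂) x` of `A ⊗̂ M` that is twisted by a map `S : A → A`. -/
def LMod.shear (S : A →L[ℂ] A) (M : LMod.{u, w} A) : A ⊗̂ M →L[ℂ] A ⊗̂ M :=
  (CTensor.map (.id ℂ A) M.actMap).comp <| (CTensor.assoc A A M).comp <|
    CTensor.map ((CTensor.map (.id ℂ A) S).comp comul) (.id ℂ M)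

theorem LMod.shear_tmk (S : A →L[ℂ] A) (M : LMod.{u, w} A) (a : A) (x : M) :
    M.shear S (tmk a x) = CTensor.map (.id ℂ A) ((M.orbit x).comp S) (comul a) := by
  have h : ((CTensor.map (.id ℂ A) M.actMap).comp <| (CTensor.assoc A A M).comp <|
      CTensor.mkLeft x).comp (CTensor.map (.id ℂ A) S) =
      CTensor.map (.id ℂ A) ((M.orbit x).comp S) := CTensor.ext fun p q => by simp
  simpa [LMod.shear] using DFunLike.congr_fun h (comul a)

/-- Two twisted shears are inverse to each other if their twists are convolution inverse:
`a₁ ⊗ S(a₂) S'(a₃) x = a₁ ⊗ ε(a₂) x = a ⊗ x` by coassociativity and the counit axiom. -/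
theorem LMod.shear_shear (S S' : A →L[ℂ] A)
    (hS : ∀ a, mulMap A (CTensor.map S S' (comul a)) = algebraMap ℂ A (counit a))
    (M : LMod.{u, w} A) (t : A ⊗̂ M) : M.shear S (M.shear S' t) = t := by
  suffices h : (M.shear S).comp (M.shear S') = .id ℂ _ from DFunLike.congr_fun h t
  refine CTensor.ext fun a x => ?_
  rw [ContinuousLinearMap.comp_apply, LMod.shear_tmk, ContinuousLinearMap.id_apply]
  let Ψ : A ⊗̂ (A ⊗̂ A) →L[ℂ] A ⊗̂ M :=
    CTensor.map (.id ℂ A) ((M.orbit x).comp ((mulMap A).comp (CTensor.map S S')))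
  have h1 : (M.shear S).comp (CTensor.map (.id ℂ A) ((M.orbit x).comp S')) =
      Ψ.comp ((CTensor.assoc A A A).comp (CTensor.map comul (.id ℂ A))) := by
    refine CTensor.ext fun p q => ?_
    simp only [ContinuousLinearMap.comp_apply, CTensor.map_tmk, LMod.shear_tmk,
      ContinuousLinearMap.id_apply]
    have h2 : CTensor.map (.id ℂ A) ((M.orbit (M.orbit x (S' q))).comp S) =
        Ψ.comp ((CTensor.assoc A A A).comp (CTensor.mkLeft q)) :=
      CTensor.ext fun r s => by simp [Ψ, M.mul_act]
    exact DFunLike.congr_fun h2 (comul p)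
  have h3 : Ψ.comp (CTensor.map (.id ℂ A) comul) =
      (CTensor.mkLeft x).comp ((CTensor.rid A).comp
        (CTensor.map (.id ℂ A) (counit (H := A)).toContinuousLinearMap)) := by
    refine CTensor.ext fun p q => ?_
    simp [Ψ, hS, Algebra.algebraMap_eq_smul_one, M.one_act]
  calc M.shear S (CTensor.map (.id ℂ A) ((M.orbit x).comp S') (comul a))
      = Ψ (((CTensor.assoc A A A).comp ((CTensor.map comul (.id ℂ A)).comp comul)) a) :=
        DFunLike.congr_fun h1 (comul a)
    _ = Ψ (CTensor.map (.id ℂ A) comul (comul a)) := by rw [coassoc]; rfl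
    _ = tmk (((CTensor.rid A).comp ((CTensor.map (.id ℂ A)
          (counit (H := A)).toContinuousLinearMap).comp comul)) a) x :=
        DFunLike.congr_fun h3 (comul a)
    _ = tmk a x := by rw [comul_counit]; rfl

variable (V : Type v) [AddCommGroup V] [Module ℂ V] [UniformSpace V] [IsCompleteLCS V]

/-- The shear isomorphism `a ⊗ (v ⊗ x) ↦ (a₁ ⊗ v) ⊗ a₂ x`. -/
def LMod.shearTensor (M : LMod.{u, w} A) : A ⊗̂ (V ⊗̂ M) →L[ℂ] (A ⊗̂ V) ⊗̂ M :=
  (CTensor.swapLeft V A M).comp <| (CTensor.map (.id ℂ V) (M.shear (.id ℂ A))).comp <|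
    (CTensor.assoc V A M).comp (CTensor.swapLeft A V M)

/-- The inverse `(a ⊗ v) ⊗ x ↦ a₁ ⊗ (v ⊗ S(a₂) x)` of the shear isomorphism. -/
def LMod.shearTensorSymm (M : LMod.{u, w} A) : (A ⊗̂ V) ⊗̂ M →L[ℂ] A ⊗̂ (V ⊗̂ M) :=
  (CTensor.swapLeftSymm A V M).comp <| (CTensor.assocSymm V A M).comp <|
    (CTensor.map (.id ℂ V) (M.shear antipode)).comp (CTensor.swapLeftSymm V A M)

theorem LMod.shearTensor_tmk (M : LMod.{u, w} A) (a : A) (y : V) (x : M) :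
    LMod.shearTensor V M (tmk a (tmk y x)) =
      CTensor.map (CTensor.mkLeft y) (M.orbit x) (comul a) := by
  have h : (CTensor.swapLeft V A M).comp ((CTensor.mkRight y).comp
      (CTensor.map (.id ℂ A) ((M.orbit x).comp (.id ℂ A)))) =
      CTensor.map (CTensor.mkLeft y) (M.orbit x) := CTensor.ext fun p q => by simp
  have h1 := DFunLike.congr_fun h (comul a)
  simpa [LMod.shearTensor, LMod.shear_tmk] using h1

theorem LMod.shearTensorSymm_shearTensor (M : LMod.{u, w} A) (t : A ⊗̂ (V ⊗̂ M)) :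
    LMod.shearTensorSymm V M (LMod.shearTensor V M t) = t := by
  have h1 : ∀ s, CTensor.swapLeftSymm V A M (CTensor.swapLeft V A M s) = s :=
    DFunLike.congr_fun (CTensor.swapLeftSymm_comp_swapLeft V A M)
  have h2 : ∀ s, CTensor.swapLeftSymm A V M (CTensor.swapLeft A V M s) = s :=
    DFunLike.congr_fun (CTensor.swapLeftSymm_comp_swapLeft A V M)
  have h3 : (M.shear antipode).comp (M.shear (.id ℂ A)) = .id ℂ _ :=
    ContinuousLinearMap.ext (LMod.shear_shear _ _ antipode_left M)
  have h4 : ∀ s, CTensor.assocSymm V A M (CTensor.assoc V A M s) = s := DFunLike.congr_fun <|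
    show (CTensor.assocSymm V A M).comp (CTensor.assoc V A M) = .id ℂ _ from
      CTensor.ext_left fun x y z => by simp
  simp only [LMod.shearTensor, LMod.shearTensorSymm, ContinuousLinearMap.comp_apply]
  rw [h1, CTensor.map_map, h3, ContinuousLinearMap.id_comp, CTensor.map_id,
    ContinuousLinearMap.id_apply, h4, h2]

theorem LMod.shearTensor_shearTensorSymm (M : LMod.{u, w} A) (t : (A ⊗̂ V) ⊗̂ M) :
    LMod.shearTensor V M (LMod.shearTensorSymm V M t) = t := by
  have h1 : ∀ s, CTensor.swapLeft V A M (CTensor.swapLeftSymm V A M s) = s :=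
    DFunLike.congr_fun (CTensor.swapLeft_comp_swapLeftSymm V A M)
  have h2 : ∀ s, CTensor.swapLeft A V M (CTensor.swapLeftSymm A V M s) = s :=
    DFunLike.congr_fun (CTensor.swapLeft_comp_swapLeftSymm A V M)
  have h3 : (M.shear (.id ℂ A)).comp (M.shear antipode) = .id ℂ _ :=
    ContinuousLinearMap.ext (LMod.shear_shear _ _ antipode_right M)
  have h4 : ∀ s, CTensor.assoc V A M (CTensor.assocSymm V A M s) = s := DFunLike.congr_fun <|
    show (CTensor.assoc V A M).comp (CTensor.assocSymm V A M) = .id ℂ _ from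
      CTensor.ext_right fun x y z => by simp
  simp only [LMod.shearTensor, LMod.shearTensorSymm, ContinuousLinearMap.comp_apply]
  rw [h2, h4, CTensor.map_map, h3, ContinuousLinearMap.id_comp, CTensor.map_id,
    ContinuousLinearMap.id_apply, h1]

end Shear

/-! ### Tensor products of modules over a Hopf algebra -/

section Tensor

variable {A : Type u} [Ring A] [Algebra ℂ A] [UniformSpace A] [IsTensorAlgebra A]

section Action

variable (N : LMod.{u, v} A) (M : LMod.{u, w} A)

/-- The action `(a ⊗ b) ⊗ (y ⊗ x) ↦ a y ⊗ b x` of `A ⊗̂ A` on `N ⊗̂ M`. -/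
def LMod.tensorAct : (A ⊗̂ A) ⊗̂ (N ⊗̂ M) →L[ℂ] N ⊗̂ M :=
  (CTensor.map N.actMap M.actMap).comp (CTensor.interchange A A N M)

@[simp]
theorem LMod.tensorAct_tmk (a b : A) (y : N) (x : M) :
    LMod.tensorAct N M (tmk (tmk a b) (tmk y x)) = tmk (N.act a y) (M.act b x) := by
  simp [LMod.tensorAct]

theorem LMod.tensorAct_tmk_right (s : A ⊗̂ A) (y : N) (x : M) :
    LMod.tensorAct N M (tmk s (tmk y x)) = CTensor.map (N.orbit y) (M.orbit x) s := by
  have h : (LMod.tensorAct N M).comp (CTensor.mkLeft (tmk y x)) =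
    CTensor.map (N.orbit y) (M.orbit x) := CTensor.ext fun a b => by simp
  exact DFunLike.congr_fun h s

theorem LMod.tensorAct_one (t : N ⊗̂ M) : LMod.tensorAct N M (tmk (tmk 1 1) t) = t := by
  have h : (LMod.tensorAct N M).comp (CTensor.mkRight (tmk 1 1)) = .id ℂ _ :=
    CTensor.ext fun y x => by simp [N.one_act, M.one_act]
  exact DFunLike.congr_fun h t

theorem LMod.tensorAct_mul (r s : A ⊗̂ A) (t : N ⊗̂ M) :
    LMod.tensorAct N M (tmk (tensorMul A A (tmk r s)) t) =
      LMod.tensorAct N M (tmk r (LMod.tensorAct N M (tmk s t))) := by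
  have h : (LMod.tensorAct N M).comp (CTensor.map (tensorMul A A) (.id ℂ (N ⊗̂ M))) =
      (LMod.tensorAct N M).comp ((CTensor.map (.id ℂ (A ⊗̂ A)) (LMod.tensorAct N M)).comp
        (CTensor.assoc (A ⊗̂ A) (A ⊗̂ A) (N ⊗̂ M))) := by
    refine CTensor.ext_left fun r s t => ?_
    simp only [ContinuousLinearMap.comp_apply, CTensor.map_tmk, CTensor.assoc_tmk,
      ContinuousLinearMap.id_apply]
    have h1 : ∀ y : N, ∀ x : M,
        (CTensor.map (N.orbit y) (M.orbit x)).comp (tensorMul A A) =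
        (LMod.tensorAct N M).comp
          (CTensor.map (.id ℂ (A ⊗̂ A)) (CTensor.map (N.orbit y) (M.orbit x))) := fun y x =>
      CTensor.ext_both fun a b a' b' => by simp [tensorMul, N.mul_act, M.mul_act]
    have h2 : (LMod.tensorAct N M).comp (CTensor.mkRight (tensorMul A A (tmk r s))) =
        (LMod.tensorAct N M).comp ((CTensor.mkRight r).comp ((LMod.tensorAct N M).comp
          (CTensor.mkRight s))) := by
      refine CTensor.ext fun y x => ?_
      have h3 := DFunLike.congr_fun (h1 y x) (tmk r s)
      simpa [LMod.tensorAct_tmk_right] using h3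
    exact DFunLike.congr_fun h2 t
  simpa using DFunLike.congr_fun h (tmk (tmk r s) t)

end Action

variable [HopfTensorAlgebra A]

open HopfTensorAlgebra

/-- The bilinear map by which a Hopf algebra acts on the tensor product of two modules. -/
def LMod.tensorActBilin (N : LMod.{u, v} A) (M : LMod.{u, w} A) :
    A →ₗ[ℂ] N ⊗̂ M →ₗ[ℂ] N ⊗̂ M :=
  (tmk.comp (comul (H := A)).toLinearMap).compr₂ (LMod.tensorAct N M).toLinearMap

theorem LMod.tensorActBilin_apply (N : LMod.{u, v} A) (M : LMod.{u, w} A) (a : A) (t : N ⊗̂ M) :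
    LMod.tensorActBilin N M a t = LMod.tensorAct N M (tmk (comul a) t) := rfl

theorem LMod.continuous_tensorActBilin (N : LMod.{u, v} A) (M : LMod.{u, w} A) :
    Continuous fun p : A × (N ⊗̂ M) => LMod.tensorActBilin N M p.1 p.2 := by
  have h : Continuous fun p : A × (N ⊗̂ M) => tmk (comul p.1) p.2 :=
    continuous_tmk_comp ((comul (H := A)).continuous.comp continuous_fst) continuous_snd
  exact (LMod.tensorAct N M).continuous.comp h

attribute [irreducible] LMod.tensorActBilin

/-- The tensor product of two modules over a Hopf algebra `A`, on which `A` acts through the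
comultiplication. -/
def LMod.tensor (N : LMod.{u, v} A) (M : LMod.{u, w} A) : LMod.{u, max v w} A where
  carrier := N ⊗̂ M
  act := LMod.tensorActBilin N M
  continuous_act := LMod.continuous_tensorActBilin N M
  one_act := fun t => by
    rw [LMod.tensorActBilin_apply, comul_one, LMod.tensorAct_one]
  mul_act := fun a b t => by
    simp only [LMod.tensorActBilin_apply, comul_mul, LMod.tensorAct_mul]

theorem LMod.tensor_act (N : LMod.{u, v} A) (M : LMod.{u, w} A) (a : A) (t : N ⊗̂ M) :
    (LMod.tensor N M).act a t = LMod.tensorAct N M (tmk (comul a) t) :=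
  LMod.tensorActBilin_apply N M a t

theorem LMod.Hom.map_tensorAct {N : LMod.{u, v} A} {N' : LMod.{u, w'} A} (φ : LMod.Hom N N')
    (M : LMod.{u, w} A) (s : A ⊗̂ A) (t : N ⊗̂ M) :
    CTensor.map φ.toCLM (.id ℂ M) (LMod.tensorAct N M (tmk s t)) =
      LMod.tensorAct N' M (tmk s (CTensor.map φ.toCLM (.id ℂ M) t)) := by
  have h : (CTensor.map φ.toCLM (.id ℂ M)).comp (LMod.tensorAct N M) =
      (LMod.tensorAct N' M).comp (CTensor.map (.id ℂ _) (CTensor.map φ.toCLM (.id ℂ M))) :=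
    CTensor.ext_both fun a b y x => by simp [φ.map_act]
  simpa using DFunLike.congr_fun h (tmk s t)

/-- A morphism `φ : N → N'` induces a morphism `φ ⊗ 1 : N ⊗ M → N' ⊗ M`. -/
def LMod.Hom.tensorRight {N : LMod.{u, v} A} {N' : LMod.{u, w'} A} (φ : LMod.Hom N N')
    (M : LMod.{u, w} A) : LMod.Hom (LMod.tensor N M) (LMod.tensor N' M) where
  toCLM := CTensor.map φ.toCLM (.id ℂ M)
  map_act := fun a t =>
    (congrArg _ (LMod.tensor_act N M a t)).trans <| (φ.map_tensorAct M (comul a) t).trans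
      (LMod.tensor_act N' M a (CTensor.map φ.toCLM (.id ℂ M) t)).symm

/-- The comultiplicative form of the linearity of the shear isomorphism, with arbitrary tensors `r`
and `s` in place of `Δ(a)` and `Δ(b)`. -/
theorem LMod.shearTensor_mul (V : Type v) [AddCommGroup V] [Module ℂ V] [UniformSpace V]
    [IsCompleteLCS V] (M : LMod.{u, w} A) (y : V) (x : M) (r s : A ⊗̂ A) :
    CTensor.map (CTensor.mkLeft y) (M.orbit x) (tensorMul A A (tmk r s)) =
      LMod.tensorAct (LMod.free A V) M
        (tmk r (CTensor.map (CTensor.mkLeft y) (M.orbit x) s : (A ⊗̂ V) ⊗̂ M)) := by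
  have h : (CTensor.map (CTensor.mkLeft y) (M.orbit x)).comp (tensorMul A A) =
      (LMod.tensorAct (LMod.free A V) M).comp
        (CTensor.map (.id ℂ (A ⊗̂ A)) (CTensor.map (CTensor.mkLeft y) (M.orbit x))) := by
    refine CTensor.ext_both fun a b a' b' => ?_
    have h1 : LMod.tensorAct (LMod.free A V) M
        (tmk (tmk a b) (tmk (tmk a' y) (M.act b' x) : (A ⊗̂ V) ⊗̂ M)) =
        (tmk (tmk (a * a') y) (M.act b (M.act b' x)) : (A ⊗̂ V) ⊗̂ M) :=
      (LMod.tensorAct_tmk (LMod.free A V) M a b (tmk a' y : A ⊗̂ V) (M.act b' x)).trans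
        (congrArg (fun z : A ⊗̂ V => (tmk z (M.act b (M.act b' x)) : (A ⊗̂ V) ⊗̂ M))
          (LMod.free_act_tmk A V a a' y))
    have h2 : CTensor.map (.id ℂ (A ⊗̂ A)) (CTensor.map (CTensor.mkLeft y) (M.orbit x))
        (tmk (tmk a b) (tmk a' b')) =
        tmk (tmk a b) (tmk (tmk a' y) (M.act b' x) : (A ⊗̂ V) ⊗̂ M) := by simp
    refine Eq.trans ?_ (h1.symm.trans (congrArg _ h2.symm))
    simp [tensorMul, M.mul_act]
  have h3 := CTensor.map_tmk (.id ℂ (A ⊗̂ A)) (CTensor.map (CTensor.mkLeft y) (M.orbit x)) r s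
  exact (DFunLike.congr_fun h (tmk r s)).trans 
    (congrArg (fun z => LMod.tensorAct (LMod.free A V) M z) h3)

/-- The shear isomorphism as a morphism of modules from the free module on `V ⊗̂ M` to the tensor
product of the free module on `V` with `M`. -/
def LMod.shearHom (V : Type v) [AddCommGroup V] [Module ℂ V] [UniformSpace V]
    [IsCompleteLCS V] (M : LMod.{u, w} A) :
    LMod.Hom (LMod.free A (V ⊗̂ M)) (LMod.tensor (LMod.free A V) M) where
  toCLM := LMod.shearTensor V M
  map_act := fun a t => by
    let f : A ⊗̂ (V ⊗̂ M) →L[ℂ] A ⊗̂ (V ⊗̂ M) := (LMod.free A (V ⊗̂ M)).actCLM a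
    let g : (A ⊗̂ V) ⊗̂ M →L[ℂ] (A ⊗̂ V) ⊗̂ M := (LMod.tensor (LMod.free A V) M).actCLM a
    have h : (LMod.shearTensor V M).comp f = g.comp (LMod.shearTensor V M) := by
      refine CTensor.ext_right fun b y x => ?_
      have h1 : f (tmk b (tmk y x)) = tmk (a * b) (tmk y x) := LMod.free_act_tmk A _ a b _
      have h2 : ∀ z : (A ⊗̂ V) ⊗̂ M, g z = LMod.tensorAct (LMod.free A V) M (tmk (comul a) z) :=
        LMod.tensor_act (LMod.free A V) M a
      rw [ContinuousLinearMap.comp_apply, ContinuousLinearMap.comp_apply, h1,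
        LMod.shearTensor_tmk, LMod.shearTensor_tmk, comul_mul, h2, LMod.shearTensor_mul]
    exact DFunLike.congr_fun h t

/-- The inverse of the shear isomorphism as a morphism of modules. Its linearity is inherited from
`LMod.shearHom`, which makes the antimultiplicativity of the antipode unnecessary. -/
def LMod.shearHomSymm (V : Type v) [AddCommGroup V] [Module ℂ V] [UniformSpace V]
    [IsCompleteLCS V] (M : LMod.{u, w} A) :
    LMod.Hom (LMod.tensor (LMod.free A V) M) (LMod.free A (V ⊗̂ M)) where
  toCLM := LMod.shearTensorSymm V M
  map_act := fun a t => by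
    have h := (LMod.shearHom V M).map_act a (LMod.shearTensorSymm V M t)
    have h1 : (LMod.shearHom V M).toCLM (LMod.shearTensorSymm V M t) = t :=
      LMod.shearTensor_shearTensorSymm V M t
    rw [h1] at h
    rw [← h]
    exact LMod.shearTensorSymm_shearTensor V M _

/-- The tensor product of a projective module with any module is projective: it is a retract of
`(A ⊗̂ P) ⊗ M`, and the shear isomorphism identifies the latter with the free module
on `P ⊗̂ M`. -/
theorem LMod.IsProjective.tensor {P : LMod.{u, max u w} A} (hP : P.IsProjective)
    (M : LMod.{u, max u w} A) : (LMod.tensor P M).IsProjective := by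
  obtain ⟨j, hj⟩ := hP.exists_section
  refine (LMod.isProjective_free (A := A) (P ⊗̂ M)).of_retract
    ((LMod.shearHomSymm P M).comp (j.tensorRight M))
    (((LMod.freeLift (.id ℂ P)).tensorRight M).comp (LMod.shearHom P M)) ?_
  refine LMod.Hom.ext (ContinuousLinearMap.ext fun t => ?_)
  have h1 : (LMod.shearHom P M).toCLM
      ((LMod.shearHomSymm P M).toCLM ((j.tensorRight M).toCLM t)) = (j.tensorRight M).toCLM t :=
    LMod.shearTensor_shearTensorSymm _ M _
  have h2 : ((LMod.freeLift (.id ℂ P)).tensorRight M).toCLM ((j.tensorRight M).toCLM t) = t := by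
    refine (CTensor.map_map _ _ _ _ t).trans ?_
    have h3 := congrArg LMod.Hom.toCLM hj
    rw [LMod.Hom.comp_toCLM] at h3
    rw [h3]
    exact DFunLike.congr_fun CTensor.map_id t
  exact (congrArg _ h1).trans h2

end Tensor

/-! ### The tensor identity -/

section ShearFormula

variable {A : Type u} [Ring A] [Algebra ℂ A] [UniformSpace A] [IsTensorAlgebra A]
variable (V : Type v) [AddCommGroup V] [Module ℂ V] [UniformSpace V] [IsCompleteLCS V]

/-- The map `(a ⊗ b) ⊗ (y ⊗ x) ↦ (a ⊗ y) ⊗ b x`, through which the shear isomorphism factors. -/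
def LMod.spread (M : LMod.{u, w} A) : (A ⊗̂ A) ⊗̂ (V ⊗̂ M) →L[ℂ] (A ⊗̂ V) ⊗̂ M :=
  (CTensor.map (.id ℂ (A ⊗̂ V)) M.actMap).comp (CTensor.interchange A A V M)

@[simp]
theorem LMod.spread_tmk (M : LMod.{u, w} A) (a b : A) (y : V) (x : M) :
    LMod.spread V M (tmk (tmk a b) (tmk y x)) = tmk (tmk a y) (M.act b x) := by
  simp [LMod.spread]

theorem LMod.shearTensor_eq_spread [HopfTensorAlgebra A] (M : LMod.{u, w} A) (a : A)
    (t : V ⊗̂ M) : LMod.shearTensor V M (tmk a t) =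
      LMod.spread V M (tmk (HopfTensorAlgebra.comul a) t) := by
  have h : (LMod.shearTensor V M).comp (CTensor.mkRight a) =
      (LMod.spread V M).comp (CTensor.mkRight (HopfTensorAlgebra.comul a)) := by
    refine CTensor.ext fun y x => ?_
    have h1 : (LMod.spread V M).comp (CTensor.mkLeft (tmk y x)) =
      CTensor.map (CTensor.mkLeft y) (M.orbit x) := CTensor.ext fun a b => by simp
    have h2 := DFunLike.congr_fun h1 (HopfTensorAlgebra.comul a)
    simpa [LMod.shearTensor_tmk] using h2.symm
  exact DFunLike.congr_fun h t

end ShearFormula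

section Via

variable {U H : Type u}
    [Ring U] [Algebra ℂ U] [UniformSpace U] [IsTensorAlgebra U]
    [Ring H] [Algebra ℂ H] [UniformSpace H] [IsTensorAlgebra H]
    (θ : U →A[ℂ] H)

/-- The canonical map `H ⊗̂ N → H ⊗̂_U N`; this is `TensorOver.proj` with the carrier of `rightVia θ`
spelled out as `H`. -/
def viaProj (N : LMod.{u, w} U) : H ⊗̂ N →L[ℂ] TensorOver (rightVia θ) N :=
  TensorOver.proj (rightVia θ) N

theorem viaProj_balanced (N : LMod.{u, w} U) (x : H) (a : U) (y : N) :
    viaProj θ N (tmk (x * θ a) y) = viaProj θ N (tmk x (N.act a y)) :=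
  TensorOver.proj_balanced (rightVia θ) N x a y

variable {θ}

theorem via_ext {N : LMod.{u, w} U} {K : Type*} [AddCommGroup K]
    [Module ℂ K] [TopologicalSpace K] [T2Space K] {f g : TensorOver (rightVia θ) N →L[ℂ] K}
    (h : ∀ (x : H) (y : N), f (viaProj θ N (tmk x y)) = g (viaProj θ N (tmk x y))) : f = g :=
  TensorOver.ext h

theorem via_ext_tensor {N : LMod.{u, w} U} {M K : Type*} [AddCommGroup M] [Module ℂ M]
    [UniformSpace M] [IsCompleteLCS M] [AddCommGroup K] [Module ℂ K] [UniformSpace K]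
    [IsCompleteLCS K] {f g : TensorOver (rightVia θ) N ⊗̂ M →L[ℂ] K}
    (h : ∀ (x : H) (y : N) (m : M), f (tmk (viaProj θ N (tmk x y)) m) =
      g (tmk (viaProj θ N (tmk x y)) m)) : f = g :=
  TensorOver.ext_tensor h

theorem map_viaProj {N : LMod.{u, w} U} {N' : LMod.{u, w'} U} (φ : LMod.Hom N N') (t : H ⊗̂ N) :
    TensorOver.map (rightVia θ) φ (viaProj θ N t) =
      viaProj θ N' (CTensor.map (.id ℂ H) φ.toCLM t) :=
  TensorOver.map_proj (rightVia θ) φ t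

section Restrict

variable (θ) (N : LMod.{u, v} U) (M : LMod.{u, w} H)

/-- The action `(a ⊗ b) ⊗ (y ⊗ x) ↦ a y ⊗ θ(b) x` of `U ⊗̂ U` on `N ⊗̂ M`, for a module `M`
over `H`. -/
def LMod.restrictAct : (U ⊗̂ U) ⊗̂ (N ⊗̂ M) →L[ℂ] N ⊗̂ M := LMod.tensorAct N (M.restrict θ)

@[simp]
theorem LMod.restrictAct_tmk (a b : U) (y : N) (x : M) :
    LMod.restrictAct θ N M (tmk (tmk a b) (tmk y x)) = tmk (N.act a y) (M.act (θ b) x) :=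
  LMod.tensorAct_tmk N (M.restrict θ) a b y x

/-- The identity `(h₁ θ(a₁) ⊗ y) ⊗ h₂ θ(a₂) x = (h θ(a))₁ ⊗ y ⊗ (h θ(a))₂ x`, with arbitrary tensors
`r` and `s` in place of `Δ(h)` and `Δ(a)`. -/
theorem map_mulMap_spread (y : N) (m : M) (r : H ⊗̂ H) (s : U ⊗̂ U) :
    CTensor.map ((CTensor.mkLeft y).comp ((mulMap H).comp
      (CTensor.map (.id ℂ H) θ.toContinuousLinearMap))) (.id ℂ M) (LMod.spread U M (tmk r
      (CTensor.map (.id ℂ U) ((M.orbit m).comp θ.toContinuousLinearMap) s))) =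
    LMod.spread N M (tmk (tensorMul H H (tmk r
      (CTensor.map θ.toContinuousLinearMap θ.toContinuousLinearMap s))) (tmk y m)) := by
  have h : (CTensor.map ((CTensor.mkLeft y).comp ((mulMap H).comp
      (CTensor.map (.id ℂ H) θ.toContinuousLinearMap))) (.id ℂ M)).comp ((LMod.spread U M).comp
      (CTensor.map (.id ℂ (H ⊗̂ H))
        (CTensor.map (.id ℂ U) ((M.orbit m).comp θ.toContinuousLinearMap)))) =
      (LMod.spread N M).comp ((CTensor.mkLeft (tmk y m)).comp ((tensorMul H H).comp
        (CTensor.map (.id ℂ (H ⊗̂ H))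
          (CTensor.map θ.toContinuousLinearMap θ.toContinuousLinearMap)))) :=
    CTensor.ext_both fun p q c d => by simp [tensorMul, M.mul_act]
  simpa using DFunLike.congr_fun h (tmk r s)

/-- The identity `(h₁ ⊗ a₁ y) ⊗ h₂ θ(a₂) x = (h₁ ⊗ y') ⊗ h₂ x'` for `y' ⊗ x' = a₁ y ⊗ θ(a₂) x`, with
arbitrary tensors `r` and `s` in place of `Δ(h)` and `Δ(a)`. -/
theorem map_orbit_spread (y : N) (m : M) (r : H ⊗̂ H) (s : U ⊗̂ U) :
    CTensor.map (CTensor.map (.id ℂ H) (N.orbit y)) (.id ℂ M) (LMod.spread U M (tmk r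
      (CTensor.map (.id ℂ U) ((M.orbit m).comp θ.toContinuousLinearMap) s))) =
    LMod.spread N M (tmk r (LMod.restrictAct θ N M (tmk s (tmk y m)))) := by
  have h : (CTensor.map (CTensor.map (.id ℂ H) (N.orbit y)) (.id ℂ M)).comp
      ((LMod.spread U M).comp (CTensor.map (.id ℂ (H ⊗̂ H))
        (CTensor.map (.id ℂ U) ((M.orbit m).comp θ.toContinuousLinearMap)))) =
      (LMod.spread N M).comp (CTensor.map (.id ℂ (H ⊗̂ H))
        ((LMod.restrictAct θ N M).comp (CTensor.mkLeft (tmk y m)))) :=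
    CTensor.ext_both fun p q c d => by simp
  simpa using DFunLike.congr_fun h (tmk r s)

variable [HopfTensorAlgebra U] [HopfTensorAlgebra H]

open HopfTensorAlgebra

/-- The shear `a ⊗ x ↦ a₁ ⊗ θ(S(a₂)) x` over `U`, twisted by `S : U → U`, for a module `M` over
`H`. -/
def LMod.restrictShear (S : U →L[ℂ] U) : U ⊗̂ M →L[ℂ] U ⊗̂ M := (M.restrict θ).shear S

theorem LMod.restrictShear_restrictShear (t : U ⊗̂ M) :
    LMod.restrictShear θ M (.id ℂ U) (LMod.restrictShear θ M antipode t) = t :=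
  LMod.shear_shear _ _ antipode_right (M.restrict θ) t

theorem LMod.orbit_restrict (m : M) :
    (M.restrict θ).orbit m = (M.orbit m).comp θ.toContinuousLinearMap :=
  ContinuousLinearMap.ext fun b =>
    ((M.restrict θ).orbit_apply m b).trans (M.orbit_apply m (θ b)).symm

theorem LMod.restrictShear_id_tmk (a : U) (m : M) :
    LMod.restrictShear θ M (.id ℂ U) (tmk a m) =
      CTensor.map (.id ℂ U) ((M.orbit m).comp θ.toContinuousLinearMap) (comul a) :=
  (LMod.shear_tmk (.id ℂ U) (M.restrict θ) a m).trans <|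
    congrArg (fun f : U →L[ℂ] M => (CTensor.map (.id ℂ U) f (comul a) : U ⊗̂ M))
      (LMod.orbit_restrict θ M m)

/-- The map `H ⊗̂ (N ⊗̂ M) → H ⊗̂_U (N ⊗ M)`, where `U` acts on `N ⊗ M` through its
comultiplication. -/
def tensorProj : H ⊗̂ (N ⊗̂ M) →L[ℂ]
    TensorOver (rightVia θ) (LMod.tensor N (M.restrict θ)) :=
  viaProj θ (LMod.tensor N (M.restrict θ))

theorem tensorProj_balanced (x : H) (a : U) (t : N ⊗̂ M) :
    tensorProj θ N M (tmk (x * θ a) t) =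
      tensorProj θ N M (tmk x (LMod.restrictAct θ N M (tmk (comul a) t))) :=
  (viaProj_balanced θ (LMod.tensor N (M.restrict θ)) x a t).trans <|
    congrArg (fun z : N ⊗̂ M => tensorProj θ N M (tmk x z)) (LMod.tensor_act N (M.restrict θ) a t)

variable {θ N M}

theorem tensorProj_ext {K : Type*} [AddCommGroup K] [Module ℂ K] [TopologicalSpace K] [T2Space K]
    {f g : TensorOver (rightVia θ) (LMod.tensor N (M.restrict θ)) →L[ℂ] K}
    (h : ∀ t, f (tensorProj θ N M t) = g (tensorProj θ N M t)) : f = g :=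
  via_ext fun _ _ => h _

theorem map_tensorProj {N' : LMod.{u, w'} U} (φ : LMod.Hom N N') (t : H ⊗̂ (N ⊗̂ M)) :
    TensorOver.map (rightVia θ) (φ.tensorRight (M.restrict θ)) (tensorProj θ N M t) =
      tensorProj θ N' M (CTensor.map (.id ℂ H) (CTensor.map φ.toCLM (.id ℂ M)) t) :=
  map_viaProj (φ.tensorRight (M.restrict θ)) t

/-- A balanced map on `H ⊗̂ (N ⊗̂ M)` induces a map on `H ⊗̂_U (N ⊗ M)`. -/
def tensorProjLift {K : Type*} [AddCommGroup K] [Module ℂ K] [UniformSpace K] [IsCompleteLCS K]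
    (f : H ⊗̂ (N ⊗̂ M) →L[ℂ] K)
    (hf : ∀ x a t, f (tmk (x * θ a) t) = f (tmk x (LMod.restrictAct θ N M (tmk (comul a) t)))) :
    TensorOver (rightVia θ) (LMod.tensor N (M.restrict θ)) →L[ℂ] K :=
  TensorOver.lift (rightVia θ) (LMod.tensor N (M.restrict θ)) f fun x a t =>
    (hf x a t).trans
      (congrArg (fun z : N ⊗̂ M => f (tmk x z)) (LMod.tensor_act N (M.restrict θ) a t).symm)

theorem tensorProjLift_apply {K : Type*} [AddCommGroup K] [Module ℂ K] [UniformSpace K]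
    [IsCompleteLCS K] (f : H ⊗̂ (N ⊗̂ M) →L[ℂ] K)
    (hf : ∀ x a t, f (tmk (x * θ a) t) = f (tmk x (LMod.restrictAct θ N M (tmk (comul a) t))))
    (t : H ⊗̂ (N ⊗̂ M)) : tensorProjLift f hf (tensorProj θ N M t) = f t :=
  TensorOver.lift_proj _ _ _ _ _

/-- A map on `(H ⊗̂ N) ⊗̂ M` that is balanced in the first two factors induces a map on
`(H ⊗̂_U N) ⊗̂ M`. -/
def viaLiftRight {K : Type*} [AddCommGroup K] [Module ℂ K] [UniformSpace K] [IsCompleteLCS K]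
    (f : (H ⊗̂ N) ⊗̂ M →L[ℂ] K)
    (hf : ∀ x a y m, f (tmk (tmk (x * θ a) y) m) = f (tmk (tmk x (N.act a y)) m)) :
    TensorOver (rightVia θ) N ⊗̂ M →L[ℂ] K :=
  TensorOver.liftRight (rightVia θ) N f hf

theorem viaLiftRight_tmk {K : Type*} [AddCommGroup K] [Module ℂ K] [UniformSpace K]
    [IsCompleteLCS K] (f : (H ⊗̂ N) ⊗̂ M →L[ℂ] K)
    (hf : ∀ x a y m, f (tmk (tmk (x * θ a) y) m) = f (tmk (tmk x (N.act a y)) m))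
    (t : H ⊗̂ N) (m : M) : viaLiftRight f hf (tmk (viaProj θ N t) m) = f (tmk t m) :=
  TensorOver.liftRight_tmk (rightVia θ) N f hf t m

attribute [irreducible] viaProj tensorProj tensorProjLift viaLiftRight
  LMod.restrictShear LMod.restrictAct

variable (hθ : IsHopfHom θ)
include hθ

theorem comul_mul_map (x : H) (a : U) : comul (x * θ a) =
    tensorMul H H (tmk (comul x) (CTensor.map θ.toContinuousLinearMap θ.toContinuousLinearMap
      (comul a))) := by
  rw [comul_mul, hθ.map_comul]

/-- The map `H ⊗̂ (N ⊗̂ M) → (H ⊗̂_U N) ⊗̂ M`, `h ⊗ (y ⊗ x) ↦ (h₁ ⊗ y) ⊗ h₂ x`, is balanced for the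
action of `U` on `N ⊗ M` through the comultiplication. -/
theorem map_viaProj_shearTensor_balanced (x : H) (a : U) (t : N ⊗̂ M) :
    CTensor.map (viaProj θ N) (.id ℂ M) (LMod.shearTensor N M (tmk (x * θ a) t)) =
      CTensor.map (viaProj θ N) (.id ℂ M) (LMod.shearTensor N M
        (tmk x (LMod.restrictAct θ N M (tmk (comul a) t)))) := by
  rw [LMod.shearTensor_eq_spread, LMod.shearTensor_eq_spread, comul_mul_map hθ]
  let Θ := CTensor.map θ.toContinuousLinearMap θ.toContinuousLinearMap
  let F := (CTensor.map (viaProj θ N) (.id ℂ M)).comp (LMod.spread N M)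
  suffices h : (F.comp ((CTensor.mkRight (tensorMul H H (tmk (comul x) (Θ (comul a))))))) =
      F.comp ((CTensor.mkRight (comul x)).comp ((LMod.restrictAct θ N M).comp
        (CTensor.mkRight (comul a)))) from DFunLike.congr_fun h t
  refine CTensor.ext fun y m => ?_
  have h1 : F.comp ((CTensor.mkLeft (tmk y m)).comp ((tensorMul H H).comp
      (CTensor.map (.id ℂ (H ⊗̂ H)) Θ))) =
      F.comp (CTensor.map (.id ℂ (H ⊗̂ H))
        ((LMod.restrictAct θ N M).comp (CTensor.mkLeft (tmk y m)))) :=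
    CTensor.ext_both fun p q c d => by
      simp [F, Θ, tensorMul, viaProj_balanced, M.mul_act]
  simpa using DFunLike.congr_fun h1 (tmk (comul x) (comul a))

/-- The map `(H ⊗̂ N) ⊗̂ M → H ⊗̂_U (N ⊗ M)`, `(h ⊗ y) ⊗ x ↦ h₁ ⊗ (y ⊗ S(h₂) x)`, is balanced in its
first two factors. Since shear maps are surjective, it is enough to replace `h ⊗ a ⊗ x` by the
elements `h₁ ⊗ a₁ ⊗ h₂ a₂ x`, where the antipode cancels. -/
theorem tensorProj_shearTensorSymm_balanced (x : H) (a : U) (y : N) (m : M) :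
    tensorProj θ N M (LMod.shearTensorSymm N M (tmk (tmk (x * θ a) y) m)) =
      tensorProj θ N M (LMod.shearTensorSymm N M (tmk (tmk x (N.act a y)) m)) := by
  let F := (tensorProj θ N M).comp (LMod.shearTensorSymm N M)
  -- `T (h ⊗ (a ⊗ x)) = (h₁ ⊗ a₁) ⊗ h₂ θ(a₂) x`
  let T := (LMod.shearTensor U M).comp
    (CTensor.map (.id ℂ H) (LMod.restrictShear θ M (.id ℂ U)))
  -- the two sides of the claim are `F ∘ (b ⊗ 1)` and `F ∘ (b' ⊗ 1)` at `(x ⊗ a) ⊗ m`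
  let b := (CTensor.mkLeft y).comp ((mulMap H).comp
    (CTensor.map (.id ℂ H) θ.toContinuousLinearMap))
  let b' := CTensor.map (.id ℂ H) (N.orbit y)
  have key : (F.comp (CTensor.map b (.id ℂ M))).comp T =
      (F.comp (CTensor.map b' (.id ℂ M))).comp T := by
    refine CTensor.ext_right fun x a m => ?_
    simp only [ContinuousLinearMap.comp_apply, CTensor.map_tmk, ContinuousLinearMap.id_apply, T, F]
    rw [LMod.restrictShear_id_tmk, LMod.shearTensor_eq_spread, map_mulMap_spread,
      map_orbit_spread, ← comul_mul_map hθ, ← LMod.shearTensor_eq_spread,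
      ← LMod.shearTensor_eq_spread, LMod.shearTensorSymm_shearTensor,
      LMod.shearTensorSymm_shearTensor, tensorProj_balanced]
  -- `T` is surjective: both of its factors are invertible by means of an antipode
  have hT : ∀ t, T (CTensor.map (.id ℂ H) (LMod.restrictShear θ M antipode)
      (LMod.shearTensorSymm U M t)) = t := by
    intro t
    have h : (LMod.restrictShear θ M (.id ℂ U)).comp (LMod.restrictShear θ M antipode) =
      .id ℂ _ := ContinuousLinearMap.ext (LMod.restrictShear_restrictShear θ M)
    rw [ContinuousLinearMap.comp_apply, CTensor.map_map, h, ContinuousLinearMap.id_comp,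
      CTensor.map_id, ContinuousLinearMap.id_apply, LMod.shearTensor_shearTensorSymm]
  have h := DFunLike.congr_fun key (CTensor.map (.id ℂ H) (LMod.restrictShear θ M antipode)
    (LMod.shearTensorSymm U M (tmk (tmk x a) m)))
  rw [ContinuousLinearMap.comp_apply, ContinuousLinearMap.comp_apply _ T, hT] at h
  simpa [F, b, b'] using h

variable (N M)

/-- The tensor identity `H ⊗̂_U (N ⊗ M) → (H ⊗̂_U N) ⊗̂ M`, `h ⊗ (y ⊗ x) ↦ (h₁ ⊗ y) ⊗ h₂ x`. -/
def tensorIdentity : TensorOver (rightVia θ) (LMod.tensor N (M.restrict θ)) →L[ℂ]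
    TensorOver (rightVia θ) N ⊗̂ M :=
  tensorProjLift ((CTensor.map (viaProj θ N) (.id ℂ M)).comp (LMod.shearTensor N M))
    (map_viaProj_shearTensor_balanced hθ)

/-- The inverse `(h ⊗ y) ⊗ x ↦ h₁ ⊗ (y ⊗ S(h₂) x)` of the tensor identity. -/
def tensorIdentitySymm : TensorOver (rightVia θ) N ⊗̂ M →L[ℂ]
    TensorOver (rightVia θ) (LMod.tensor N (M.restrict θ)) :=
  viaLiftRight ((tensorProj θ N M).comp (LMod.shearTensorSymm N M))
    (tensorProj_shearTensorSymm_balanced hθ)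

variable {N M}

theorem tensorIdentity_tensorProj (t : H ⊗̂ (N ⊗̂ M)) :
    tensorIdentity N M hθ (tensorProj θ N M t) =
      CTensor.map (viaProj θ N) (.id ℂ M) (LMod.shearTensor N M t) :=
  tensorProjLift_apply _ _ t

theorem tensorIdentitySymm_map_viaProj (t : (H ⊗̂ N) ⊗̂ M) :
    tensorIdentitySymm N M hθ (CTensor.map (viaProj θ N) (.id ℂ M) t) =
      tensorProj θ N M (LMod.shearTensorSymm N M t) := by
  have h : (tensorIdentitySymm N M hθ).comp (CTensor.map (viaProj θ N) (.id ℂ M)) =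
      (tensorProj θ N M).comp (LMod.shearTensorSymm N M) := CTensor.ext fun t m => by
    rw [ContinuousLinearMap.comp_apply, CTensor.map_tmk]
    exact viaLiftRight_tmk _ _ t m
  exact DFunLike.congr_fun h t

theorem tensorIdentitySymm_tensorIdentity
    (t : TensorOver (rightVia θ) (LMod.tensor N (M.restrict θ))) :
    tensorIdentitySymm N M hθ (tensorIdentity N M hθ t) = t := by
  have h : (tensorIdentitySymm N M hθ).comp (tensorIdentity N M hθ) = .id ℂ _ :=
    tensorProj_ext fun t => by
      rw [ContinuousLinearMap.comp_apply, tensorIdentity_tensorProj,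
        tensorIdentitySymm_map_viaProj, LMod.shearTensorSymm_shearTensor]
      rfl
  exact DFunLike.congr_fun h t

theorem tensorIdentity_tensorIdentitySymm (t : TensorOver (rightVia θ) N ⊗̂ M) :
    tensorIdentity N M hθ (tensorIdentitySymm N M hθ t) = t := by
  have h : (tensorIdentity N M hθ).comp (tensorIdentitySymm N M hθ) = .id ℂ _ :=
    via_ext_tensor fun x y m => by
      have h1 : tmk (viaProj θ N (tmk x y)) m =
        CTensor.map (viaProj θ N) (.id ℂ M) (tmk (tmk x y) m) := by simp
      rw [ContinuousLinearMap.comp_apply, h1, tensorIdentitySymm_map_viaProj,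
        tensorIdentity_tensorProj, LMod.shearTensor_shearTensorSymm]
      rfl
  exact DFunLike.congr_fun h t

/-- The tensor identity is natural in `N`. -/
theorem tensorIdentity_natural {N' : LMod.{u, w'} U} (φ : LMod.Hom N N')
    (t : TensorOver (rightVia θ) (LMod.tensor N (M.restrict θ))) :
    tensorIdentity N' M hθ (TensorOver.map (rightVia θ) (φ.tensorRight (M.restrict θ)) t) =
      CTensor.map (TensorOver.map (rightVia θ) φ) (.id ℂ M) (tensorIdentity N M hθ t) := by
  have h : (tensorIdentity N' M hθ).comp
      (TensorOver.map (rightVia θ) (φ.tensorRight (M.restrict θ))) =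
      (CTensor.map (TensorOver.map (rightVia θ) φ) (.id ℂ M)).comp (tensorIdentity N M hθ) := by
    refine tensorProj_ext fun t => ?_
    rw [ContinuousLinearMap.comp_apply, ContinuousLinearMap.comp_apply, map_tensorProj,
      tensorIdentity_tensorProj, tensorIdentity_tensorProj]
    have h1 : (CTensor.map (viaProj θ N') (.id ℂ M)).comp ((LMod.spread N' M).comp
        (CTensor.map (.id ℂ (H ⊗̂ H)) (CTensor.map φ.toCLM (.id ℂ M)))) =
        (CTensor.map (TensorOver.map (rightVia θ) φ) (.id ℂ M)).comp
          ((CTensor.map (viaProj θ N) (.id ℂ M)).comp (LMod.spread N M)) :=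
      CTensor.ext_both fun p q y m => by simp [map_viaProj]
    have h2 : (CTensor.map (viaProj θ N') (.id ℂ M)).comp ((LMod.shearTensor N' M).comp
        (CTensor.map (.id ℂ H) (CTensor.map φ.toCLM (.id ℂ M)))) =
        (CTensor.map (TensorOver.map (rightVia θ) φ) (.id ℂ M)).comp
          ((CTensor.map (viaProj θ N) (.id ℂ M)).comp (LMod.shearTensor N M)) :=
      CTensor.ext fun x t => by
        have h3 := DFunLike.congr_fun h1 (tmk (comul x) t)
        simpa [LMod.shearTensor_eq_spread] using h3
    exact DFunLike.congr_fun h2 t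
  exact DFunLike.congr_fun h t

theorem tensorIdentitySymm_natural {N' : LMod.{u, w'} U} (φ : LMod.Hom N N')
    (t : TensorOver (rightVia θ) N ⊗̂ M) :
    TensorOver.map (rightVia θ) (φ.tensorRight (M.restrict θ)) (tensorIdentitySymm N M hθ t) =
      tensorIdentitySymm N' M hθ (CTensor.map (TensorOver.map (rightVia θ) φ) (.id ℂ M) t) := by
  rw [← tensorIdentitySymm_tensorIdentity hθ (TensorOver.map _ _ _), tensorIdentity_natural,
    tensorIdentity_tensorIdentitySymm]

attribute [irreducible] tensorIdentity tensorIdentitySymm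

end Restrict

end Via

/-! ### Tensoring a resolution of the trivial module -/

section TensorResolution

/-- Tensoring with a fixed space preserves admissibility. -/
theorem IsAdmissible.tensorRight {X : Type*} {C : ℕ → Type*} [AddCommGroup X] [Module ℂ X]
    [UniformSpace X] [IsCompleteLCS X] [∀ n, AddCommGroup (C n)] [∀ n, Module ℂ (C n)]
    [∀ n, UniformSpace (C n)] [∀ n, IsCompleteLCS (C n)] {e : C 0 →L[ℂ] X}
    {d : ∀ n, C (n + 1) →L[ℂ] C n} (h : IsAdmissible e d) (M : Type*) [AddCommGroup M]
    [Module ℂ M] [UniformSpace M] [IsCompleteLCS M] :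
    IsAdmissible (C := fun n => C n ⊗̂ M) (CTensor.map e (.id ℂ M))
      fun n => CTensor.map (d n) (.id ℂ M) := by
  obtain ⟨he, hd, s₀, s, h1, h2, h3⟩ := h
  refine ⟨?_, fun n => ?_, CTensor.map s₀ (.id ℂ M), fun n => CTensor.map (s n) (.id ℂ M), ?_, ?_,
    fun n => ?_⟩
  · rw [CTensor.map_comp_map, he, CTensor.map_zero_left]
  · rw [CTensor.map_comp_map, hd, CTensor.map_zero_left]
  · rw [CTensor.map_comp_map, h1, ContinuousLinearMap.id_comp, CTensor.map_id]
  · rw [CTensor.map_comp_map, CTensor.map_comp_map, ContinuousLinearMap.id_comp,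
      ← CTensor.map_add_left, h2, CTensor.map_id]
  · rw [CTensor.map_comp_map, CTensor.map_comp_map, ContinuousLinearMap.id_comp,
      ← CTensor.map_add_left, h3, CTensor.map_id]

variable {A : Type u} [Ring A] [Algebra ℂ A] [UniformSpace A] [IsTensorAlgebra A]
  [HopfTensorAlgebra A]

open HopfTensorAlgebra

variable (A) in
/-- The trivial module `ℂ` over a Hopf algebra. -/
abbrev LMod.trivial : LMod.{u, 0} A := leftVia (counit (H := A))

theorem CTensor.lid_tmk_one (M : Type w) [AddCommGroup M] [Module ℂ M] [UniformSpace M]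
    [IsCompleteLCS M] (x : M) : CTensor.lid M (tmk 1 x) = x := by simp

theorem CTensor.tmk_one_lid (M : Type w) [AddCommGroup M] [Module ℂ M] [UniformSpace M]
    [IsCompleteLCS M] (t : ℂ ⊗̂ M) : tmk 1 (CTensor.lid M t) = t := by
  have h : (CTensor.mkRight (1 : ℂ)).comp (CTensor.lid M) = .id ℂ (ℂ ⊗̂ M) :=
    CTensor.ext fun c x => by simp [← LinearMap.smul_apply, ← map_smul tmk]
  exact DFunLike.congr_fun h t

theorem LMod.tensorAct_trivial (M : LMod.{u, w} A) (a : A) (x : M) :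
    LMod.tensorAct (LMod.trivial A) M (tmk (comul a) (tmk (1 : ℂ) x : ℂ ⊗̂ M)) =
      (tmk (1 : ℂ) (M.act a x) : ℂ ⊗̂ M) := by
  have h : (CTensor.map ((LMod.trivial A).orbit (1 : ℂ)) (M.orbit x) : A ⊗̂ A →L[ℂ] ℂ ⊗̂ M) =
      (CTensor.mkRight (1 : ℂ)).comp ((M.orbit x).comp ((CTensor.lid A).comp
        (CTensor.map (counit (H := A)).toContinuousLinearMap (.id ℂ A)))) := by
    refine CTensor.ext fun p q => ?_
    have h1 : ((LMod.trivial A).orbit (1 : ℂ) p : ℂ) = counit p :=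
      ((LMod.trivial A).orbit_apply (1 : ℂ) p).trans (mul_one (counit p : ℂ))
    have h2 : (tmk (counit p) (M.act q x) : ℂ ⊗̂ M) = counit p • (tmk (1 : ℂ) (M.act q x)) := by
      rw [← LinearMap.smul_apply, ← map_smul, smul_eq_mul, mul_one]
    refine (CTensor.map_tmk _ _ p q).trans ?_
    refine (congrArg (fun z : ℂ => (tmk z (M.orbit x q) : ℂ ⊗̂ M)) h1).trans ?_
    simpa using h2
  refine (LMod.tensorAct_tmk_right (LMod.trivial A) M (comul a) (1 : ℂ) x).trans ?_
  refine (DFunLike.congr_fun h (comul a)).trans ?_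
  have h3 := DFunLike.congr_fun (counit_comul (H := A)) a
  simp only [ContinuousLinearMap.comp_apply] at h3 ⊢
  rw [h3]
  simp

/-- The isomorphism `M → ℂ ⊗ M`. -/
def LMod.unitTensor (M : LMod.{u, w} A) : LMod.Hom M (LMod.tensor (LMod.trivial A) M) where
  toCLM := (CTensor.mkRight (1 : ℂ) : M →L[ℂ] ℂ ⊗̂ M)
  map_act := fun a x => (LMod.tensorAct_trivial M a x).symm.trans
    (LMod.tensor_act (LMod.trivial A) M a (tmk (1 : ℂ) x : ℂ ⊗̂ M)).symm

/-- The isomorphism `ℂ ⊗ M → M`. -/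
def LMod.tensorUnit (M : LMod.{u, w} A) : LMod.Hom (LMod.tensor (LMod.trivial A) M) M where
  toCLM := CTensor.lid M
  map_act := fun a t => by
    have h := (LMod.unitTensor M).map_act a (CTensor.lid M t)
    have h1 : (LMod.unitTensor M).toCLM (CTensor.lid M t) = t := CTensor.tmk_one_lid M t
    rw [h1] at h
    rw [← h]
    exact CTensor.lid_tmk_one M _

theorem LMod.tensorUnit_comp_unitTensor (M : LMod.{u, w} A) :
    (LMod.tensorUnit M).comp (LMod.unitTensor M) = LMod.Hom.id M :=
  LMod.Hom.ext (ContinuousLinearMap.ext fun x => CTensor.lid_tmk_one M x)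

theorem LMod.unitTensor_comp_tensorUnit (M : LMod.{u, w} A) :
    (LMod.unitTensor M).comp (LMod.tensorUnit M) = LMod.Hom.id _ :=
  LMod.Hom.ext (ContinuousLinearMap.ext fun x => CTensor.tmk_one_lid M x)

/-- A projective resolution `Q` of the trivial module gives the projective resolution `Q ⊗ M`
of `M`. -/
def ProjResolution.tensor (Q : ProjResolution (LMod.trivial A)) (M : LMod.{u, u} A) :
    ProjResolution M where
  obj n := LMod.tensor (Q.obj n) M
  aug := (LMod.tensorUnit M).comp (Q.aug.tensorRight M)
  d n := (Q.d n).tensorRight M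
  projective n := (Q.projective n).tensor M
  admissible := by
    have h := Q.admissible.tensorRight M
    exact h.of_retract (C' := fun n => Q.obj n ⊗̂ M) (CTensor.lid M) (fun n => .id ℂ _)
      (CTensor.mkRight (1 : ℂ)) (fun n => .id ℂ _) (fun x => rfl) (fun n x => rfl)
      (fun x => (CTensor.tmk_one_lid M _).symm) (fun n x => rfl) (fun x => CTensor.lid_tmk_one M x)
      (fun n x => rfl)

end TensorResolution

/-! ### Localizations and weak localizations of Hopf algebras -/

section Main

variable {U H : Type u}
    [Ring U] [Algebra ℂ U] [UniformSpace U] [IsTensorAlgebra U] [HopfTensorAlgebra U]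
    [Ring H] [Algebra ℂ H] [UniformSpace H] [IsTensorAlgebra H] [HopfTensorAlgebra H]
    {θ : U →A[ℂ] H} (hθ : IsHopfHom θ)

open HopfTensorAlgebra

/-- The isomorphism `H ⊗̂_U M → (H ⊗̂_U ℂ) ⊗̂ M`, `h ⊗ x ↦ (h₁ ⊗ 1) ⊗ h₂ x`, the tensor identity for
the trivial module. -/
def unitIdentity (M : LMod.{u, w} H) : TensorOver (rightVia θ) (M.restrict θ) →L[ℂ]
    TensorOver (rightVia θ) (LMod.trivial U) ⊗̂ M :=
  (tensorIdentity (LMod.trivial U) M hθ).comp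
    (TensorOver.map (rightVia θ) (LMod.unitTensor (M.restrict θ)))

/-- The inverse of `unitIdentity`. -/
def unitIdentitySymm (M : LMod.{u, w} H) : TensorOver (rightVia θ) (LMod.trivial U) ⊗̂ M →L[ℂ]
    TensorOver (rightVia θ) (M.restrict θ) :=
  (TensorOver.map (rightVia θ) (LMod.tensorUnit (M.restrict θ))).comp
    (tensorIdentitySymm (LMod.trivial U) M hθ)

theorem unitIdentity_unitIdentitySymm (M : LMod.{u, w} H)
    (t : TensorOver (rightVia θ) (LMod.trivial U) ⊗̂ M) :
    unitIdentity hθ M (unitIdentitySymm hθ M t) = t := by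
  rw [unitIdentity, unitIdentitySymm, ContinuousLinearMap.comp_apply,
    ContinuousLinearMap.comp_apply, TensorOver.map_map, LMod.unitTensor_comp_tensorUnit,
    TensorOver.map_id, ContinuousLinearMap.id_apply, tensorIdentity_tensorIdentitySymm]

theorem unitIdentitySymm_unitIdentity (M : LMod.{u, w} H)
    (t : TensorOver (rightVia θ) (M.restrict θ)) :
    unitIdentitySymm hθ M (unitIdentity hθ M t) = t := by
  rw [unitIdentity, unitIdentitySymm, ContinuousLinearMap.comp_apply,
    ContinuousLinearMap.comp_apply, tensorIdentitySymm_tensorIdentity, TensorOver.map_map,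
    LMod.tensorUnit_comp_unitTensor, TensorOver.map_id, ContinuousLinearMap.id_apply]

theorem unitIdentity_natural {N : LMod.{u, v} U} (φ : LMod.Hom N (LMod.trivial U))
    (M : LMod.{u, w} H)
    (t : TensorOver (rightVia θ) (LMod.tensor N (M.restrict θ))) :
    unitIdentity hθ M (TensorOver.map (rightVia θ)
      ((LMod.tensorUnit (M.restrict θ)).comp (φ.tensorRight (M.restrict θ))) t) =
      CTensor.map (TensorOver.map (rightVia θ) φ) (.id ℂ M) (tensorIdentity N M hθ t) := by
  rw [unitIdentity, ContinuousLinearMap.comp_apply, TensorOver.map_map, ← tensorIdentity_natural,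
    ← LMod.Hom.comp_assoc, LMod.unitTensor_comp_tensorUnit]
  rfl

theorem unitIdentitySymm_natural {N : LMod.{u, v} U} (φ : LMod.Hom N (LMod.trivial U))
    (M : LMod.{u, w} H) (t : TensorOver (rightVia θ) N ⊗̂ M) :
    TensorOver.map (rightVia θ)
      ((LMod.tensorUnit (M.restrict θ)).comp (φ.tensorRight (M.restrict θ)))
        (tensorIdentitySymm N M hθ t) =
      unitIdentitySymm hθ M (CTensor.map (TensorOver.map (rightVia θ) φ) (.id ℂ M) t) := by
  rw [← unitIdentitySymm_unitIdentity hθ M (TensorOver.map _ _ _), unitIdentity_natural,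
    tensorIdentity_tensorIdentitySymm]

theorem unitIdentity_viaProj (M : LMod.{u, w} H) (x : H) (m : M) :
    unitIdentity hθ M (viaProj θ (M.restrict θ) (tmk x m : H ⊗̂ M)) =
      CTensor.map ((viaProj θ (LMod.trivial U)).comp (CTensor.mkLeft (1 : ℂ) : H →L[ℂ] H ⊗̂ ℂ))
        (M.orbit m) (comul x) := by
  have h1 : TensorOver.map (rightVia θ) (LMod.unitTensor (M.restrict θ))
      (viaProj θ (M.restrict θ) (tmk x m : H ⊗̂ M)) =
      tensorProj θ (LMod.trivial U) M (tmk x (tmk (1 : ℂ) m : ℂ ⊗̂ M)) := by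
    rw [tensorProj]
    exact (map_viaProj (LMod.unitTensor (M.restrict θ)) _).trans
      (congrArg _ (CTensor.map_tmk _ _ _ _))
  rw [unitIdentity, ContinuousLinearMap.comp_apply, h1]
  refine (tensorIdentity_tensorProj hθ _).trans ?_
  refine (congrArg _ (LMod.shearTensor_tmk ℂ M x (1 : ℂ) m)).trans ?_
  exact CTensor.map_map (CTensor.mkLeft (1 : ℂ) : H →L[ℂ] H ⊗̂ ℂ) (M.orbit m)
    (viaProj θ (LMod.trivial U) : H ⊗̂ ℂ →L[ℂ] _) (.id ℂ M) (comul x)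

attribute [irreducible] unitIdentity unitIdentitySymm

/-- The map `t ⊗ x ↦ ε(x) t`, a left inverse of `t ↦ t ⊗ 1`. -/
def tensorCounit (E : Type*) [AddCommGroup E] [Module ℂ E] [UniformSpace E] [IsCompleteLCS E] :
    E ⊗̂ H →L[ℂ] E :=
  (CTensor.rid E).comp (CTensor.map (.id ℂ E) (counit (H := H)).toContinuousLinearMap)

@[simp]
theorem tensorCounit_tmk {E : Type*} [AddCommGroup E] [Module ℂ E] [UniformSpace E]
    [IsCompleteLCS E] (x : E) (a : H) : tensorCounit E (tmk x a) = counit a • x := by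
  simp [tensorCounit]

theorem tensorCounit_map {E F : Type*} [AddCommGroup E] [Module ℂ E] [UniformSpace E]
    [IsCompleteLCS E] [AddCommGroup F] [Module ℂ F] [UniformSpace F] [IsCompleteLCS F]
    (f : E →L[ℂ] F) (t : E ⊗̂ H) :
    tensorCounit F (CTensor.map f (.id ℂ H) t) = f (tensorCounit E t) := by
  have h : (tensorCounit F).comp (CTensor.map f (.id ℂ H)) = f.comp (tensorCounit E) :=
    CTensor.ext fun x a => by simp
  exact DFunLike.congr_fun h t

/-- A complex is a retract of its tensor product with `H`, by means of the unit and the counit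
of `H`. -/
theorem IsAdmissible.of_tensorRight {X : Type*} {C : ℕ → Type*} [AddCommGroup X] [Module ℂ X]
    [UniformSpace X] [IsCompleteLCS X] [∀ n, AddCommGroup (C n)] [∀ n, Module ℂ (C n)]
    [∀ n, UniformSpace (C n)] [∀ n, IsCompleteLCS (C n)] {e : C 0 →L[ℂ] X}
    {d : ∀ n, C (n + 1) →L[ℂ] C n} (h : IsAdmissible (C := fun n => C n ⊗̂ H)
      (CTensor.map e (.id ℂ H)) fun n => CTensor.map (d n) (.id ℂ H)) : IsAdmissible e d :=
  h.of_retract (tensorCounit X) (fun n => tensorCounit (C n)) (CTensor.mkLeft 1)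
    (fun n => CTensor.mkLeft 1) (fun x => (tensorCounit_map e x).symm)
    (fun n x => (tensorCounit_map (d n) x).symm) (fun x => by simp) (fun n x => by simp)
    (fun x => by simp) (fun n x => by simp)

include hθ

/-- By the tensor identity, `H ⊗̂_U (Q ⊗ H)` is isomorphic to `(H ⊗̂_U Q) ⊗̂ H`. -/
theorem stronglyTransversal_iff :
    StronglyTransversal (rightVia θ) (leftVia θ) ↔
      StronglyTransversal (rightVia θ) (LMod.trivial U) := by
  constructor
  · intro h
    let Q := LMod.barResolution (LMod.trivial U)
    have h1 := h.isAdmissible (Q.tensor (leftVia θ))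
    refine ⟨Q, IsAdmissible.of_tensorRight (H := H) ?_⟩
    exact h1.of_retract (unitIdentity hθ (LMod.self H))
      (fun n => tensorIdentity (Q.obj n) (LMod.self H) hθ) (unitIdentitySymm hθ (LMod.self H))
      (fun n => tensorIdentitySymm (Q.obj n) (LMod.self H) hθ)
      (fun x => (unitIdentity_natural hθ Q.aug (LMod.self H) x).symm)
      (fun n x => (tensorIdentity_natural (M := LMod.self H) hθ (Q.d n) x).symm)
      (fun x => unitIdentitySymm_natural hθ Q.aug (LMod.self H) x)
      (fun n x => tensorIdentitySymm_natural (M := LMod.self H) hθ (Q.d n) x)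
      (unitIdentity_unitIdentitySymm hθ (LMod.self H))
      (fun n x => tensorIdentity_tensorIdentitySymm (N := Q.obj n) (M := LMod.self H) hθ x)
  · rintro ⟨Q, hQ⟩
    refine ⟨Q.tensor (leftVia θ), ?_⟩
    exact (hQ.tensorRight (LMod.self H)).of_retract (unitIdentitySymm hθ (LMod.self H))
      (fun n => tensorIdentitySymm (Q.obj n) (LMod.self H) hθ) (unitIdentity hθ (LMod.self H))
      (fun n => tensorIdentity (Q.obj n) (LMod.self H) hθ)
      (fun x => unitIdentitySymm_natural hθ Q.aug (LMod.self H) x)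
      (fun n x => tensorIdentitySymm_natural (M := LMod.self H) hθ (Q.d n) x)
      (fun x => (unitIdentity_natural hθ Q.aug (LMod.self H) x).symm)
      (fun n x => (tensorIdentity_natural (M := LMod.self H) hθ (Q.d n) x).symm)
      (unitIdentitySymm_unitIdentity hθ (LMod.self H))
      (fun n x => tensorIdentitySymm_tensorIdentity (N := Q.obj n) (M := LMod.self H) hθ x)

omit hθ in
theorem mulOver_viaProj (x y : H) :
    mulOver θ (viaProj θ (leftVia θ) (tmk x y : H ⊗̂ H)) = x * y := by
  rw [viaProj]
  exact (TensorOver.lift_proj _ _ _ _ _).trans (mulMap_tmk x y)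

theorem augOver_viaProj (x : H) (c : ℂ) :
    augOver counit counit θ hθ.counit_comp (viaProj θ (LMod.trivial U) (tmk x c : H ⊗̂ ℂ)) =
      counit x * c := by
  rw [viaProj]
  refine (TensorOver.lift_proj _ _ _ _ _).trans ?_
  exact (congrArg (mulMap ℂ) (CTensor.map_tmk (counit (H := H)).toContinuousLinearMap (.id ℂ ℂ)
    x c)).trans (mulMap_tmk _ _)

/-- Under the isomorphism `H ⊗̂_U H ≅ (H ⊗̂_U ℂ) ⊗̂ H`, the multiplication `H ⊗̂_U H → H` becomes the
tensor product of `H ⊗̂_U ℂ → ℂ` with `H`. -/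
theorem map_augOver_unitIdentity (t : TensorOver (rightVia θ) (leftVia θ)) :
    CTensor.map (augOver counit counit θ hθ.counit_comp) (.id ℂ H)
      (unitIdentity hθ (LMod.self H) t) = (tmk 1 (mulOver θ t) : ℂ ⊗̂ H) := by
  let α := augOver counit counit θ hθ.counit_comp
  suffices h : (CTensor.map α (.id ℂ H)).comp (unitIdentity hθ (LMod.self H)) =
      (CTensor.mkRight (1 : ℂ)).comp (mulOver θ) from DFunLike.congr_fun h t
  refine via_ext fun x (y : H) => ?_
  let ρ : H →L[ℂ] H := (LMod.self H).orbit y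
  have hρ : ∀ z, ρ z = z * y := (LMod.self H).orbit_apply y
  have h1 : (CTensor.map α (.id ℂ H)).comp (CTensor.map ((viaProj θ (LMod.trivial U)).comp
      (CTensor.mkLeft (1 : ℂ) : H →L[ℂ] H ⊗̂ ℂ)) ρ) =
      (CTensor.mkRight (1 : ℂ)).comp (ρ.comp ((CTensor.lid H).comp
        (CTensor.map (counit (H := H)).toContinuousLinearMap (.id ℂ H)))) := by
    refine CTensor.ext fun p q => ?_
    have h2 : α (viaProj θ (LMod.trivial U) (tmk p (1 : ℂ) : H ⊗̂ ℂ)) = counit p :=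
      (augOver_viaProj hθ p 1).trans (mul_one _)
    have h3 : (tmk (counit p) (q * y) : ℂ ⊗̂ H) = counit p • tmk (1 : ℂ) (q * y) := by
      rw [← LinearMap.smul_apply, ← map_smul, smul_eq_mul, mul_one]
    have h5 : CTensor.map α (.id ℂ H) (CTensor.map ((viaProj θ (LMod.trivial U)).comp
      (CTensor.mkLeft (1 : ℂ) : H →L[ℂ] H ⊗̂ ℂ)) ρ (tmk p q)) =
        (tmk (counit p) (q * y) : ℂ ⊗̂ H) := by
      refine (congrArg _ (CTensor.map_tmk _ _ p q)).trans ?_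
      refine (CTensor.map_tmk α (.id ℂ H) _ _).trans ?_
      exact congrArg₂ (fun (c : ℂ) (z : H) => (tmk c z : ℂ ⊗̂ H)) h2 (hρ q)
    refine h5.trans (h3.trans ?_)
    simp [hρ]
  have h6 := DFunLike.congr_fun (counit_comul (H := H)) x
  have h7 := unitIdentity_viaProj hθ (LMod.self H) x y
  refine (congrArg (CTensor.map α (.id ℂ H)) h7).trans ?_
  refine (DFunLike.congr_fun h1 (comul x)).trans ?_
  refine congrArg (fun z : H => (tmk (1 : ℂ) z : ℂ ⊗̂ H)) ?_
  refine ((congrArg ρ h6).trans (hρ x)).trans ?_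
  exact (mulOver_viaProj x y).symm

theorem mulOver_unitIdentitySymm (t : TensorOver (rightVia θ) (LMod.trivial U) ⊗̂ H) :
    mulOver θ (unitIdentitySymm hθ (LMod.self H) t) = CTensor.lid H
      (CTensor.map (augOver counit counit θ hθ.counit_comp) (.id ℂ H) t) := by
  have h := map_augOver_unitIdentity hθ (unitIdentitySymm hθ (LMod.self H) t)
  have h1 := congrArg (CTensor.map (augOver counit counit θ hθ.counit_comp) (.id ℂ H))
    (unitIdentity_unitIdentitySymm hθ (LMod.self H) t)
  exact ((congrArg _ (h1.symm.trans h)).trans (CTensor.lid_tmk_one H _)).symm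

theorem isTopIso_mulOver_iff :
    IsTopIso (mulOver θ) ↔ IsTopIso (augOver counit counit θ hθ.counit_comp) := by
  constructor
  · intro h
    refine h.of_retract ((unitIdentitySymm hθ (LMod.self H)).comp (CTensor.mkLeft (1 : H)))
      ((tensorCounit (H := H) _).comp (unitIdentity hθ (LMod.self H)))
      (LinearMap.toSpanSingleton ℂ H 1).toContinuousLinearMap
      (counit (H := H)).toContinuousLinearMap (fun x => ?_) (fun x => ?_) (fun x => ?_)
      (fun c => ?_)
    · refine (mulOver_unitIdentitySymm hθ (tmk x (1 : H))).trans ?_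
      simp
    · have h1 := congrArg (tensorCounit (H := H) ℂ) (map_augOver_unitIdentity hθ x)
      rw [tensorCounit_tmk] at h1
      exact ((tensorCounit_map _ _).symm.trans h1).trans (by simp)
    · refine (congrArg (tensorCounit (H := H) _)
        (unitIdentity_unitIdentitySymm hθ (LMod.self H) (tmk x (1 : H)))).trans ?_
      refine (tensorCounit_tmk _ _).trans ?_
      simp
    · simp
  · rintro ⟨g, h1, h2⟩
    have h : IsTopIso (CTensor.map (augOver counit counit θ hθ.counit_comp) (.id ℂ H)) :=
      ⟨CTensor.map g (.id ℂ H),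
        by rw [CTensor.map_comp_map, h1, ContinuousLinearMap.id_comp, CTensor.map_id],
        by rw [CTensor.map_comp_map, h2, ContinuousLinearMap.id_comp, CTensor.map_id]⟩
    exact h.of_retract (unitIdentity hθ (LMod.self H)) (unitIdentitySymm hθ (LMod.self H))
      (CTensor.mkRight (1 : ℂ)) (CTensor.lid H) (map_augOver_unitIdentity hθ)
      (mulOver_unitIdentitySymm hθ) (unitIdentitySymm_unitIdentity hθ (LMod.self H))
      (CTensor.lid_tmk_one H)

end Main

end TopHom

end

theorem mainTheorem7 {U H : Type u}
    [Ring U] [Algebra ℂ U] [UniformSpace U] [TopHom.IsTensorAlgebra U] [TopHom.HopfTensorAlgebra U]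
    [Ring H] [Algebra ℂ H] [UniformSpace H] [TopHom.IsTensorAlgebra H] [TopHom.HopfTensorAlgebra H]
    (hU : TopHom.HasInvertibleAntipode U) (hH : TopHom.HasInvertibleAntipode H)
    (θ : U →A[ℂ] H) (hθ : TopHom.IsHopfHom θ) :
    TopHom.IsLocalizationHom θ ↔
      TopHom.IsWeakLocalizationHom TopHom.HopfTensorAlgebra.counit TopHom.HopfTensorAlgebra.counit
        θ hθ.counit_comp :=
  (and_congr (TopHom.isTopIso_mulOver_iff hθ) (TopHom.stronglyTransversal_iff hθ)).trans and_comm
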